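/- Let $F$ be a local field (a non-discrete locally compact field: $\mathbb R$, $\mathbb C$ or non-Archimedean, of any characteristic), $\|\cdot\|$ its module ($\mu_F(xS)=\|x\|\mu_F(S)$), $B=F^\times$ with Haar measure $d_Bx=d_Fx/\|x\|$, $\hat B$ the Pontryagin dual of $B$ with the dual Haar measure ($\int_{\hat B}\alpha(x)\,d\alpha=\delta_B(x)$), and $A=\hat B\times B$, written additively, with Fourier kernel $\langle(\alpha,x);(\beta,y)\rangle=\alpha(y)\beta(x)$. For angles $a=(\dot a,\ddot a)$, $c=(\dot c,\ddot c)$ in $C=\mathbb R\times B$ (also written additively) put $b=\varpi-a-c$, $\varpi=(1,-1)$, and $$\Psi_{a,c}(\alpha,x)=\frac{1}{\alpha((1-\ddot a x)\ddot c)}\frac{\|\ddot a x\|^{\dot c}}{\|1-\ddot a x\|^{1-\dot a}},\qquad \bar\Psi_{a,c}(\alpha,x)=\alpha\big((1-x/\ddot a)/\ddot c\big)\frac{\|x/\ddot a\|^{\dot c}}{\|1-x/\ddot a\|^{1-\dot a}} .$$ Consider the 4-simplex with ordered vertices $0,\dots,4$, and let $T_i$ be the tetrahedron opposite to the vertex $i$,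 with the induced order of its vertices. In the standard ordered pentagon $P$ all $T_i$ are positive, $T_1,T_3$ form one side and $T_0,T_2,T_4$ (sharing the edge $13$) the other. An ordering of the vertices of $P$ is given by a permutation $\sigma\in S_5$, which renames the vertex $v$ as $\sigma(v)$; then the sides are $\{T_i\}_{i\in I}$, $I=\{\sigma(1),\sigma(3)\}$, and $\{T_i\}_{i\notin I}$, and $T_i$ has the sign $\varepsilon_i=\mathrm{sgn}(\sigma)(-1)^{\sigma^{-1}(i)+i}$. (The $120$ permutations give $20$ orderings up to the symmetries of $P$: a pair $I$ and the sign of $\sigma$.) Let $T_i$ carry angles $a_i,b_i,c_i\in C$ with $a_i+b_i+c_i=\varpi$, where $a_i$ belongs to the edges of $T_i$ joining its first and second, or third and fourth vertices, $b_i$ to those joining the first and third, or second and fourth, and $c_i$ to those joining the first and fourth, or second and third. Assume $\dot a_i,\dot b_i,\dot c_i\ge 0$ for all $i$ and that around each of the nine edges $jk$ with $\{j,k\}\ne I$ the sum of the angles of $\{T_i\}_{i\in I}$ equals the sum of the angles of $\{T_i\}_{i\notin I}$. (For $\sigma=1$ this says $a_3=a_2+a_4$, $c_3=a_0+c_4$,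 $c_1=c_0+a_4$, $a_1=a_0+a_2$, $c_2=c_1+c_3$.) Put $\Psi_i=\Psi_{a_i,c_i}$ if $\varepsilon_i=1$ and $\Psi_i=\bar\Psi_{a_i,c_i}$ if $\varepsilon_i=-1$. Let the variables $z_0,\dots,z_4\in A$ of the tetrahedra satisfy $z_1=z_0+z_2$ and $z_3=z_2+z_4$; if $I=\{3,4\}$ let $p=z_0$, $q=z_2$, otherwise let $p=z_i$, $q=z_j$ for $I=\{i<j\}$. Then, for every $\sigma\in S_5$, the pentagon identity of the ordering $\sigma$ holds: as distributions in $(p,q)\in A^2$, $$\prod_{i\in I}\Psi_i(z_i)=\int_A\langle z_0;z_4\rangle^{\mathrm{sgn}(\sigma)}\prod_{i\notin I}\Psi_i(z_i)\,dn\quad\text{if } I\ne\{3,4\},$$ $$\prod_{i\notin I}\Psi_i(z_i)=\int_A\langle z_0;z_4\rangle^{-\mathrm{sgn}(\sigma)}\prod_{i\in I}\Psi_i(z_i)\,dn\quad\text{if } I=\{3,4\},$$ where $n$ is the remaining free variable: $n=z_2$ for $I\in\{03,04,13,14\}$, $n=z_4$ for $I\in\{01,02,12,34\}$, $n=z_0$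 for $I\in\{23,24\}$. For $\sigma=1$ this is $$\Psi_1(\alpha,x)\Psi_3(\beta,y)=\int_{\hat B\times B}\Psi_0(\alpha-\gamma,x/z)\,\Psi_2(\gamma,z)\,\Psi_4(\beta-\gamma,y/z)\,\frac{\alpha(y/z)\beta(x/z)}{\gamma(xy/z^2)}\,d(\gamma,z).$$ Here an identity of distributions means equality after pairing with every test function $f$ on $A^2$: $f$ is continuous, dominated by an integrable function of the two characters, and its partial Fourier transform $(u,v,x,y)\mapsto\int f((\alpha,x),(\beta,y))\alpha(u)\beta(v)\,d(\alpha,\beta)$ has compact support in $B^4$. In the pairing the characters are integrated before the variables in $B$. The integral over $n=(\gamma,z)$ is taken after the pairing with $f$, with the integral over $\gamma\in\hat B$, taken before that over $z$, understood improperly: the integrand is multiplied by $\hat\rho_k(\gamma)=\int_B\gamma(t)\rho_k(t)\,d_Bt$, where $(\rho_k)$ is any sequence of non-negative continuous functions on $B$ with integral $1$, integrable Fourier transform $\hat\rho_k$ and compact supports shrinking to $\{1\}$, and $k\to\infty$. All the integrals to be formed converge absolutely (those with the factor $\hat\rho_k$ for all large $k$; those depending on a variable in $B$ for almost all its values). 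-/

import Mathlib

open MeasureTheory Filter Topology

noncomputable section

namespace OrderedPentagon

/-! ## The local field, its multiplicative group and the Gaussian group `A = B^ × B`

A local field is a nontrivially normed field all of whose closed balls are compact; the norm only
serves to give the topology, the absolute value in the formulas is the module `modulus`. -/

section Basic

variable (F : Type*) [NontriviallyNormedField F]

/-- The group `A = B^ × B`, where `B = Fˣ` and `B^` is its Pontryagin dual; it is written
multiplicatively. -/
abbrev GaussGroup : Type _ := PontryaginDual Fˣ × Fˣ

/-- The group `ℝ × B` of angles, written additively: `a = (ȧ, ä)` has `ȧ = a.1` and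
`ä = a.2.toMul`. -/
abbrev AngleGroup : Type _ := ℝ × Additive Fˣ

/-- The angle `ϖ = (1, -1)`. -/
def halfTurn : AngleGroup F := (1, Additive.ofMul (-1))

variable {F}

/-- The Fourier kernel `⟨(α, x); (β, y)⟩ = α(y) β(x)`. -/
def pairing (p q : GaussGroup F) : Circle := p.1 q.2 * q.1 p.2

theorem pairing_mul_left (p p' q : GaussGroup F) :
    pairing (p * p') q = pairing p q * pairing p' q := by
  have h₁ : (p * p').1 q.2 = p.1 q.2 * p'.1 q.2 := rfl
  have h₂ : q.1 (p * p').2 = q.1 p.2 * q.1 p'.2 := map_mul q.1 p.2 p'.2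
  rw [pairing, h₁, h₂, mul_mul_mul_comm]
  rfl

theorem pairing_mul_right (p q q' : GaussGroup F) :
    pairing p (q * q') = pairing p q * pairing p q' := by
  have h₁ : (q * q').1 p.2 = q.1 p.2 * q'.1 p.2 := rfl
  have h₂ : p.1 (q * q').2 = p.1 q.2 * p.1 q'.2 := map_mul p.1 q.2 q'.2
  rw [pairing, h₁, h₂, mul_mul_mul_comm]
  rfl

/-- The conjugate angle `(ȧ, ä⁻¹)`. -/
def conjAngle (a : AngleGroup F) : AngleGroup F := (a.1, -a.2)

/-- The angle `b` determined by `a + b + c = ϖ`. -/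
def thirdAngle (a c : AngleGroup F) : AngleGroup F := halfTurn F - a - c

variable [ProperSpace F]

open Classical in
/-- The module `‖x‖` of the local field, `μ (x • S) = ‖x‖ μ S` for every Haar measure `μ`
of `(F, +)`. -/
def modulus (x : F) : ℝ := if h : x = 0 then 0 else (distribHaarChar F (Units.mk0 x h) : ℝ)

open Classical in
/-- `Ψ_{a,c}(α, x) = α((1 - ä x) c̈)⁻¹ ‖ä x‖ ^ ċ / ‖1 - ä x‖ ^ (1 - ȧ)`, defined for `ä x ≠ 1`
(the value `0` is assigned on the null set `ä x = 1`). -/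
def Psi (a c : AngleGroup F) (p : GaussGroup F) : ℂ :=
  if h : 1 - ((a.2.toMul * p.2 : Fˣ) : F) = 0 then 0
  else
    (((p.1 (Units.mk0 _ h * c.2.toMul))⁻¹ : Circle) : ℂ) *
      ((modulus ((a.2.toMul * p.2 : Fˣ) : F) ^ c.1 /
        modulus (1 - ((a.2.toMul * p.2 : Fˣ) : F)) ^ (1 - a.1) : ℝ) : ℂ)

/-- `Ψ` with a bar: the complex conjugate of `Ψ` at the conjugate angles. -/
def PsiBar (a c : AngleGroup F) (p : GaussGroup F) : ℂ :=
  (starRingEnd ℂ) (Psi (conjAngle a) (conjAngle c) p)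

/-- The weight of a tetrahedron of sign `ε`: `Ψ` for a positive one, `Ψ` with a bar for a negative
one. -/
def PsiSign (ε : ℤˣ) (a c : AngleGroup F) (p : GaussGroup F) : ℂ :=
  if ε = 1 then Psi a c p else PsiBar a c p

end Basic

/-! ## Measures, test functions and improper integrals -/

section Analysis

variable {F : Type*} [NontriviallyNormedField F]

/-- The Haar measure `d_B x = d_F x / ‖x‖` of `B = Fˣ`. -/
def unitsMeasure [ProperSpace F] [MeasurableSpace F] (μ : Measure F) : Measure Fˣ :=
  (μ.withDensity fun x => ENNReal.ofReal (modulus x)⁻¹).comap Units.val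

/-- `∫_B γ(t) ρ(t) dt`. -/
def charTransform [MeasurableSpace F] (m : Measure Fˣ) (ρ : Fˣ → ℂ) (γ : PontryaginDual Fˣ) : ℂ :=
  ∫ t, (γ t : ℂ) * ρ t ∂m

variable [MeasurableSpace F] [MeasurableSpace (PontryaginDual Fˣ)]

/-- The normalization of the Haar measure `ν` of `B^` relative to the Haar measure `m` of `B`:
`∫_{B^} γ(t) dγ` is the Dirac delta function of `B` at `t = 1`. -/
def IsDualMeasure (m : Measure Fˣ) (ν : Measure (PontryaginDual Fˣ)) : Prop :=
  ∀ ρ : Fˣ → ℂ, Continuous ρ → HasCompactSupport ρ → Integrable (charTransform m ρ) ν →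
    ∫ γ, charTransform m ρ γ ∂ν = ρ 1

/-- Test functions `f` on `A²`: continuous functions, dominated by an integrable function of the
two characters, whose partial Fourier transform
`(u, v, x, y) ↦ ∫∫ α(u) β(v) f((α, x), (β, y)) dα dβ` has compact support in `B⁴`. -/
structure IsTestFunction (ν : Measure (PontryaginDual Fˣ))
    (f : GaussGroup F → GaussGroup F → ℂ) : Prop where
  continuous : Continuous fun r : GaussGroup F × GaussGroup F => f r.1 r.2
  dominated : ∃ g : PontryaginDual Fˣ × PontryaginDual Fˣ → ℝ, Integrable g (ν.prod ν) ∧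
    ∀ p q : GaussGroup F, ‖f p q‖ ≤ g (p.1, q.1)
  compactSupport : HasCompactSupport fun s : (Fˣ × Fˣ) × (Fˣ × Fˣ) =>
    ∫ χ : PontryaginDual Fˣ × PontryaginDual Fˣ,
      (χ.1 s.1.1 : ℂ) * (χ.2 s.1.2 : ℂ) * f (χ.1, s.2.1) (χ.2, s.2.2) ∂(ν.prod ν)

/-- The value `∫_{A²} f(p, q) G(p, q) d(p, q)` on the test function `f` of the distribution given by
the function `G`; the characters are integrated first. -/
def distPairing (m : Measure Fˣ) (ν : Measure (PontryaginDual Fˣ))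
    (f G : GaussGroup F → GaussGroup F → ℂ) : ℂ :=
  ∫ s : Fˣ × Fˣ, (∫ χ : PontryaginDual Fˣ × PontryaginDual Fˣ,
    f (χ.1, s.1) (χ.2, s.2) * G (χ.1, s.1) (χ.2, s.2) ∂(ν.prod ν)) ∂(m.prod m)

/-- The two integrals in `distPairing` converge absolutely. -/
def PairingConverges (m : Measure Fˣ) (ν : Measure (PontryaginDual Fˣ))
    (f G : GaussGroup F → GaussGroup F → ℂ) : Prop :=
  (∀ᵐ s : Fˣ × Fˣ ∂(m.prod m), Integrable (fun χ : PontryaginDual Fˣ × PontryaginDual Fˣ =>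
      f (χ.1, s.1) (χ.2, s.2) * G (χ.1, s.1) (χ.2, s.2)) (ν.prod ν)) ∧
  Integrable (fun s : Fˣ × Fˣ => ∫ χ : PontryaginDual Fˣ × PontryaginDual Fˣ,
      f (χ.1, s.1) (χ.2, s.2) * G (χ.1, s.1) (χ.2, s.2) ∂(ν.prod ν)) (m.prod m)

/-- Approximate identities on `B`: nonnegative continuous functions of integral one whose supports
shrink to `{1}`, with integrable Fourier transforms. -/
structure IsApproxIdentity (m : Measure Fˣ) (ν : Measure (PontryaginDual Fˣ))
    (ρ : ℕ → Fˣ → ℝ) : Prop where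
  continuous : ∀ k, Continuous (ρ k)
  nonneg : ∀ k t, 0 ≤ ρ k t
  compactSupport : ∀ k, HasCompactSupport (ρ k)
  integral_eq_one : ∀ k, ∫ t, ρ k t ∂m = 1
  shrink : ∀ U ∈ 𝓝 (1 : Fˣ), ∀ᶠ k in atTop, tsupport (ρ k) ⊆ U
  integrable_transform : ∀ k, Integrable (charTransform m fun t => (ρ k t : ℂ)) ν

/-- `I` is the value on the test function `f` of the distributional integral
`∫_A W(·, ·, n) dn`, `n = (γ, z)`, of a family of distributions on `A²`. The integral over the
characters `γ` is improper: the integrand is multiplied by a factor `∫_B γ(t) ρ_k(t) dt`, which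
tends to `1` as the approximate identity `ρ_k` tends to the delta function of `B`. -/
def HasImproperIntegral (m : Measure Fˣ) (ν : Measure (PontryaginDual Fˣ))
    (f : GaussGroup F → GaussGroup F → ℂ)
    (W : GaussGroup F → GaussGroup F → GaussGroup F → ℂ) (I : ℂ) : Prop :=
  (∀ᵐ z ∂m, ∀ γ : PontryaginDual Fˣ, PairingConverges m ν f fun p q => W p q (γ, z)) ∧
  ∀ ρ : ℕ → Fˣ → ℝ, IsApproxIdentity m ν ρ →
    (∀ᶠ k in atTop,
      (∀ᵐ z ∂m, Integrable (fun γ => charTransform m (fun t => (ρ k t : ℂ)) γ *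
        distPairing m ν f fun p q => W p q (γ, z)) ν) ∧
      Integrable (fun z => ∫ γ, charTransform m (fun t => (ρ k t : ℂ)) γ *
        distPairing m ν f (fun p q => W p q (γ, z)) ∂ν) m) ∧
    Tendsto (fun k => ∫ z, (∫ γ, charTransform m (fun t => (ρ k t : ℂ)) γ *
        distPairing m ν f (fun p q => W p q (γ, z)) ∂ν) ∂m) atTop (𝓝 I)

end Analysis

/-! ## Combinatorics of the ordered pentagon

The vertices `0, …, 4` are ordered, `T i` denotes the tetrahedron opposite to the vertex `i`, with
the induced order of its four vertices. In the standard pentagon `P` the positive tetrahedra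
`T 1`, `T 3` make up one side and the positive tetrahedra `T 0`, `T 2`, `T 4`, which share the
edge `13`, the other. A permutation `σ` of the vertices gives the vertex `v` of `P` the new name
`σ v`. -/

section Combinatorics

variable {F : Type*} [NontriviallyNormedField F]

/-- The vertices opposite to the tetrahedra of the side of `P` with two tetrahedra, after the
vertices are renamed by `σ`; this pair is also the edge common to the other three tetrahedra. -/
def twoSide (σ : Equiv.Perm (Fin 5)) : Finset (Fin 5) := {σ 1, σ 3}

/-- The sign of `T i` after renaming the vertices of `P` by `σ`: the sign of the bijection which
`σ` induces between the ordered vertices of the tetrahedron before and after. -/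
def tetSign (σ : Equiv.Perm (Fin 5)) (i : Fin 5) : ℤˣ :=
  Equiv.Perm.sign σ * (-1) ^ ((σ.symm i : ℕ) + (i : ℕ))

/-- The position of the vertex `j ≠ i` among the four ordered vertices of `T i`. -/
def position (i j : Fin 5) : ℕ := if j < i then (j : ℕ) else (j : ℕ) - 1

/-- The angle of `T i` at its edge `jk`: the angles are `a` at the edges `01` and `23`, `c` at the
edges `03` and `12`, and `b = ϖ - a - c` at the edges `02` and `13` (positions in `T i`). -/
def edgeAngle (a c : Fin 5 → AngleGroup F) (i j k : Fin 5) : AngleGroup F :=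
  let e : Finset ℕ := {position i j, position i k}
  if e = {0, 1} ∨ e = {2, 3} then a i
  else if e = {0, 3} ∨ e = {1, 2} then c i
  else thirdAngle (a i) (c i)

/-- The angles of the two sides match: around each of the nine edges which are common to both sides
the total angles of the two sides are the same. -/
def AnglesMatch (σ : Equiv.Perm (Fin 5)) (a c : Fin 5 → AngleGroup F) : Prop :=
  ∀ j k : Fin 5, j ≠ k → ({j, k} : Finset (Fin 5)) ≠ twoSide σ →
    ∑ i ∈ twoSide σ \ {j, k}, edgeAngle a c i j k =
      ∑ i ∈ (twoSide σ)ᶜ \ {j, k}, edgeAngle a c i j k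

/-- The angles `ȧ`, `ḃ`, `ċ` of every tetrahedron are nonnegative. -/
def AnglesNonneg (a c : Fin 5 → AngleGroup F) : Prop :=
  ∀ i, 0 ≤ (a i).1 ∧ 0 ≤ (thirdAngle (a i) (c i)).1 ∧ 0 ≤ (c i).1

/-- The variables `z₀, …, z₄ ∈ A` of the five tetrahedra, subject to `z₁ = z₀ + z₂` and
`z₃ = z₂ + z₄`, in terms of `z₀`, `z₂`, `z₄`. -/
def tetVars (z0 z2 z4 : GaussGroup F) : Fin 5 → GaussGroup F :=
  ![z0, z0 * z2, z2, z2 * z4, z4]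

/-- The variables `z₀, …, z₄` in terms of two external variables `p`, `q` and an internal variable
`n`, when `T i` and `T j`, `i < j`, are the tetrahedra of the side with two tetrahedra. The external
variables are `p = z_i`, `q = z_j`, except for `T 3` and `T 4`, where they are `p = z₀`, `q = z₂`. -/
def pentagonVars (i j : Fin 5) (p q n : GaussGroup F) : Fin 5 → GaussGroup F :=
  match i, j with
  | 0, 1 => tetVars p (q / p) n
  | 0, 3 => tetVars p n (q / n)
  | 0, 4 => tetVars p n q
  | 1, 2 => tetVars (p / q) q n
  | 1, 3 => tetVars (p / n) n (q / n)
  | 1, 4 => tetVars (p / n) n q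
  | 2, 3 => tetVars n p (q / p)
  | 2, 4 => tetVars n p q
  | _, _ => tetVars p q n

theorem pentagonVars_ext (i j : Fin 5) (hij : i < j) (h : (i, j) ≠ (3, 4))
    (p q n : GaussGroup F) :
    pentagonVars i j p q n i = p ∧ pentagonVars i j p q n j = q := by
  fin_cases i <;> fin_cases j <;> first
    | (exfalso; revert hij h; decide)
    | simp [pentagonVars, tetVars]

/-- The states `x i j = x j i` of the face common to `T i` and `T j` determine the variables of the
tetrahedra: with `x₀, x₁, x₂, x₃` the states of the faces of `T i`, opposite to its first, …, last
vertex, the kinematical kernel of a tetrahedron of sign `ε` is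
`⟨x₀; z⟩ ^ ε δ(x₀ - x₁ + x₂) δ(x₂ - x₃ + z)`. On the support of these delta functions the variables
satisfy `z₁ = z₀ + z₂` and `z₃ = z₂ + z₄`, and the phases of the two sides differ by the factor
`⟨z₀; z₄⟩`. -/
theorem kinematics (x : Fin 5 → Fin 5 → GaussGroup F) (hx : ∀ i j, x i j = x j i)
    (z : Fin 5 → GaussGroup F)
    (h₁ : ∀ i, x i (i.succAbove 1) = x i (i.succAbove 0) * x i (i.succAbove 2))
    (h₂ : ∀ i, x i (i.succAbove 3) = x i (i.succAbove 2) * z i) :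
    z = tetVars (z 0) (z 2) (z 4) ∧
    ∏ i, pairing (x i (i.succAbove 0)) (z i) ^ ((-1 : ℤ) ^ (i : ℕ)) = pairing (z 0) (z 4) := by
  have e₀ := h₁ 0
  have e₁ := h₁ 1
  have e₂ := h₁ 2
  have e₃ := h₁ 3
  have e₄ := h₁ 4
  have g₀ := h₂ 0
  have g₁ := h₂ 1
  have g₂ := h₂ 2
  have g₃ := h₂ 3
  have g₄ := h₂ 4
  simp only [show (0 : Fin 5).succAbove 0 = 1 by decide, show (0 : Fin 5).succAbove 1 = 2 by decide,
    show (0 : Fin 5).succAbove 2 = 3 by decide, show (0 : Fin 5).succAbove 3 = 4 by decide,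
    show (1 : Fin 5).succAbove 0 = 0 by decide, show (1 : Fin 5).succAbove 1 = 2 by decide,
    show (1 : Fin 5).succAbove 2 = 3 by decide, show (1 : Fin 5).succAbove 3 = 4 by decide,
    show (2 : Fin 5).succAbove 0 = 0 by decide, show (2 : Fin 5).succAbove 1 = 1 by decide,
    show (2 : Fin 5).succAbove 2 = 3 by decide, show (2 : Fin 5).succAbove 3 = 4 by decide,
    show (3 : Fin 5).succAbove 0 = 0 by decide, show (3 : Fin 5).succAbove 1 = 1 by decide,
    show (3 : Fin 5).succAbove 2 = 2 by decide, show (3 : Fin 5).succAbove 3 = 4 by decide,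
    show (4 : Fin 5).succAbove 0 = 0 by decide, show (4 : Fin 5).succAbove 1 = 1 by decide,
    show (4 : Fin 5).succAbove 2 = 2 by decide, show (4 : Fin 5).succAbove 3 = 3 by decide]
    at e₀ e₁ e₂ e₃ e₄ g₀ g₁ g₂ g₃ g₄
  rw [hx 1 0] at e₁
  rw [hx 3 1, hx 3 0, hx 3 2] at e₃
  rw [hx 4 1, hx 4 0, hx 4 2] at e₄
  rw [hx 3 2] at g₃
  rw [hx 4 3, hx 4 2] at g₄
  have k₁ : z 1 = z 0 * z 2 := by
    rw [e₄, g₀, g₂, e₃] at g₁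
    have := eq_inv_mul_of_mul_eq g₁.symm
    rw [this, mul_mul_mul_comm, inv_mul_cancel_left]
  have k₃ : z 3 = z 2 * z 4 := by
    rw [g₄, g₂, mul_assoc] at g₃
    exact (mul_left_cancel g₃).symm
  refine ⟨?_, ?_⟩
  · funext i
    fin_cases i <;> simp [tetVars, k₁, k₃]
  · simp only [Fin.prod_univ_five]
    simp only [show (0 : Fin 5).succAbove 0 = 1 by decide,
      show (1 : Fin 5).succAbove 0 = 0 by decide, show (2 : Fin 5).succAbove 0 = 0 by decide,
      show (3 : Fin 5).succAbove 0 = 0 by decide, show (4 : Fin 5).succAbove 0 = 0 by decide,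
      hx 1 0, hx 2 0, hx 3 0, hx 4 0, g₀, e₀, k₁, k₃, pairing_mul_left, pairing_mul_right]
    apply Additive.ofMul.injective
    simp

end Combinatorics

/-! ## The pentagon identities -/

section Pentagon

variable {F : Type*} [NontriviallyNormedField F] [ProperSpace F]

/-- The product of the weights of the tetrahedra `T i`, `i ∈ S`. -/
def sideWeight (σ : Equiv.Perm (Fin 5)) (a c : Fin 5 → AngleGroup F) (S : Finset (Fin 5))
    (z : Fin 5 → GaussGroup F) : ℂ :=
  ∏ i ∈ S, PsiSign (tetSign σ i) (a i) (c i) (z i)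

/-- The variables of the pentagon with the vertices renamed by `σ`. -/
def vars (σ : Equiv.Perm (Fin 5)) (p q n : GaussGroup F) : Fin 5 → GaussGroup F :=
  pentagonVars (min (σ 1) (σ 3)) (max (σ 1) (σ 3)) p q n

/-- The relative phase `⟨z₀; z₄⟩ ^ sign σ` of the side with three tetrahedra. -/
def relPhase (σ : Equiv.Perm (Fin 5)) (z : Fin 5 → GaussGroup F) : Circle :=
  pairing (z 0) (z 4) ^ ((Equiv.Perm.sign σ : ℤˣ) : ℤ)

variable [MeasurableSpace F] [MeasurableSpace (PontryaginDual Fˣ)]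

/-- The ordered pentagon identity for the pentagon with the vertices renamed by `σ`, as an identity
of distributions on `A²`. For `{σ 1, σ 3} ≠ {3, 4}` it reads
`∏_{i ∈ {σ 1, σ 3}} Ψ_i(z_i) = ∫_A ⟨z₀; z₄⟩ ^ sign σ ∏_{i ∉ {σ 1, σ 3}} Ψ_i(z_i) dn`,
and for `{σ 1, σ 3} = {3, 4}` it reads
`∫_A ⟨z₀; z₄⟩ ^ (- sign σ) Ψ_3(z₃) Ψ_4(z₄) dn = Ψ_0(z₀) Ψ_1(z₁) Ψ_2(z₂)`,
where `Ψ_i` carries a bar if `T i` is negative. The side without the integral does not depend on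
`n`. -/
def PentagonIdentity (m : Measure Fˣ) (ν : Measure (PontryaginDual Fˣ))
    (σ : Equiv.Perm (Fin 5)) (a c : Fin 5 → AngleGroup F) : Prop :=
  ∀ f : GaussGroup F → GaussGroup F → ℂ, IsTestFunction ν f →
    if twoSide σ = {3, 4} then
      PairingConverges m ν f (fun p q => sideWeight σ a c (twoSide σ)ᶜ (vars σ p q 1)) ∧
      HasImproperIntegral m ν f
        (fun p q n => (((relPhase σ (vars σ p q n))⁻¹ : Circle) : ℂ) *
          sideWeight σ a c (twoSide σ) (vars σ p q n))
        (distPairing m ν f fun p q => sideWeight σ a c (twoSide σ)ᶜ (vars σ p q 1))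
    else
      PairingConverges m ν f (fun p q => sideWeight σ a c (twoSide σ) (vars σ p q 1)) ∧
      HasImproperIntegral m ν f
        (fun p q n => (relPhase σ (vars σ p q n) : ℂ) *
          sideWeight σ a c (twoSide σ)ᶜ (vars σ p q n))
        (distPairing m ν f fun p q => sideWeight σ a c (twoSide σ) (vars σ p q 1))

end Pentagon

end OrderedPentagon

end

noncomputable section

set_option linter.unusedSectionVars false
set_option linter.unusedSimpArgs false

namespace OrderedPentagon

/-! ## The module of a local field -/

section Modulus

variable {F : Type*} [NontriviallyNormedField F] [ProperSpace F]

/-! Each weight is the value of a character at a point of B times a nonnegative function on B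
(`psi_eq`). With external variables (α,x), (β,y) and internal variable (γ,z), the integrand is
therefore α(P) β(Q) γ(N) w, where P, Q, N and w depend on x, y, z only, and the other side is α(P₀)
β(Q₀) w₀. Integrating over α and β replaces the test function by its partial Fourier transform g,
which is continuous with compact support on B⁴. Integrating over γ against the transform of ρ_k
gives ρ_k(N⁻¹) by Fourier inversion. So the identity says that ∫∫∫ g(P,Q,x,y) w δ(N) = ∫∫
g(P₀,Q₀,x,y) w₀ on B, with δ approximated by peaks at 1 (`hasImproperIntegral_of_concentrates`).

Algebra. Let X_i be the variable of T_i scaled by the signed angle, so that X₁ = X₀X₂ and X₃ = X₂X₄.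
In all cases the surface N = 1 is the five-term relation 1 - X₀ = X₄(1 - X₁), 1 - X₄ = X₀(1 - X₃), 1
- X₂ = (1 - X₁)(1 - X₃). On it P, Q become P₀, Q₀, and the angle relations say exactly that w
becomes w₀ times the right Jacobian.

Analysis. With each coordinate chosen as some X_i or its inverse, N = α(y,z)x + β(y,z). Replacing x
by n = N introduces the Jacobian ‖n‖/(‖α‖‖x‖). On the support of g, for n near 1, the logarithms of
P, Q, x, y, n are bounded, and w is at most a constant times ‖α x y z‖. What remains is dominated by
a constant times ‖y‖‖z‖ on a bounded set, integrable for dy dz/(‖y‖‖z‖), so dominated convergence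
allows n = 1. For fixed y the root x is a fractional linear function of z, and a second change of
variables produces the integral of w₀ (`AffineData.concentrates`). Fractional linear maps are
composed of translations, dilations and inversion, whose effect on the measure follows from Haar
invariance alone; hence one argument serves all local fields.

Combinatorics. The signs are ε_i = -sgn(σ)(-1)^i on I and sgn(σ)(-1)^i off I (`tetSign_eq`). Raising
the B-components of the angles to the powers ε_i makes their relations the same for all σ
(`anglePattern_of_match`), and sgn(σ) survives only as a common exponent of the characters. This
leaves the ten pairs I: seven normal forms (the `affineData_*` theorems), three of which are also
used after the reflection i ↦ 4 - i. Constants from the angles are absorbed into translations of B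
and a change of g (`KernelConcentrates.substitution`). The condition at the edge I, where the total
angle is 2ϖ, follows from the other nine (`sum_sideSign_edgeAngle`). -/

@[simp] theorem modulus_zero : modulus (0 : F) = 0 := by simp [modulus]

theorem modulus_of_ne_zero {x : F} (h : x ≠ 0) :
    modulus x = (distribHaarChar F (Units.mk0 x h) : ℝ) := by simp [modulus, h]

theorem modulus_pos {x : F} (h : x ≠ 0) : 0 < modulus x := by
  rw [modulus_of_ne_zero h]
  exact_mod_cast distribHaarChar_pos

theorem modulus_nonneg (x : F) : 0 ≤ modulus x := by
  by_cases h : x = 0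
  · simp [h]
  · exact (modulus_pos h).le

@[simp] theorem modulus_one : modulus (1 : F) = 1 := by
  rw [modulus_of_ne_zero one_ne_zero]
  simp

@[simp] theorem modulus_mul (x y : F) : modulus (x * y) = modulus x * modulus y := by
  by_cases hx : x = 0
  · simp [hx]
  by_cases hy : y = 0
  · simp [hy]
  rw [modulus_of_ne_zero hx, modulus_of_ne_zero hy, modulus_of_ne_zero (mul_ne_zero hx hy),
    Units.mk0_mul, map_mul]
  rfl

@[simp] theorem modulus_inv (x : F) : modulus x⁻¹ = (modulus x)⁻¹ := by
  by_cases hx : x = 0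
  · simp [hx]
  exact eq_inv_of_mul_eq_one_left (by rw [← modulus_mul, inv_mul_cancel₀ hx, modulus_one])

@[simp] theorem modulus_div (x y : F) : modulus (x / y) = modulus x / modulus y := by
  rw [div_eq_mul_inv, modulus_mul, modulus_inv, div_eq_mul_inv]

variable [MeasurableSpace F] [BorelSpace F] (μ : Measure F) [μ.IsAddHaarMeasure]

open Pointwise in
theorem measure_smul_set (x : F) (hx : x ≠ 0) (S : Set F) :
    μ (x • S) = ENNReal.ofReal (modulus x) * μ S := by
  have := distribHaarChar_mul μ (Units.mk0 x hx) S
  rw [modulus_of_ne_zero hx, ENNReal.ofReal_coe_nnreal, this]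
  rfl

open Pointwise in
theorem measure_closedBall (x : F) (hx : x ≠ 0) :
    μ (Metric.closedBall 0 ‖x‖) = ENNReal.ofReal (modulus x) * μ (Metric.closedBall 0 1) := by
  rw [← measure_smul_set μ x hx, smul_closedBall x 0 zero_le_one]
  simp

variable (F) in
/-- The ratio of the measure of a closed ball to that of the unit ball. -/
def ballRatio (r : ℝ) : ℝ :=
  (Measure.addHaar : Measure F).real (Metric.closedBall 0 r) /
    (Measure.addHaar : Measure F).real (Metric.closedBall 0 1)

theorem measureReal_closedBall_one_pos :
    0 < (Measure.addHaar : Measure F).real (Metric.closedBall 0 1) :=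
  ENNReal.toReal_pos (Metric.measure_closedBall_pos _ 0 one_pos).ne'
    (isCompact_closedBall (0 : F) 1).measure_lt_top.ne

/-- Multiplication by x ≠ 0 carries the unit ball onto the ball of radius ‖x‖. The module is thus a
monotone function of the norm, which gives its measurability and, with multiplicativity, its
continuity. -/
theorem modulus_eq_ballRatio (x : F) : modulus x = ballRatio F ‖x‖ := by
  rw [ballRatio, eq_div_iff measureReal_closedBall_one_pos.ne']
  by_cases hx : x = 0
  · subst hx
    simp [Measure.real]
  · simp only [Measure.real]
    rw [measure_closedBall _ x hx, ENNReal.toReal_mul, ENNReal.toReal_ofReal (modulus_nonneg x)]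

theorem ballRatio_mono : Monotone (ballRatio F) := by
  intro r s h
  refine div_le_div_of_nonneg_right ?_ measureReal_closedBall_one_pos.le
  exact measureReal_mono (Metric.closedBall_subset_closedBall h)
    (isCompact_closedBall (0 : F) s).measure_lt_top.ne

/-- The closed balls of radius r > 1 decrease to the closed unit ball and have finite measure, so
continuity from above applies. Only this one-sided limit is available directly. -/
theorem tendsto_ballRatio : Tendsto (ballRatio F) (𝓝[>] 1) (𝓝 1) := by
  have h := tendsto_measure_biInter_gt (μ := (Measure.addHaar : Measure F)) (a := (1 : ℝ))
    (s := fun r => Metric.closedBall 0 r)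
    (fun r _ => Metric.isClosed_closedBall.measurableSet.nullMeasurableSet)
    (fun i j _ hij => Metric.closedBall_subset_closedBall hij)
    ⟨2, by norm_num, (isCompact_closedBall (0 : F) 2).measure_lt_top.ne⟩
  have h₁ : (⋂ r : ℝ, ⋂ _ : r > 1, Metric.closedBall (0 : F) r) = Metric.closedBall 0 1 := by
    ext x
    simp only [Set.mem_iInter, mem_closedBall_zero_iff]
    exact ⟨fun h => le_of_forall_gt_imp_ge_of_dense h, fun h r hr => h.trans hr.le⟩
  rw [h₁] at h
  have h₂ := (ENNReal.tendsto_toReal (isCompact_closedBall (0 : F) 1).measure_lt_top.ne).comp h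
  have h₃ := h₂.div_const ((Measure.addHaar : Measure F).real (Metric.closedBall 0 1))
  have h₄ := div_self (measureReal_closedBall_one_pos (F := F)).ne'
  rw [show ENNReal.toReal (Measure.addHaar (Metric.closedBall (0 : F) 1)) = _ from rfl] at h₃
  unfold Measure.real at h₃ h₄
  rw [h₄] at h₃
  exact h₃

theorem measurable_modulus : Measurable (modulus : F → ℝ) := by
  have : (modulus : F → ℝ) = fun x => ballRatio F ‖x‖ := funext modulus_eq_ballRatio
  rw [this]
  exact ballRatio_mono.measurable.comp measurable_norm

end Modulus

/-! ### Continuity and logarithm of the module -/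

section Continuity

variable {F : Type*} [NontriviallyNormedField F] [ProperSpace F]

theorem modulus_le_modulus {x y : F} (h : ‖x‖ ≤ ‖y‖) : modulus x ≤ modulus y := by
  borelize F
  rw [modulus_eq_ballRatio, modulus_eq_ballRatio]
  exact ballRatio_mono h

/-- Right continuity of the ball ratio bounds the module from above near 1; the lower bound is the
upper bound at x⁻¹. -/
theorem continuousAt_modulus_one : ContinuousAt (modulus : F → ℝ) 1 := by
  borelize F
  have key : ∀ ε > 0, ∀ᶠ x : F in 𝓝 1, modulus x < 1 + ε := by
    intro ε hε
    have h₁ : ∀ᶠ r in 𝓝[>] (1 : ℝ), ballRatio F r < 1 + ε :=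
      tendsto_ballRatio.eventually_lt_const (by linarith)
    obtain ⟨r, hr, hr'⟩ := (h₁.and self_mem_nhdsWithin).exists
    have h₂ : ∀ᶠ x : F in 𝓝 1, ‖x‖ < r :=
      (continuous_norm.tendsto (1 : F)).eventually_lt_const (by simpa using hr')
    filter_upwards [h₂] with x hx
    rw [modulus_eq_ballRatio]
    exact (ballRatio_mono hx.le).trans_lt hr
  have hinv : Tendsto (fun x : F => x⁻¹) (𝓝 1) (𝓝 1) := by
    simpa using (tendsto_inv₀ (one_ne_zero (α := F)))
  rw [ContinuousAt, modulus_one, tendsto_order]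
  constructor
  · intro a ha
    by_cases ha0 : a ≤ 0
    · filter_upwards [isOpen_ne.mem_nhds (one_ne_zero (α := F))] with x hx
      exact ha0.trans_lt (modulus_pos hx)
    · push Not at ha0
      have hpos : 0 < a⁻¹ - 1 := by
        have := (one_lt_inv₀ ha0).2 ha
        linarith
      filter_upwards [hinv.eventually (key _ hpos), isOpen_ne.mem_nhds (one_ne_zero (α := F))]
        with x hx hx0
      rw [modulus_inv, add_sub_cancel] at hx
      exact (inv_lt_inv₀ (modulus_pos hx0) ha0).1 hx
  · intro a ha
    filter_upwards [key (a - 1) (by linarith)] with x hx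
    linarith

theorem continuousAt_modulus {x : F} (hx : x ≠ 0) : ContinuousAt (modulus : F → ℝ) x := by
  have h₁ : Tendsto (fun y : F => y / x) (𝓝 x) (𝓝 1) := by
    have : Tendsto (fun y : F => y / x) (𝓝 x) (𝓝 (x / x)) := tendsto_id.div_const x
    rwa [div_self hx] at this
  have h₂ := (continuousAt_modulus_one.tendsto.comp h₁).const_mul (modulus x)
  rw [modulus_one, mul_one] at h₂
  refine h₂.congr fun y => ?_
  simp only [Function.comp, modulus_div]
  rw [mul_div_cancel₀ _ (modulus_pos hx).ne']

/-- The logarithm of the module. -/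
def logMod (x : F) : ℝ := Real.log (modulus x)

theorem logMod_mul {x y : F} (hx : x ≠ 0) (hy : y ≠ 0) :
    logMod (x * y) = logMod x + logMod y := by
  rw [logMod, modulus_mul, Real.log_mul (modulus_pos hx).ne' (modulus_pos hy).ne', logMod, logMod]

theorem logMod_inv (x : F) : logMod x⁻¹ = -logMod x := by
  rw [logMod, modulus_inv, Real.log_inv, logMod]

theorem logMod_div {x y : F} (hx : x ≠ 0) (hy : y ≠ 0) :
    logMod (x / y) = logMod x - logMod y := by
  rw [div_eq_mul_inv, logMod_mul hx (inv_ne_zero hy), logMod_inv, sub_eq_add_neg]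

theorem exp_logMod {x : F} (hx : x ≠ 0) : Real.exp (logMod x) = modulus x :=
  Real.exp_log (modulus_pos hx)

theorem continuousAt_logMod {x : F} (hx : x ≠ 0) : ContinuousAt (logMod : F → ℝ) x :=
  (continuousAt_modulus hx).log (modulus_pos hx).ne'

theorem measurable_logMod [MeasurableSpace F] [BorelSpace F] : Measurable (logMod : F → ℝ) :=
  Real.measurable_log.comp measurable_modulus

/-- On an annulus the logarithm of the module is bounded. -/
theorem exists_abs_logMod_le (R : ℝ) :
    ∃ L : ℝ, 0 ≤ L ∧ ∀ x : F, ‖x‖ ≤ R → ‖x⁻¹‖ ≤ R → x ≠ 0 → |logMod x| ≤ L := by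
  obtain ⟨w, hw⟩ := NormedField.exists_lt_norm F (max R 1)
  have hw1 : 1 < ‖w‖ := (le_max_right _ _).trans_lt hw
  have hwR : R < ‖w‖ := (le_max_left _ _).trans_lt hw
  have key : ∀ x : F, ‖x‖ ≤ R → x ≠ 0 → logMod x ≤ logMod w := fun x hx hx0 =>
    Real.log_le_log (modulus_pos hx0) (modulus_le_modulus (hx.trans hwR.le))
  refine ⟨logMod w, ?_, fun x h₁ h₂ h₃ => abs_le.2 ⟨?_, key x h₁ h₃⟩⟩
  · apply Real.log_nonneg
    rw [← modulus_one (F := F)]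
    exact modulus_le_modulus (by simpa using hw1.le)
  · have := key x⁻¹ h₂ (inv_ne_zero h₃)
    rw [logMod_inv] at this
    linarith

end Continuity

/-! ## The Haar measures of the additive and the multiplicative group -/

section Measures

variable {F : Type*} [NontriviallyNormedField F] [ProperSpace F]

instance : SecondCountableTopology Fˣ := Units.isEmbedding_val₀.secondCountableTopology

variable [MeasurableSpace F] [BorelSpace F]

theorem measurableEmbedding_val : MeasurableEmbedding (Units.val : Fˣ → F) := by
  refine ⟨Units.val_injective, comap_measurable _, ?_⟩
  rintro s ⟨t, ht, rfl⟩
  rw [Set.image_preimage_eq_inter_range]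
  exact ht.inter Units.isOpenEmbedding_val.isOpen_range.measurableSet

instance : BorelSpace Fˣ :=
  measurableEmbedding_val.borelSpace Units.isEmbedding_val₀.isInducing

variable (μ : Measure F)

/-- The density `dx / ‖x‖` on the additive group. -/
def mulMeasure : Measure F := μ.withDensity fun x => ENNReal.ofReal (modulus x)⁻¹

theorem measurable_invModulus :
    Measurable fun x : F => ENNReal.ofReal (modulus x)⁻¹ :=
  measurable_modulus.inv.ennreal_ofReal

theorem range_val : Set.range (Units.val : Fˣ → F) = {0}ᶜ := by
  ext x
  simp only [Set.mem_range, Set.mem_compl_iff, Set.mem_singleton_iff]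
  exact ⟨fun ⟨u, hu⟩ => hu ▸ u.ne_zero, fun h => ⟨Units.mk0 x h, rfl⟩⟩

theorem map_val_unitsMeasure : (unitsMeasure μ).map Units.val = mulMeasure μ := by
  rw [unitsMeasure, measurableEmbedding_val.map_comap, range_val]
  -- The density vanishes at 0 by the convention 0⁻¹ = 0, so {0} is null whatever μ is.
  refine Measure.restrict_eq_self_of_ae_mem ?_
  rw [ae_iff]
  simp

theorem measurePreserving_val : MeasurePreserving Units.val (unitsMeasure μ) (mulMeasure μ) :=
  ⟨measurableEmbedding_val.measurable, map_val_unitsMeasure μ⟩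

variable [μ.IsAddHaarMeasure]

instance : SigmaFinite (mulMeasure μ) := SigmaFinite.withDensity_ofReal _

/-- Multiplication by c is a measurable equivalence, so no measurability of f is needed; this
permits free rewriting in the change of variables below. -/
theorem lintegral_comp_mul_left {c : F} (hc : c ≠ 0) (f : F → ENNReal) :
    ∫⁻ x, f (c * x) * ENNReal.ofReal (modulus c) ∂μ = ∫⁻ x, f x ∂μ := by
  have h : ENNReal.ofReal (modulus c) • μ.map (c * ·) = μ := by
    ext S hS
    rw [Measure.smul_apply, Measure.map_apply (measurable_const_mul c) hS, smul_eq_mul,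
      ← measure_smul_set μ c hc]
    congr 1
    ext x
    rw [Set.mem_smul_set]
    constructor
    · rintro ⟨y, hy, rfl⟩
      exact hy
    · intro hx
      exact ⟨c⁻¹ * x, by simpa [hc] using hx, by simp [hc]⟩
  have e : ∫⁻ x, f x ∂μ.map (c * ·) = ∫⁻ x, f (c * x) ∂μ :=
    lintegral_map_equiv f (Homeomorph.mulLeft₀ c hc).toMeasurableEquiv
  conv_rhs => rw [← h]
  rw [lintegral_smul_measure, smul_eq_mul, e, lintegral_mul_const' _ _ ENNReal.ofReal_ne_top,
    mul_comm]

theorem lintegral_mulMeasure (f : F → ENNReal) :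
    ∫⁻ x, f x ∂mulMeasure μ = ∫⁻ x, ENNReal.ofReal (modulus x)⁻¹ * f x ∂μ := by
  rw [mulMeasure, lintegral_withDensity_eq_lintegral_mul_non_measurable _ measurable_invModulus
    (Eventually.of_forall fun x => ENNReal.ofReal_lt_top)]
  rfl

theorem measurePreserving_mulMeasure_mul_left {c : F} (hc : c ≠ 0) :
    MeasurePreserving (c * ·) (mulMeasure μ) (mulMeasure μ) := by
  refine ⟨measurable_const_mul c, Measure.ext_of_lintegral _ fun f hf => ?_⟩
  rw [lintegral_map hf (measurable_const_mul c), lintegral_mulMeasure, lintegral_mulMeasure]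
  conv_rhs => rw [← lintegral_comp_mul_left μ hc]
  refine lintegral_congr fun x => ?_
  rw [modulus_mul, mul_inv, ENNReal.ofReal_mul (inv_nonneg.2 (modulus_nonneg c)),
    mul_comm, mul_comm _ (ENNReal.ofReal (modulus c)), ← mul_assoc, ← mul_assoc,
    ← ENNReal.ofReal_mul (modulus_nonneg c), mul_inv_cancel₀ (modulus_pos hc).ne',
    ENNReal.ofReal_one, one_mul, mul_comm]

variable (F) in
/-- The annulus of all `x` with `‖x‖ ≤ R` and `‖x⁻¹‖ ≤ R`. -/
def annulus (R : ℝ) : Set F := {x | x ≠ 0 ∧ ‖x‖ ≤ R ∧ ‖x⁻¹‖ ≤ R}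

theorem measurableSet_annulus (R : ℝ) : MeasurableSet (annulus F R) := by
  refine (measurableSet_singleton (0 : F)).compl.inter (MeasurableSet.inter ?_ ?_)
  · exact measurableSet_le measurable_norm measurable_const
  · exact measurableSet_le measurable_inv.norm measurable_const

/-- On the annulus log ‖x‖ is bounded, hence so is the density, and the annulus lies in a compact
ball. -/
theorem mulMeasure_annulus_lt_top (R : ℝ) : mulMeasure μ (annulus F R) < ⊤ := by
  obtain ⟨L, hL, hL'⟩ := exists_abs_logMod_le (F := F) R
  rw [mulMeasure, withDensity_apply _ (measurableSet_annulus R)]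
  have h₁ : ∀ x ∈ annulus F R, ENNReal.ofReal (modulus x)⁻¹ ≤ ENNReal.ofReal (Real.exp L) := by
    rintro x ⟨h₁, h₂, h₃⟩
    refine ENNReal.ofReal_le_ofReal ?_
    rw [← modulus_inv, ← exp_logMod (inv_ne_zero h₁), logMod_inv]
    exact Real.exp_le_exp.2 ((neg_le_abs _).trans (hL' x h₂ h₃ h₁))
  refine (setLIntegral_mono measurable_const h₁).trans_lt ?_
  rw [setLIntegral_const]
  refine ENNReal.mul_lt_top ENNReal.ofReal_lt_top ?_
  refine (measure_mono ?_).trans_lt (isCompact_closedBall (0 : F) R).measure_lt_top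
  rintro x ⟨_, h₂, _⟩
  simpa using h₂

theorem unitsMeasure_apply (S : Set Fˣ) : unitsMeasure μ S = mulMeasure μ (Units.val '' S) :=
  measurableEmbedding_val.comap_apply _ _

theorem exists_annulus_of_isCompact {K : Set Fˣ} (hK : IsCompact K) :
    ∃ R, ∀ u ∈ K, (u : F) ∈ annulus F R := by
  obtain ⟨R₁, h₁⟩ := hK.exists_bound_of_continuousOn (f := fun u : Fˣ => (u : F))
    Units.continuous_val.continuousOn
  obtain ⟨R₂, h₂⟩ := hK.exists_bound_of_continuousOn (f := fun u : Fˣ => ((u⁻¹ : Fˣ) : F))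
    (Units.continuous_val.comp continuous_inv).continuousOn
  refine ⟨max R₁ R₂, fun u hu => ⟨u.ne_zero, (h₁ u hu).trans (le_max_left _ _), ?_⟩⟩
  have := (h₂ u hu).trans (le_max_right R₁ R₂)
  simpa using this

instance : (unitsMeasure μ).IsMulLeftInvariant := ⟨fun u => by
  ext S hS
  rw [Measure.map_apply (measurable_const_mul u) hS, unitsMeasure_apply, unitsMeasure_apply]
  have hS' : MeasurableSet (Units.val '' S : Set F) :=
    measurableEmbedding_val.measurableSet_image.2 hS
  rw [← (measurePreserving_mulMeasure_mul_left μ u.ne_zero).measure_preimage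
    hS'.nullMeasurableSet]
  congr 1
  ext x
  constructor
  · rintro ⟨v, hv, rfl⟩
    exact ⟨u * v, hv, rfl⟩
  · rintro ⟨v, hv, hx⟩
    refine ⟨u⁻¹ * v, by simpa using hv, ?_⟩
    have hx' : u * x = v := hx.symm
    simp [← hx']⟩

instance : (unitsMeasure μ).IsHaarMeasure := by
  obtain ⟨K, hK, hK1⟩ := exists_compact_mem_nhds (1 : Fˣ)
  have hne : (interior K).Nonempty := ⟨1, mem_interior_iff_mem_nhds.2 hK1⟩
  refine Measure.isHaarMeasure_of_isCompact_nonempty_interior _ K hK hne ?_ ?_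
  · intro h0
    have h1 := measure_mono_null (interior_subset : interior K ⊆ K) h0
    have ho : IsOpen (Units.val '' interior K : Set F) :=
      Units.isOpenEmbedding_val.isOpenMap _ isOpen_interior
    rw [unitsMeasure_apply, mulMeasure, withDensity_apply_eq_zero measurable_invModulus] at h1
    refine (ho.measure_pos μ (hne.image _)).ne' (measure_mono_null ?_ h1)
    rintro _ ⟨u, hu, rfl⟩
    refine ⟨?_, u, hu, rfl⟩
    simpa using modulus_pos u.ne_zero
  · obtain ⟨R, hR⟩ := exists_annulus_of_isCompact hK
    rw [unitsMeasure_apply]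
    refine ((measure_mono ?_).trans_lt (mulMeasure_annulus_lt_top μ R)).ne
    rintro _ ⟨u, hu, rfl⟩
    exact hR u hu

/-- The Haar measure of the commutative group B is invariant under inversion; this is transported
along the inclusion of B into F. -/
theorem measurePreserving_mulMeasure_inv :
    MeasurePreserving (fun x : F => x⁻¹) (mulMeasure μ) (mulMeasure μ) := by
  refine ⟨measurable_inv, ?_⟩
  have h := (Measure.measurePreserving_inv (unitsMeasure μ)).map_eq
  conv_lhs => rw [← map_val_unitsMeasure]
  conv_rhs => rw [← map_val_unitsMeasure, ← h]
  rw [Measure.map_map measurable_inv measurableEmbedding_val.measurable,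
    Measure.map_map measurableEmbedding_val.measurable measurable_inv]
  congr 1
  ext u
  simp

/-- The Jacobian ‖x‖⁻² of inversion is obtained from the inversion invariance of dx/‖x‖, without
differentiation, so it holds over every local field. -/
theorem lintegral_comp_inv {f : F → ENNReal} (hf : Measurable f) :
    ∫⁻ x, f x⁻¹ * ENNReal.ofReal (modulus x ^ 2)⁻¹ ∂μ = ∫⁻ x, f x ∂μ := by
  have hm : Measurable fun x : F => f x * ENNReal.ofReal (modulus x) :=
    hf.mul measurable_modulus.ennreal_ofReal
  have h := (measurePreserving_mulMeasure_inv μ).lintegral_comp hm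
  rw [lintegral_mulMeasure, lintegral_mulMeasure] at h
  have h0 : ∀ᵐ x : F ∂μ, x ≠ 0 := by
    rw [ae_iff]
    simp
  calc _ = _ := lintegral_congr fun x => ?_
    _ = _ := h
    _ = _ := lintegral_congr_ae ?_
  · rw [modulus_inv, mul_left_comm, ← ENNReal.ofReal_mul (inv_nonneg.2 (modulus_nonneg x)),
      pow_two, mul_inv]
  · filter_upwards [h0] with x hx
    rw [mul_left_comm, ← ENNReal.ofReal_mul (inv_nonneg.2 (modulus_nonneg x)),
      inv_mul_cancel₀ (modulus_pos hx).ne', ENNReal.ofReal_one, mul_one]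

/-- Change of variables by a fractional linear transformation. -/
theorem lintegral_comp_moebius {a b c d : F} (h : a * d - b * c ≠ 0) {f : F → ENNReal}
    (hf : Measurable f) :
    ∫⁻ x, f ((a * x + b) / (c * x + d)) *
      ENNReal.ofReal (modulus (a * d - b * c) / modulus (c * x + d) ^ 2) ∂μ = ∫⁻ x, f x ∂μ := by
  by_cases hc : c = 0
  · subst hc
    have hd : d ≠ 0 := by
      rintro rfl
      simp at h
    have ha : a ≠ 0 := by
      rintro rfl
      simp at h
    conv_rhs => rw [← lintegral_add_right_eq_self f (b / d),
      ← lintegral_comp_mul_left μ (div_ne_zero ha hd)]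
    refine lintegral_congr fun x => ?_
    have hd' := (modulus_pos hd).ne'
    congr 2
    · rw [zero_mul, zero_add]
      field_simp
    · simp only [modulus_mul, modulus_div, mul_zero, sub_zero, zero_mul, zero_add]
      field_simp
  -- For c ≠ 0 one has (ax + b)/(cx + d) = a/c - ((ad - bc)/c) (cx + d)⁻¹: a dilation, a
  -- translation, an inversion, a dilation and a translation.
  · have e₁ : ∫⁻ x, f x ∂μ = ∫⁻ x, f (x + a / c) ∂μ := (lintegral_add_right_eq_self f _).symm
    have hk : -((a * d - b * c) / c) ≠ 0 := neg_ne_zero.2 (div_ne_zero h hc)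
    rw [e₁]
    conv_rhs => rw [← lintegral_comp_mul_left μ hk]
    have hm : Measurable fun x => f (-((a * d - b * c) / c) * x + a / c) *
      ENNReal.ofReal (modulus (-((a * d - b * c) / c))) := by fun_prop
    conv_rhs => rw [← lintegral_comp_inv μ hm, ← lintegral_add_right_eq_self _ d,
      ← lintegral_comp_mul_left μ hc]
    refine lintegral_congr_ae ?_
    have h0 : ∀ᵐ x : F ∂μ, x ∉ ({-d / c} : Set F) :=
      (Set.countable_singleton _).ae_notMem μ
    filter_upwards [h0] with x hx
    have hx' : c * x + d ≠ 0 := by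
      intro h'
      refine hx (Set.mem_singleton_iff.2 ?_)
      field_simp
      linear_combination h'
    have hneg : modulus (-((a * d - b * c) / c)) = modulus (a * d - b * c) / modulus c := by
      rw [← modulus_div]
      exact le_antisymm (modulus_le_modulus (by simp)) (modulus_le_modulus (by simp))
    rw [hneg, mul_assoc, mul_assoc, ← ENNReal.ofReal_mul (by positivity), ← ENNReal.ofReal_mul
      (div_nonneg (modulus_nonneg _) (modulus_nonneg _))]
    have hc' := (modulus_pos hc).ne'
    have hx'' := (modulus_pos hx').ne'
    congr 2
    · rw [div_eq_iff hx', add_mul, mul_assoc, inv_mul_cancel₀ hx']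
      field_simp
      ring
    · field_simp

/-- The Jacobian of a fractional linear transformation with respect to `mulMeasure`. -/
def mulJacobian (a b c d x : F) : ℝ :=
  modulus (a * d - b * c) / modulus (c * x + d) ^ 2 * modulus x /
    modulus ((a * x + b) / (c * x + d))

theorem mulJacobian_nonneg (a b c d x : F) : 0 ≤ mulJacobian a b c d x :=
  div_nonneg (mul_nonneg (div_nonneg (modulus_nonneg _) (sq_nonneg _)) (modulus_nonneg _))
    (modulus_nonneg _)

theorem measurable_mulJacobian (a b c d : F) : Measurable (mulJacobian a b c d) := by
  have h := measurable_modulus (F := F)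
  unfold mulJacobian
  fun_prop

/-- As an identity of image measures, the change of variables transfers both integrability and
integrals of vector-valued functions. -/
theorem map_moebius {a b c d : F} (h : a * d - b * c ≠ 0) :
    ((mulMeasure μ).withDensity fun x => ((mulJacobian a b c d x).toNNReal : ENNReal)).map
        (fun x => (a * x + b) / (c * x + d)) = mulMeasure μ := by
  have hm : Measurable fun x : F => (a * x + b) / (c * x + d) := by fun_prop
  have hd : Measurable fun x : F => ((mulJacobian a b c d x).toNNReal : ENNReal) :=
    (measurable_mulJacobian a b c d).real_toNNReal.coe_nnreal_ennreal
  refine Measure.ext_of_lintegral _ fun f hf => ?_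
  rw [lintegral_map hf hm]
  refine (lintegral_withDensity_eq_lintegral_mul _ hd (hf.comp hm)).trans ?_
  rw [lintegral_mulMeasure, lintegral_mulMeasure]
  have hg : Measurable fun x : F => ENNReal.ofReal (modulus x)⁻¹ * f x :=
    measurable_invModulus.mul hf
  conv_rhs => rw [← lintegral_comp_moebius μ h hg]
  have h0 : ∀ᵐ x : F ∂μ, x ∉ ({0} : Set F) := (Set.countable_singleton _).ae_notMem μ
  refine lintegral_congr_ae ?_
  filter_upwards [h0] with x hx
  have hx' := (modulus_pos (Set.notMem_singleton_iff.1 hx)).ne'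
  simp only [Pi.mul_apply, Function.comp]
  rw [mul_right_comm (ENNReal.ofReal _), ← mul_assoc]
  congr 1
  rw [← ENNReal.ofReal, ← ENNReal.ofReal_mul (inv_nonneg.2 (modulus_nonneg _)),
    ← ENNReal.ofReal_mul (inv_nonneg.2 (modulus_nonneg _)), mulJacobian]
  congr 1
  field_simp

theorem measurable_moebius (a b c d : F) : Measurable fun x : F => (a * x + b) / (c * x + d) := by
  fun_prop

theorem integrable_comp_moebius {E : Type*} [NormedAddCommGroup E] [NormedSpace ℝ E]
    {a b c d : F} (h : a * d - b * c ≠ 0) {f : F → E}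
    (hf : AEStronglyMeasurable f (mulMeasure μ)) :
    Integrable (fun x => mulJacobian a b c d x • f ((a * x + b) / (c * x + d)))
      (mulMeasure μ) ↔ Integrable f (mulMeasure μ) := by
  have e := map_moebius μ h
  conv_rhs => rw [← e]
  rw [integrable_map_measure (by rwa [e]) (measurable_moebius a b c d).aemeasurable,
    integrable_withDensity_iff_integrable_smul (measurable_mulJacobian a b c d).real_toNNReal]
  refine integrable_congr (Eventually.of_forall fun x => ?_)
  simp only [NNReal.smul_def, Function.comp]
  rw [Real.coe_toNNReal _ (mulJacobian_nonneg _ _ _ _ _)]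

theorem integral_comp_moebius {E : Type*} [NormedAddCommGroup E] [NormedSpace ℝ E]
    {a b c d : F} (h : a * d - b * c ≠ 0) {f : F → E}
    (hf : AEStronglyMeasurable f (mulMeasure μ)) :
    ∫ x, mulJacobian a b c d x • f ((a * x + b) / (c * x + d)) ∂mulMeasure μ =
      ∫ x, f x ∂mulMeasure μ := by
  have e := map_moebius μ h
  conv_rhs => rw [← e]
  rw [integral_map (measurable_moebius a b c d).aemeasurable (by rwa [e]),
    integral_withDensity_eq_integral_smul (measurable_mulJacobian a b c d).real_toNNReal]
  refine integral_congr_ae (Eventually.of_forall fun x => ?_)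
  simp only [NNReal.smul_def]
  rw [Real.coe_toNNReal _ (mulJacobian_nonneg _ _ _ _ _)]

end Measures

/-! ## Concentration of integrals at a hypersurface -/

section Concentration

variable {G : Type*} [One G] [TopologicalSpace G] [MeasurableSpace G]

/-- Nonnegative functions of integral one whose supports shrink to `{1}`. -/
structure IsPeak (η : Measure G) (r : ℕ → G → ℝ) : Prop where
  measurable : ∀ k, Measurable (r k)
  nonneg : ∀ k x, 0 ≤ r k x
  integral_eq_one : ∀ k, ∫ x, r k x ∂η = 1
  shrink : ∀ U ∈ 𝓝 (1 : G), ∀ᶠ k in atTop, ∀ x, r k x ≠ 0 → x ∈ U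

/-- The distributions `T(x, y, z) δ(N(x, y, z))` on the multiplicative group converge absolutely
and have the integral `T₀(x, y)` over `z`, in the sense that `δ` is approximated by peaks. -/
structure Concentrates (η : Measure G) (T : G → G → G → ℂ) (N : G → G → G → G) (T₀ : G → G → ℂ) :
    Prop where
  integrable_slice : ∀ᵐ z ∂η, Integrable (fun s : G × G => T s.1 s.2 z) (η.prod η)
  integrable_limit : Integrable (fun s : G × G => T₀ s.1 s.2) (η.prod η)
  integrable : ∀ r, IsPeak η r → ∀ᶠ k in atTop, Integrable (fun s : (G × G) × G =>
    T s.1.1 s.1.2 s.2 * (r k (N s.1.1 s.1.2 s.2) : ℂ)) ((η.prod η).prod η)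
  tendsto : ∀ r, IsPeak η r → Tendsto (fun k => ∫ s : (G × G) × G,
    T s.1.1 s.1.2 s.2 * (r k (N s.1.1 s.1.2 s.2) : ℂ) ∂(η.prod η).prod η) atTop
      (𝓝 (∫ s : G × G, T₀ s.1 s.2 ∂η.prod η))

end Concentration

/-! ### Peaks and dominating functions on the field -/

section FieldConcentration

variable {F : Type*} [NontriviallyNormedField F] [ProperSpace F] [MeasurableSpace F] [BorelSpace F]

/-- A non-integrable function has integral 0 by convention, so integral one forces integrability. -/
theorem IsPeak.integrable {η : Measure F} {r : ℕ → F → ℝ} (hr : IsPeak η r) (k : ℕ) :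
    Integrable (r k) η :=
  Integrable.of_integral_ne_zero (by rw [hr.integral_eq_one]; exact one_ne_zero)

theorem IsPeak.integrable_mul {η : Measure F} {r : ℕ → F → ℝ} (hr : IsPeak η r) {K : F → ℂ}
    (hK : AEStronglyMeasurable K η) {C : ℝ} {k : ℕ} (hC : ∀ x, r k x ≠ 0 → ‖K x‖ ≤ C) :
    Integrable (fun x => K x * (r k x : ℂ)) η ∧ ∫ x, ‖K x * (r k x : ℂ)‖ ∂η ≤ C := by
  have hb : ∀ x, ‖K x * (r k x : ℂ)‖ ≤ C * r k x := by
    intro x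
    rw [norm_mul, Complex.norm_real, Real.norm_of_nonneg (hr.nonneg k x)]
    by_cases h : r k x = 0
    · simp [h]
    · exact mul_le_mul_of_nonneg_right (hC x h) (hr.nonneg k x)
  have hi : Integrable (fun x => K x * (r k x : ℂ)) η :=
    ((hr.integrable k).const_mul C).mono'
      (hK.mul (Complex.measurable_ofReal.comp (hr.measurable k)).aestronglyMeasurable)
      (Eventually.of_forall hb)
  refine ⟨hi, (integral_mono hi.norm ((hr.integrable k).const_mul C) hb).trans ?_⟩
  rw [integral_const_mul, hr.integral_eq_one, mul_one]

theorem IsPeak.tendsto_integral {η : Measure F} {r : ℕ → F → ℝ} (hr : IsPeak η r) {K : F → ℂ}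
    (hK : AEStronglyMeasurable K η) (hc : ContinuousAt K 1) :
    Tendsto (fun k => ∫ x, K x * (r k x : ℂ) ∂η) atTop (𝓝 (K 1)) := by
  rw [Metric.tendsto_atTop']
  intro ε hε
  have hU : {x | ‖K x - K 1‖ < ε / 2} ∈ 𝓝 (1 : F) := by
    filter_upwards [Metric.continuousAt_iff'.1 hc (ε / 2) (by linarith)] with x hx
    simpa [dist_eq_norm] using hx
  obtain ⟨n, hn⟩ := eventually_atTop.1 (hr.shrink _ hU)
  refine ⟨n, fun k hk => ?_⟩
  have h₁ := hr.integrable_mul (k := k) (C := ε / 2) (hK.sub aestronglyMeasurable_const)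
    (fun x hx => (hn k hk.le x hx).le)
  have h₂ : Integrable (fun x => K 1 * (r k x : ℂ)) η := ((hr.integrable k).ofReal).const_mul _
  have h₃ : ∫ x, K x * (r k x : ℂ) ∂η = ∫ x, (K x - K 1) * (r k x : ℂ) ∂η + K 1 := by
    have h₄ : ∫ x, K 1 * (r k x : ℂ) ∂η = K 1 := by
      rw [integral_const_mul, integral_complex_ofReal, hr.integral_eq_one]
      simp
    have h₅ := integral_add h₁.1 h₂
    rw [h₄] at h₅
    refine Eq.trans ?_ h₅
    refine integral_congr_ae (Eventually.of_forall fun x => ?_)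
    simp only [Pi.sub_apply]
    ring
  rw [h₃, dist_eq_norm, add_sub_cancel_right]
  exact ((norm_integral_le_integral_norm _).trans h₁.2).trans_lt (by linarith)

variable (μ : Measure F) [μ.IsAddHaarMeasure]

/-- The factor ‖y‖ cancels the density 1/‖y‖ and leaves the additive measure of a ball. Products of
two such functions are the dominating functions below. -/
theorem integrable_modulus_ball (R : ℝ) :
    Integrable (fun y : F => (Metric.closedBall (0 : F) R).indicator modulus y) (mulMeasure μ) := by
  refine ⟨(measurable_modulus.indicator Metric.isClosed_closedBall.measurableSet).aestronglyMeasurable, ?_⟩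
  rw [HasFiniteIntegral, lintegral_mulMeasure]
  refine (lintegral_mono (g := (Metric.closedBall (0 : F) R).indicator fun _ => 1)
    fun x => ?_).trans_lt ?_
  · by_cases hx : x ∈ Metric.closedBall (0 : F) R
    · rw [Set.indicator_of_mem hx, Set.indicator_of_mem hx, Real.enorm_of_nonneg (modulus_nonneg x),
        ← ENNReal.ofReal_mul (inv_nonneg.2 (modulus_nonneg x)), ← ENNReal.ofReal_one]
      exact ENNReal.ofReal_le_ofReal inv_mul_le_one
    · simp [hx]
  · rw [lintegral_indicator Metric.isClosed_closedBall.measurableSet]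
    simpa using (isCompact_closedBall (0 : F) R).measure_lt_top

theorem ae_mulMeasure_of_ae {p : F → Prop} (h : ∀ᵐ x ∂μ, p x) : ∀ᵐ x ∂mulMeasure μ, p x :=
  (withDensity_absolutelyContinuous _ _).ae_le h

theorem ae_prod_ne_zero {η : Measure F} [SFinite η] {g : F → F → F}
    (hg : Measurable fun s : F × F => g s.1 s.2) (h : ∀ᵐ y ∂η, ∀ᵐ z ∂η, g y z ≠ 0) :
    ∀ᵐ s : F × F ∂η.prod η, g s.1 s.2 ≠ 0 := by
  have hs : MeasurableSet {s : F × F | g s.1 s.2 ≠ 0} := hg (measurableSet_singleton 0).compl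
  exact (Measure.ae_prod_mem_iff_ae_ae_mem hs).2 h

end FieldConcentration

/-! ### Concentration on a surface which is affine in one variable -/

section AffineConcentration

variable {F : Type*} [NontriviallyNormedField F] [ProperSpace F] [MeasurableSpace F] [BorelSpace F]
variable (μ : Measure F)

/-- Conditions under which `T(x, y, z) δ(α(y, z) x + β(y, z))` concentrates, where `δ` is the delta
function at `1`. Everything is regular outside the zeros of the discriminant `g`, where the equation
`α(y, z) x + β(y, z) = 1` is equivalent to `x` being a fractional linear function of `z`. -/
structure AffineData (T : F → F → F → ℂ) (T₀ : F → F → ℂ) (α β g : F → F → F) : Prop where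
  measurable : Measurable fun s : F × F × F => T s.1 s.2.1 s.2.2
  measurable_limit : Measurable fun s : F × F => T₀ s.1 s.2
  measurable_coeff : Measurable fun s : F × F => α s.1 s.2
  measurable_const : Measurable fun s : F × F => β s.1 s.2
  measurable_disc : Measurable fun s : F × F => g s.1 s.2
  disc_ne_zero : ∀ᵐ y ∂μ, ∀ᵐ z ∂μ, g y z ≠ 0
  coeff_ne_zero : ∀ y z, g y z ≠ 0 → α y z ≠ 0
  slice_bound : ∀ᵐ z ∂μ, ∃ C R, ∀ x y, T x y z ≠ 0 →
    ‖T x y z‖ ≤ C ∧ x ∈ annulus F R ∧ y ∈ annulus F R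
  bound : ∃ C R, ∀ x y z, T x y z ≠ 0 → ‖α y z * x + β y z - 1‖ < 1 / 2 → ‖y‖ ≤ R ∧ ‖z‖ ≤ R ∧
    ‖T x y z‖ ≤ C * (modulus (α y z) * modulus x * modulus y * modulus z)
  root : ∀ y z, g y z ≠ 0 →
    (1 - β y z) / α y z ≠ 0 ∧ ContinuousAt (fun x => T x y z) ((1 - β y z) / α y z)
  solve : ∃ a b c d : F → F, ∀ y z, g y z ≠ 0 → z ≠ 0 ∧ a y * d y - b y * c y ≠ 0 ∧
    (1 - β y z) / α y z = (a y * z + b y) / (c y * z + d y) ∧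
    T ((1 - β y z) / α y z) y z = ((modulus z * modulus (α y z) *
      (modulus (a y * d y - b y * c y) / modulus (c y * z + d y) ^ 2) : ℝ) : ℂ) *
        T₀ ((1 - β y z) / α y z) y

namespace AffineData

variable {μ} {T : F → F → F → ℂ} {T₀ : F → F → ℂ} {α β g : F → F → F}

/-- The integrand after the substitution `n = α(y, z) x + β(y, z)`. -/
def substituted (T : F → F → F → ℂ) (α β : F → F → F) (y z n : F) : ℂ :=
  mulJacobian 1 (-β y z) 0 (α y z) n • T ((1 * n + -β y z) / (0 * n + α y z)) y z

theorem measurable_substituted (h : AffineData μ T T₀ α β g) :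
    Measurable fun s : (F × F) × F => substituted T α β s.1.1 s.1.2 s.2 := by
  have h₁ := measurable_modulus (F := F)
  have h₂ : Measurable fun s : (F × F) × F => α s.1.1 s.1.2 := h.measurable_coeff.comp measurable_fst
  have h₃ : Measurable fun s : (F × F) × F => β s.1.1 s.1.2 := h.measurable_const.comp measurable_fst
  have h₄ : Measurable fun s : (F × F) × F =>
      (1 * s.2 + -β s.1.1 s.1.2) / (0 * s.2 + α s.1.1 s.1.2) :=
    ((measurable_snd.const_mul 1).add h₃.neg).div ((measurable_snd.const_mul 0).add h₂)
  have h₅ : Measurable fun s : (F × F) × F =>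
      T ((1 * s.2 + -β s.1.1 s.1.2) / (0 * s.2 + α s.1.1 s.1.2)) s.1.1 s.1.2 :=
    h.measurable.comp (h₄.prodMk measurable_fst)
  have h₆ : Measurable fun s : (F × F) × F =>
      mulJacobian 1 (-β s.1.1 s.1.2) 0 (α s.1.1 s.1.2) s.2 :=
    (((h₁.comp ((h₂.const_mul 1).sub (h₃.neg.mul_const 0))).div
      ((h₁.comp ((measurable_snd.const_mul 0).add h₂)).pow_const 2)).mul
        (h₁.comp measurable_snd)).div (h₁.comp h₄)
  exact h₆.smul h₅

/-- The Jacobian is ‖n‖/(‖α‖‖x‖), which cancels the factor ‖α‖‖x‖ of the assumed bound and leaves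
‖n‖‖y‖‖z‖ with n near 1. -/
theorem norm_substituted_le (h : AffineData μ T T₀ α β g) :
    ∃ C R, ∀ y z n, g y z ≠ 0 → ‖n - 1‖ < 1 / 2 → ‖substituted T α β y z n‖ ≤
      C * ((Metric.closedBall (0 : F) R).indicator modulus y *
        (Metric.closedBall (0 : F) R).indicator modulus z) := by
  obtain ⟨C, R, hC⟩ := h.bound
  -- Since ‖n - 1‖ < 1/2 gives norm ‖n‖ ≤ 2, the module of any w of norm greater than 2 bounds the
  -- module of n.
  obtain ⟨w, hw⟩ := NormedField.exists_lt_norm F 2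
  refine ⟨|C| * modulus w, R, fun y z n hg hn => ?_⟩
  have hα := h.coeff_ne_zero y z hg
  have hn2 : modulus n ≤ modulus w := by
    refine modulus_le_modulus (le_trans ?_ hw.le)
    calc ‖n‖ = ‖(n - 1) + 1‖ := by rw [sub_add_cancel]
      _ ≤ ‖n - 1‖ + ‖(1 : F)‖ := norm_add_le _ _
      _ ≤ 2 := by rw [norm_one]; linarith
  have hnn : ∀ y : F, 0 ≤ (Metric.closedBall (0 : F) R).indicator modulus y := fun y =>
    Set.indicator_nonneg (fun y _ => modulus_nonneg y) y
  have hpos : 0 ≤ |C| * modulus w * ((Metric.closedBall (0 : F) R).indicator modulus y *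
        (Metric.closedBall (0 : F) R).indicator modulus z) :=
    mul_nonneg (mul_nonneg (abs_nonneg _) (modulus_nonneg _)) (mul_nonneg (hnn _) (hnn _))
  unfold substituted
  set x := (1 * n + -β y z) / (0 * n + α y z) with hx
  have hxn : α y z * x + β y z = n := by
    rw [hx, zero_mul, zero_add, mul_div_cancel₀ _ hα]
    ring
  by_cases hT : T x y z = 0
  · rw [hT, smul_zero, norm_zero]
    exact hpos
  obtain ⟨h₁, h₂, h₃⟩ := hC x y z hT (by rwa [hxn])
  rw [Set.indicator_of_mem (by simpa using h₁), Set.indicator_of_mem (by simpa using h₂), norm_smul,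
    Real.norm_of_nonneg (mulJacobian_nonneg _ _ _ _ _)]
  refine (mul_le_mul_of_nonneg_left h₃ (mulJacobian_nonneg _ _ _ _ _)).trans ?_
  rw [mulJacobian, ← hx]
  have hα' := modulus_pos hα
  have hy := modulus_nonneg y
  have hz := modulus_nonneg z
  -- The root x may be 0 here; then the left side is 0 because of division by zero.
  have hle : modulus n / modulus x * modulus x ≤ modulus w := by
    by_cases hx0 : modulus x = 0
    · rw [hx0, mul_zero]
      exact modulus_nonneg w
    · rwa [div_mul_cancel₀ _ hx0]
  have hge : 0 ≤ modulus n / modulus x * modulus x :=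
    mul_nonneg (div_nonneg (modulus_nonneg _) (modulus_nonneg _)) (modulus_nonneg _)
  calc _ = C * (modulus n / modulus x * modulus x) * (modulus y * modulus z) := by
        simp only [mul_zero, sub_zero, one_mul, zero_mul, zero_add]
        field_simp
    _ ≤ |C| * modulus w * (modulus y * modulus z) := by
        refine mul_le_mul_of_nonneg_right ?_ (mul_nonneg hy hz)
        exact (mul_le_mul_of_nonneg_right (le_abs_self C) hge).trans
          (mul_le_mul_of_nonneg_left hle (abs_nonneg C))

variable [μ.IsAddHaarMeasure]

theorem ae_disc_ne_zero (h : AffineData μ T T₀ α β g) :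
    ∀ᵐ s : F × F ∂(mulMeasure μ).prod (mulMeasure μ), g s.1 s.2 ≠ 0 := by
  refine ae_prod_ne_zero h.measurable_disc (ae_mulMeasure_of_ae μ ?_)
  filter_upwards [h.disc_ne_zero] with y hy
  exact ae_mulMeasure_of_ae μ hy

theorem det_ne_zero {a b : F} (ha : a ≠ 0) : 1 * a - -b * 0 ≠ 0 := by simpa using ha

theorem comp_substitution (h : AffineData μ T T₀ α β g) {y z : F} (hg : g y z ≠ 0) (r : F → ℝ)
    (n : F) : mulJacobian 1 (-β y z) 0 (α y z) n •
      (T ((1 * n + -β y z) / (0 * n + α y z)) y z *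
        (r (α y z * ((1 * n + -β y z) / (0 * n + α y z)) + β y z) : ℂ)) =
      substituted T α β y z n * (r n : ℂ) := by
  have hα := h.coeff_ne_zero y z hg
  have hxn : α y z * ((1 * n + -β y z) / (0 * n + α y z)) + β y z = n := by
    rw [zero_mul, zero_add, mul_div_cancel₀ _ hα]
    ring
  rw [hxn, substituted, smul_mul_assoc]

theorem measurable_slice (h : AffineData μ T T₀ α β g) {r : F → ℝ} (hr : Measurable r) :
    Measurable fun s : (F × F) × F =>
      T s.2 s.1.1 s.1.2 * (r (α s.1.1 s.1.2 * s.2 + β s.1.1 s.1.2) : ℂ) := by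
  have h₂ : Measurable fun s : (F × F) × F => α s.1.1 s.1.2 := h.measurable_coeff.comp measurable_fst
  have h₃ : Measurable fun s : (F × F) × F => β s.1.1 s.1.2 := h.measurable_const.comp measurable_fst
  have h₄ : Measurable fun s : (F × F) × F => (s.2, s.1) := by fun_prop
  exact (h.measurable.comp h₄).mul 
    (Complex.measurable_ofReal.comp (hr.comp ((h₂.mul measurable_snd).add h₃)))

theorem integrable_bound (C R : ℝ) : Integrable (fun s : F × F =>
    C * ((Metric.closedBall (0 : F) R).indicator modulus s.1 *
        (Metric.closedBall (0 : F) R).indicator modulus s.2))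
        ((mulMeasure μ).prod (mulMeasure μ)) :=
  ((integrable_modulus_ball μ R).mul_prod (integrable_modulus_ball μ R)).const_mul C

theorem continuousAt_substituted (h : AffineData μ T T₀ α β g) {y z : F} (hg : g y z ≠ 0) :
    ContinuousAt (substituted T α β y z) 1 := by
  have hα := h.coeff_ne_zero y z hg
  obtain ⟨h₁, h₂⟩ := h.root y z hg
  have e : (1 * 1 + -β y z) / (0 * 1 + α y z) = (1 - β y z) / α y z := by
    rw [one_mul, zero_mul, zero_add, sub_eq_add_neg]
  have hc : ContinuousAt (fun n : F => (1 * n + -β y z) / (0 * n + α y z)) 1 := by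
    refine ContinuousAt.div (by fun_prop) (by fun_prop) ?_
    simpa using hα
  have h₃ : ContinuousAt (fun n => mulJacobian 1 (-β y z) 0 (α y z) n) 1 := by
    unfold mulJacobian
    refine ContinuousAt.div (ContinuousAt.mul (ContinuousAt.div continuousAt_const ?_ ?_) ?_) ?_ ?_
    · refine ContinuousAt.pow ?_ 2
      simp only [zero_mul, zero_add]
      exact continuousAt_const
    · simpa using (modulus_pos hα).ne'
    · exact continuousAt_modulus one_ne_zero
    · refine ContinuousAt.comp (g := modulus) ?_ hc
      rw [e]
      exact continuousAt_modulus h₁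
    · rw [e]
      exact (modulus_pos h₁).ne'
  have h₄ : ContinuousAt (fun n : F => T ((1 * n + -β y z) / (0 * n + α y z)) y z) 1 := by
    refine ContinuousAt.comp (g := fun x => T x y z) ?_ hc
    rwa [e]
  exact h₃.smul h₄

theorem measurable_substituted_slice (h : AffineData μ T T₀ α β g) (y z : F) :
    Measurable (substituted T α β y z) :=
  Measurable.of_uncurry_left (f := fun s : F × F => substituted T α β s.1 s.2)
    h.measurable_substituted (x := (y, z))

theorem integrable_substituted_one (h : AffineData μ T T₀ α β g) :
    Integrable (fun s : F × F => substituted T α β s.1 s.2 1)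
      ((mulMeasure μ).prod (mulMeasure μ)) := by
  obtain ⟨C, R, hC⟩ := h.norm_substituted_le
  refine (integrable_bound (μ := μ) C R).mono'
    (h.measurable_substituted.comp (measurable_prodMk_right (y := (1 : F)))).aestronglyMeasurable ?_
  filter_upwards [h.ae_disc_ne_zero] with s hs
  exact hC s.1 s.2 1 hs (by simp)

/-- The integrals with a peak converge and concentrate at `α(y, z) x + β(y, z) = 1`. -/
theorem integrable_and_tendsto (h : AffineData μ T T₀ α β g) {r : ℕ → F → ℝ}
    (hr : IsPeak (mulMeasure μ) r) :
    (∀ᶠ k in atTop, Integrable (fun s : (F × F) × F =>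
      T s.2 s.1.1 s.1.2 * (r k (α s.1.1 s.1.2 * s.2 + β s.1.1 s.1.2) : ℂ))
        (((mulMeasure μ).prod (mulMeasure μ)).prod (mulMeasure μ))) ∧
    Tendsto (fun k => ∫ s : (F × F) × F,
      T s.2 s.1.1 s.1.2 * (r k (α s.1.1 s.1.2 * s.2 + β s.1.1 s.1.2) : ℂ)
        ∂((mulMeasure μ).prod (mulMeasure μ)).prod (mulMeasure μ)) atTop
      (𝓝 (∫ s : F × F, substituted T α β s.1 s.2 1 ∂(mulMeasure μ).prod (mulMeasure μ))) := by
  obtain ⟨C, R, hC⟩ := h.norm_substituted_le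
  set η := mulMeasure μ
  have hbd := integrable_bound (μ := μ) C R
  have hball : Metric.ball (1 : F) (1 / 2) ∈ 𝓝 1 := Metric.ball_mem_nhds _ (by norm_num)
  have hmT : ∀ k y z, Measurable fun x => T x y z * (r k (α y z * x + β y z) : ℂ) := fun k y z =>
    (h.measurable_slice (hr.measurable k)).comp (measurable_prodMk_left (x := (y, z)))
  have hslice : ∀ k y z, g y z ≠ 0 → (∀ x, r k x ≠ 0 → x ∈ Metric.ball (1 : F) (1 / 2)) →
      Integrable (fun x => T x y z * (r k (α y z * x + β y z) : ℂ)) η ∧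
      ∫ x, ‖T x y z * (r k (α y z * x + β y z) : ℂ)‖ ∂η ≤
        C * ((Metric.closedBall (0 : F) R).indicator modulus y *
        (Metric.closedBall (0 : F) R).indicator modulus z) := by
    intro k y z hg hk
    have hd := det_ne_zero (b := β y z) (h.coeff_ne_zero y z hg)
    have h₁ := hr.integrable_mul (k := k)
      (h.measurable_substituted_slice y z).aestronglyMeasurable
      (fun x hx => hC y z x hg (by simpa [dist_eq_norm] using hk x hx))
    have h₂ := integrable_comp_moebius μ hd (hmT k y z).aestronglyMeasurable
    simp only [h.comp_substitution hg] at h₂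
    refine ⟨h₂.1 h₁.1, ?_⟩
    have h₃ := integral_comp_moebius μ hd (hmT k y z).norm.aestronglyMeasurable
    rw [← h₃]
    refine Eq.trans_le (integral_congr_ae (Eventually.of_forall fun n => ?_)) h₁.2
    simp only
    rw [← h.comp_substitution hg, norm_smul, Real.norm_of_nonneg (mulJacobian_nonneg _ _ _ _ _),
      smul_eq_mul]
  have hint : ∀ᶠ k in atTop, Integrable (fun s : (F × F) × F =>
      T s.2 s.1.1 s.1.2 * (r k (α s.1.1 s.1.2 * s.2 + β s.1.1 s.1.2) : ℂ)) ((η.prod η).prod η) := by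
    filter_upwards [hr.shrink _ hball] with k hk
    have hm := (h.measurable_slice (hr.measurable k)).aestronglyMeasurable
      (μ := (η.prod η).prod η)
    rw [integrable_prod_iff hm]
    constructor
    · filter_upwards [h.ae_disc_ne_zero] with s hs
      exact (hslice k s.1 s.2 hs hk).1
    · refine hbd.mono' hm.norm.integral_prod_right' ?_
      filter_upwards [h.ae_disc_ne_zero] with s hs
      rw [Real.norm_of_nonneg (integral_nonneg fun x => norm_nonneg _)]
      exact (hslice k s.1 s.2 hs hk).2
  refine ⟨hint, ?_⟩
  · have hlim : Tendsto (fun k => ∫ s : F × F,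
        (∫ x, T x s.1 s.2 * (r k (α s.1 s.2 * x + β s.1 s.2) : ℂ) ∂η) ∂η.prod η) atTop
        (𝓝 (∫ s : F × F, substituted T α β s.1 s.2 1 ∂η.prod η)) := by
      refine tendsto_integral_filter_of_dominated_convergence _ ?_ ?_ hbd ?_
      · refine Eventually.of_forall fun k => ?_
        exact (h.measurable_slice (hr.measurable k)).aestronglyMeasurable
          (μ := (η.prod η).prod η) |>.integral_prod_right'
      · filter_upwards [hr.shrink _ hball] with k hk
        filter_upwards [h.ae_disc_ne_zero] with s hs
        exact (norm_integral_le_integral_norm _).trans (hslice k s.1 s.2 hs hk).2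
      · filter_upwards [h.ae_disc_ne_zero] with s hs
        have hd := det_ne_zero (b := β s.1 s.2) (h.coeff_ne_zero s.1 s.2 hs)
        refine (hr.tendsto_integral (h.measurable_substituted_slice s.1 s.2).aestronglyMeasurable
          (h.continuousAt_substituted hs)).congr fun k => ?_
        rw [← integral_comp_moebius μ hd (hmT k s.1 s.2).aestronglyMeasurable]
        simp only [h.comp_substitution hs]
        rfl
    refine hlim.congr' ?_
    filter_upwards [hint] with k hk
    exact (integral_prod _ hk).symm

/-- At n = 1 the integrand is, for fixed y, the pullback of T₀(·, y) under a fractional linear map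
of z, including its Jacobian. -/
theorem substituted_one (h : AffineData μ T T₀ α β g) : ∃ a b c d : F → F, ∀ y z, g y z ≠ 0 →
    a y * d y - b y * c y ≠ 0 ∧ substituted T α β y z 1 =
      mulJacobian (a y) (b y) (c y) (d y) z • T₀ ((a y * z + b y) / (c y * z + d y)) y := by
  obtain ⟨a, b, c, d, hs⟩ := h.solve
  refine ⟨a, b, c, d, fun y z hg => ?_⟩
  obtain ⟨hz, hdet, e₁, e₂⟩ := hs y z hg
  have hα := modulus_pos (h.coeff_ne_zero y z hg)
  obtain ⟨hx, -⟩ := h.root y z hg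
  refine ⟨hdet, ?_⟩
  have e : (1 * 1 + -β y z) / (0 * 1 + α y z) = (1 - β y z) / α y z := by
    rw [one_mul, zero_mul, zero_add, sub_eq_add_neg]
  rw [substituted, e, e₂, ← e₁, mulJacobian, mulJacobian, e, ← e₁, Complex.real_smul,
    Complex.real_smul, ← mul_assoc, ← Complex.ofReal_mul]
  congr 2
  simp only [mul_zero, sub_zero, one_mul, zero_mul, zero_add, modulus_one]
  field_simp

/-- Integrability of T₀ is not assumed. It is inherited from the dominated integrand at n = 1 by
reading the fractional linear substitution backwards, slice by slice in y. -/
theorem integral_limit (h : AffineData μ T T₀ α β g) :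
    Integrable (fun s : F × F => T₀ s.1 s.2) ((mulMeasure μ).prod (mulMeasure μ)) ∧
    ∫ s : F × F, substituted T α β s.1 s.2 1 ∂(mulMeasure μ).prod (mulMeasure μ) =
      ∫ s : F × F, T₀ s.1 s.2 ∂(mulMeasure μ).prod (mulMeasure μ) := by
  obtain ⟨a, b, c, d, hs⟩ := h.substituted_one
  have hi := h.integrable_substituted_one
  set η := mulMeasure μ
  have hgη : ∀ᵐ y ∂η, ∀ᵐ z ∂η, g y z ≠ 0 := by
    refine ae_mulMeasure_of_ae μ ?_
    filter_upwards [h.disc_ne_zero] with y hy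
    exact ae_mulMeasure_of_ae μ hy
  -- The determinant is known to be nonzero only if some z has g(y, z) ≠ 0; nontriviality of the
  -- measure supplies such a z for almost every y.
  have : (ae η).NeBot := by
    rw [ae_neBot]
    intro h0
    have := map_val_unitsMeasure μ
    rw [show mulMeasure μ = 0 from h0, Measure.map_eq_zero_iff
      measurableEmbedding_val.measurable.aemeasurable] at this
    exact NeZero.ne (unitsMeasure μ) this
  have hmT : ∀ y, Measurable fun x => T₀ x y := fun y =>
    h.measurable_limit.comp (measurable_prodMk_right (y := y))
  have hslice : ∀ᵐ y ∂η, ∃ hd : a y * d y - b y * c y ≠ 0,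
      (fun z => substituted T α β y z 1) =ᵐ[η] fun z =>
      mulJacobian (a y) (b y) (c y) (d y) z • T₀ ((a y * z + b y) / (c y * z + d y)) y := by
    filter_upwards [hgη] with y hy
    obtain ⟨z, hz⟩ := hy.exists
    refine ⟨(hs y z hz).1, ?_⟩
    filter_upwards [hy] with z hz
    exact (hs y z hz).2
  have hmsw : AEStronglyMeasurable (fun s : F × F => T₀ s.2 s.1) (η.prod η) :=
    (h.measurable_limit.comp measurable_swap).aestronglyMeasurable
  obtain ⟨hi₁, hi₂⟩ := (integrable_prod_iff hi.aestronglyMeasurable).1 hi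
  have hsw : Integrable (fun s : F × F => T₀ s.2 s.1) (η.prod η) := by
    rw [integrable_prod_iff hmsw]
    constructor
    · filter_upwards [hslice, hi₁] with y ⟨hd, hy⟩ hiy
      exact (integrable_comp_moebius μ hd (hmT y).aestronglyMeasurable).1 (hiy.congr hy)
    · refine hi₂.congr ?_
      filter_upwards [hslice] with y ⟨hd, hy⟩
      refine Eq.trans ?_ (integral_comp_moebius μ hd (hmT y).norm.aestronglyMeasurable)
      refine integral_congr_ae ?_
      filter_upwards [hy] with z hz
      simp only [hz]
      rw [norm_smul, Real.norm_of_nonneg (mulJacobian_nonneg _ _ _ _ _), smul_eq_mul]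
  refine ⟨hsw.swap, ?_⟩
  rw [integral_prod _ hi, ← integral_prod_swap]
  refine Eq.trans ?_ (integral_prod _ hsw).symm
  refine integral_congr_ae ?_
  filter_upwards [hslice] with y ⟨hd, hy⟩
  rw [integral_congr_ae hy]
  exact integral_comp_moebius μ hd (hmT y).aestronglyMeasurable

theorem integrable_slice (h : AffineData μ T T₀ α β g) : ∀ᵐ z ∂mulMeasure μ,
    Integrable (fun s : F × F => T s.1 s.2 z) ((mulMeasure μ).prod (mulMeasure μ)) := by
  filter_upwards [ae_mulMeasure_of_ae μ h.slice_bound] with z ⟨C, R, hC⟩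
  have hfin : ((mulMeasure μ).prod (mulMeasure μ)) (annulus F R ×ˢ annulus F R) ≠ ⊤ := by
    rw [Measure.prod_prod]
    exact (ENNReal.mul_lt_top (mulMeasure_annulus_lt_top μ R) (mulMeasure_annulus_lt_top μ R)).ne
  have hms : MeasurableSet (annulus F R ×ˢ annulus F R) :=
    (measurableSet_annulus R).prod (measurableSet_annulus R)
  have hb : Integrable ((annulus F R ×ˢ annulus F R).indicator fun _ => |C|)
      ((mulMeasure μ).prod (mulMeasure μ)) :=
    (integrable_indicator_iff hms).2 (integrableOn_const hfin)
  refine hb.mono' (h.measurable.comp (by fun_prop :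
    Measurable fun s : F × F => (s.1, s.2, z))).aestronglyMeasurable
    (Eventually.of_forall fun s => ?_)
  by_cases hT : T s.1 s.2 z = 0
  · simp only [hT, norm_zero]
    exact Set.indicator_nonneg (fun _ _ => abs_nonneg C) _
  · obtain ⟨h₁, h₂⟩ := hC s.1 s.2 hT
    rw [Set.indicator_of_mem (Set.mem_prod.2 h₂)]
    exact h₁.trans (le_abs_self C)

/-- The coordinate x is moved to the innermost place, where the substitution is made. Since N enters
only multiplied by T, it has to be affine only where T does not vanish. -/
theorem concentrates (h : AffineData μ T T₀ α β g) {N : F → F → F → F}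
    (hN : ∀ x y z, T x y z ≠ 0 → N x y z = α y z * x + β y z) :
    Concentrates (mulMeasure μ) T N T₀ := by
  set η := mulMeasure μ
  let e : (F × F) × F ≃ᵐ (F × F) × F := MeasurableEquiv.prodAssoc.trans MeasurableEquiv.prodComm
  have he : MeasurePreserving e ((η.prod η).prod η) ((η.prod η).prod η) :=
    (measurePreserving_prodAssoc η η η).trans Measure.measurePreserving_swap
  have hTe : ∀ (r : F → ℝ), (fun s : (F × F) × F =>
      T s.1.1 s.1.2 s.2 * (r (N s.1.1 s.1.2 s.2) : ℂ)) = (fun s : (F × F) × F =>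
      T s.2 s.1.1 s.1.2 * (r (α s.1.1 s.1.2 * s.2 + β s.1.1 s.1.2) : ℂ)) ∘ e := by
    intro r
    funext ⟨⟨x, y⟩, z⟩
    change T x y z * (r (N x y z) : ℂ) = T x y z * (r (α y z * x + β y z) : ℂ)
    by_cases hT : T x y z = 0
    · rw [hT, zero_mul, zero_mul]
    · rw [hN x y z hT]
  refine ⟨h.integrable_slice, h.integral_limit.1, fun r hr => ?_, fun r hr => ?_⟩
  · filter_upwards [(h.integrable_and_tendsto hr).1] with k hk
    rw [hTe, he.integrable_comp_emb e.measurableEmbedding]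
    exact hk
  · rw [← h.integral_limit.2]
    refine (h.integrable_and_tendsto hr).2.congr fun k => ?_
    rw [hTe, ← he.integral_comp e.measurableEmbedding]
    rfl

end AffineData
end AffineConcentration

/-! ### Weights, kernels and a criterion for concentration -/

section Weights

variable {F : Type*} [NontriviallyNormedField F] [ProperSpace F]

theorem modulus_neg (x : F) : modulus (-x) = modulus x :=
  le_antisymm (modulus_le_modulus (by simp)) (modulus_le_modulus (by simp))

theorem logMod_neg (x : F) : logMod (-x) = logMod x := by rw [logMod, modulus_neg, logMod]

open Classical in
/-- `‖X‖ ^ c ‖1 - X‖ ^ (a - 1)`, extended by zero to `X = 0` and `X = 1`. -/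
def weight (a c : ℝ) (X : F) : ℝ :=
  if X = 0 ∨ X = 1 then 0 else Real.exp (c * logMod X + (a - 1) * logMod (1 - X))

theorem weight_eq {a c : ℝ} {X : F} (h₀ : X ≠ 0) (h₁ : 1 - X ≠ 0) :
    weight a c X = Real.exp (c * logMod X + (a - 1) * logMod (1 - X)) := by
  rw [weight, if_neg]
  rintro (h | h)
  · exact h₀ h
  · exact h₁ (by rw [h, sub_self])

theorem ne_of_weight_ne_zero {a c : ℝ} {X : F} (h : weight a c X ≠ 0) : X ≠ 0 ∧ 1 - X ≠ 0 := by
  rw [weight] at h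
  have h' : ¬(X = 0 ∨ X = 1) := fun h' => h (if_pos h')
  push Not at h'
  exact ⟨h'.1, fun e => h'.2 (sub_eq_zero.1 e).symm⟩

theorem continuousAt_weight {a c : ℝ} {X : F} (h₀ : X ≠ 0) (h₁ : 1 - X ≠ 0) :
    ContinuousAt (weight a c : F → ℝ) X := by
  have e : weight a c =ᶠ[𝓝 X] fun X => Real.exp (c * logMod X + (a - 1) * logMod (1 - X)) := by
    filter_upwards [isOpen_ne.mem_nhds h₀, isOpen_ne.mem_nhds
      (fun h => h₁ (by rw [h, sub_self]) : X ≠ 1)] with Y hY₀ hY₁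
    exact weight_eq hY₀ (sub_ne_zero.2 (Ne.symm hY₁))
  refine ContinuousAt.congr ?_ e.symm
  have h₂ : ContinuousAt (fun X : F => logMod (1 - X)) X :=
    ContinuousAt.comp (g := logMod) (continuousAt_logMod h₁) (by fun_prop)
  have h₃ := continuousAt_logMod h₀
  fun_prop

theorem ContinuousAt.weight {β : Type*} [TopologicalSpace β] {f : β → F} {b : β} {a c : ℝ}
    (hf : ContinuousAt f b) (h₀ : f b ≠ 0) (h₁ : 1 - f b ≠ 0) :
    ContinuousAt (fun b => weight a c (f b)) b :=
  ContinuousAt.comp (g := OrderedPentagon.weight a c) (continuousAt_weight h₀ h₁) hf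

variable [MeasurableSpace F] [BorelSpace F]

theorem measurable_weight (a c : ℝ) : Measurable (weight a c : F → ℝ) := by
  have h := measurable_logMod (F := F)
  unfold weight
  refine Measurable.ite ?_ measurable_const (by fun_prop)
  exact (measurableSet_singleton (0 : F)).union (measurableSet_singleton (1 : F))

theorem Measurable.weight {β : Type*} [MeasurableSpace β] {f : β → F} {a c : ℝ}
    (hf : Measurable f) : Measurable fun b => weight a c (f b) :=
  (measurable_weight a c).comp hf

/-- A function on `F⁴` which is continuous outside of the coordinate hyperplanes and has compact
support there. -/
structure IsKernel (φ : F → F → F → F → ℂ) : Prop where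
  measurable : Measurable fun s : F × F × F × F => φ s.1 s.2.1 s.2.2.1 s.2.2.2
  bounded : ∃ M, 0 ≤ M ∧ ∀ p q x y, ‖φ p q x y‖ ≤ M
  support : ∃ R, ∀ p q x y, φ p q x y ≠ 0 →
    p ∈ annulus F R ∧ q ∈ annulus F R ∧ x ∈ annulus F R ∧ y ∈ annulus F R
  continuousAt : ∀ p q x y, p ≠ 0 → q ≠ 0 → x ≠ 0 → y ≠ 0 →
    ContinuousAt (fun s : F × F × F × F => φ s.1 s.2.1 s.2.2.1 s.2.2.2) (p, q, x, y)

namespace IsKernel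

variable {φ : F → F → F → F → ℂ}

theorem measurable_comp {β : Type*} [MeasurableSpace β] (h : IsKernel φ) {p q x y : β → F}
    (hp : Measurable p) (hq : Measurable q) (hx : Measurable x) (hy : Measurable y) :
    Measurable fun b => φ (p b) (q b) (x b) (y b) :=
  h.measurable.comp (hp.prodMk (hq.prodMk (hx.prodMk hy)))

theorem continuousAt_comp {β : Type*} [TopologicalSpace β] (h : IsKernel φ) {p q x y : β → F}
    {b : β} (hp : ContinuousAt p b) (hq : ContinuousAt q b) (hx : ContinuousAt x b)
    (hy : ContinuousAt y b) (hp₀ : p b ≠ 0) (hq₀ : q b ≠ 0) (hx₀ : x b ≠ 0) (hy₀ : y b ≠ 0) :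
    ContinuousAt (fun b => φ (p b) (q b) (x b) (y b)) b :=
  ContinuousAt.comp (g := fun s : F × F × F × F => φ s.1 s.2.1 s.2.2.1 s.2.2.2)
    (f := fun b => (p b, q b, x b, y b)) (h.continuousAt _ _ _ _ hp₀ hq₀ hx₀ hy₀) (hp.prodMk (hq.prodMk (hx.prodMk hy)))

/-- Bounds on the support of a kernel, in a form suited to monomial weights. -/
theorem exists_bounds (h : IsKernel φ) : ∃ M R L : ℝ, 0 ≤ M ∧ 0 ≤ L ∧
    (∀ p q x y, ‖φ p q x y‖ ≤ M) ∧
    (∀ p q x y, φ p q x y ≠ 0 →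
      (p ∈ annulus F R ∧ q ∈ annulus F R ∧ x ∈ annulus F R ∧ y ∈ annulus F R) ∧
      |logMod p| ≤ L ∧ |logMod q| ≤ L ∧ |logMod x| ≤ L ∧ |logMod y| ≤ L) ∧
    (∀ n : F, ‖n - 1‖ < 1 / 2 → n ∈ annulus F 2 ∧ |logMod n| ≤ L) := by
  obtain ⟨M, hM, hM'⟩ := h.bounded
  obtain ⟨R, hR⟩ := h.support
  obtain ⟨L₁, hL₁, h₁⟩ := exists_abs_logMod_le (F := F) R
  obtain ⟨L₂, hL₂, h₂⟩ := exists_abs_logMod_le (F := F) 2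
  have key : ∀ t ∈ annulus F R, |logMod t| ≤ max L₁ L₂ := fun t ht =>
    (h₁ t ht.2.1 ht.2.2 ht.1).trans (le_max_left _ _)
  refine ⟨M, R, max L₁ L₂, hM, hL₁.trans (le_max_left _ _), hM', fun p q x y hφ => ?_,
    fun n hn => ?_⟩
  · have hφ' := hR p q x y hφ
    exact ⟨hφ', key p hφ'.1, key q hφ'.2.1, key x hφ'.2.2.1, key y hφ'.2.2.2⟩
  · have e₁ : ‖n‖ ≤ ‖n - 1‖ + 1 := by
      simpa using norm_add_le (n - 1) 1
    have e₂ : 1 ≤ ‖n‖ + ‖n - 1‖ := by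
      have := norm_sub_le n (n - 1)
      rwa [sub_sub_cancel, norm_one] at this
    have h0 : n ≠ 0 := by
      rintro rfl
      norm_num at hn
    have h3 : ‖n⁻¹‖ ≤ 2 := by
      rw [norm_inv]
      exact inv_le_of_inv_le₀ (by norm_num) (by linarith)
    exact ⟨⟨h0, by linarith, h3⟩, (h₂ n (by linarith) h3 h0).trans (le_max_right _ _)⟩

end IsKernel

/-- The five logarithms are those of P, Q, x, y and n, all bounded on the support of the kernel. The
weights are estimated by writing their logarithms as linear combinations of these. -/
theorem sum_mul_le {e₁ e₂ e₃ e₄ e₅ l₁ l₂ l₃ l₄ l₅ L : ℝ} (h₁ : |l₁| ≤ L) (h₂ : |l₂| ≤ L)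
    (h₃ : |l₃| ≤ L) (h₄ : |l₄| ≤ L) (h₅ : |l₅| ≤ L) :
    e₁ * l₁ + e₂ * l₂ + e₃ * l₃ + e₄ * l₄ + e₅ * l₅ ≤
      (|e₁| + |e₂| + |e₃| + |e₄| + |e₅|) * L := by
  have key : ∀ e l : ℝ, |l| ≤ L → e * l ≤ |e| * L := fun e l hl =>
    (le_abs_self _).trans (by rw [abs_mul]; exact mul_le_mul_of_nonneg_left hl (abs_nonneg e))
  linarith [key e₁ l₁ h₁, key e₂ l₂ h₂, key e₃ l₃ h₃, key e₄ l₄ h₄, key e₅ l₅ h₅]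

theorem exp_logMod_mul₄ {α x y z : F} (hα : α ≠ 0) (hx : x ≠ 0) (hy : y ≠ 0) (hz : z ≠ 0) :
    Real.exp (logMod α + logMod x + logMod y + logMod z) =
      modulus α * modulus x * modulus y * modulus z := by
  rw [Real.exp_add, Real.exp_add, Real.exp_add, exp_logMod hα, exp_logMod hx, exp_logMod hy,
    exp_logMod hz]

theorem ne_zero_of_kernel_mul {φ : ℂ} {w : ℝ} (h : φ * (w : ℂ) ≠ 0) : φ ≠ 0 ∧ w ≠ 0 :=
  ⟨left_ne_zero_of_mul h, fun h' => right_ne_zero_of_mul h (by rw [h', Complex.ofReal_zero])⟩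

theorem ae_notMem_finset (μ : Measure F) [μ.IsAddHaarMeasure] (S : Finset F) :
    ∀ᵐ z ∂μ, z ∉ S := by
  simpa using S.countable_toSet.ae_notMem μ

theorem ae_mul_ne_zero (μ : Measure F) [μ.IsAddHaarMeasure] {g : F → F → F} (S : Finset F)
    (S' : F → Finset F) (h : ∀ y ∉ S, ∀ z ∉ S' y, g y z ≠ 0) : ∀ᵐ y ∂μ, ∀ᵐ z ∂μ, g y z ≠ 0 := by
  filter_upwards [ae_notMem_finset μ S] with y hy
  filter_upwards [ae_notMem_finset μ (S' y)] with z hz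
  exact h y hy z hz

/-- Affine data for the product of a kernel with a weight `w`. -/
theorem affineData_of_kernel (μ : Measure F) {φ : F → F → F → F → ℂ}
    (hφ : IsKernel φ) {p q : F → F → F → F} {p₀ q₀ : F → F → F} {w : F → F → F → ℝ}
    {w₀ : F → F → ℝ} {α β g : F → F → F}
    (hp : Measurable fun s : F × F × F => p s.1 s.2.1 s.2.2)
    (hq : Measurable fun s : F × F × F => q s.1 s.2.1 s.2.2)
    (hw : Measurable fun s : F × F × F => w s.1 s.2.1 s.2.2)
    (hp₀ : Measurable fun s : F × F => p₀ s.1 s.2)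
    (hq₀ : Measurable fun s : F × F => q₀ s.1 s.2)
    (hw₀ : Measurable fun s : F × F => w₀ s.1 s.2)
    (hα : Measurable fun s : F × F => α s.1 s.2)
    (hβ : Measurable fun s : F × F => β s.1 s.2)
    (hg : Measurable fun s : F × F => g s.1 s.2)
    (hg₀ : ∀ᵐ y ∂μ, ∀ᵐ z ∂μ, g y z ≠ 0)
    (hα₀ : ∀ y z, g y z ≠ 0 → α y z ≠ 0)
    (hpos : ∀ x y z, 0 ≤ w x y z)
    (hslice : ∀ᵐ z ∂μ, ∀ R L, ∃ K, ∀ x y, w x y z ≠ 0 →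
      p x y z ∈ annulus F R → q x y z ∈ annulus F R → x ∈ annulus F R → y ∈ annulus F R →
      |logMod (p x y z)| ≤ L → |logMod (q x y z)| ≤ L → |logMod x| ≤ L → |logMod y| ≤ L →
      w x y z ≤ Real.exp K)
    (hbound : ∀ R L, ∃ K R', ∀ x y z, w x y z ≠ 0 →
      p x y z ∈ annulus F R → q x y z ∈ annulus F R → x ∈ annulus F R → y ∈ annulus F R →
      α y z * x + β y z ∈ annulus F 2 →
      |logMod (p x y z)| ≤ L → |logMod (q x y z)| ≤ L → |logMod x| ≤ L → |logMod y| ≤ L →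
      |logMod (α y z * x + β y z)| ≤ L →
      ‖z‖ ≤ R' ∧ α y z ≠ 0 ∧ z ≠ 0 ∧
        w x y z ≤ Real.exp (K + (logMod (α y z) + logMod x + logMod y + logMod z)))
    (hroot : ∀ y z, g y z ≠ 0 → ∀ x, x = (1 - β y z) / α y z → y ≠ 0 ∧ x ≠ 0 ∧
      p x y z ≠ 0 ∧ q x y z ≠ 0 ∧ ContinuousAt (fun x => p x y z) x ∧
      ContinuousAt (fun x => q x y z) x ∧ ContinuousAt (fun x => w x y z) x)
    (hsolve : ∃ a b c d : F → F, ∀ y z, g y z ≠ 0 → ∀ x, x = (1 - β y z) / α y z →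
      z ≠ 0 ∧ a y * d y - b y * c y ≠ 0 ∧
      x = (a y * z + b y) / (c y * z + d y) ∧ p x y z = p₀ x y ∧ q x y z = q₀ x y ∧
      w x y z = modulus z * modulus (α y z) *
        (modulus (a y * d y - b y * c y) / modulus (c y * z + d y) ^ 2) * w₀ x y) :
    AffineData μ (fun x y z => φ (p x y z) (q x y z) x y * (w x y z : ℂ))
      (fun x y => φ (p₀ x y) (q₀ x y) x y * (w₀ x y : ℂ)) α β g := by
  obtain ⟨M, R, L, hM, hL, hMφ, hR, hn⟩ := hφ.exists_bounds
  have hnorm : ∀ x y z t, w x y z ≤ t →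
      ‖φ (p x y z) (q x y z) x y * (w x y z : ℂ)‖ ≤ M * t := by
    intro x y z t ht
    rw [norm_mul, Complex.norm_real, Real.norm_of_nonneg (hpos x y z)]
    exact mul_le_mul (hMφ _ _ _ _) ht (hpos x y z) hM
  refine ⟨?_, ?_, hα, hβ, hg, hg₀, hα₀, ?_, ?_, ?_, ?_⟩
  · exact (hφ.measurable_comp hp hq measurable_fst (measurable_fst.comp measurable_snd)).mul
      (Complex.measurable_ofReal.comp hw)
  · exact (hφ.measurable_comp hp₀ hq₀ measurable_fst measurable_snd).mul
      (Complex.measurable_ofReal.comp hw₀)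
  · filter_upwards [hslice] with z hz
    obtain ⟨K, hK⟩ := hz R L
    refine ⟨M * Real.exp K, R, fun x y hT => ?_⟩
    obtain ⟨h₁, h₂⟩ := ne_zero_of_kernel_mul hT
    obtain ⟨⟨i₁, i₂, i₃, i₄⟩, j₁, j₂, j₃, j₄⟩ := hR _ _ _ _ h₁
    exact ⟨hnorm x y z _ (hK x y h₂ i₁ i₂ i₃ i₄ j₁ j₂ j₃ j₄), i₃, i₄⟩
  · obtain ⟨K, R', hK⟩ := hbound R L
    refine ⟨M * Real.exp K, max R R', fun x y z hT hN => ?_⟩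
    obtain ⟨h₁, h₂⟩ := ne_zero_of_kernel_mul hT
    obtain ⟨⟨i₁, i₂, i₃, i₄⟩, j₁, j₂, j₃, j₄⟩ := hR _ _ _ _ h₁
    obtain ⟨k₁, k₂⟩ := hn _ hN
    obtain ⟨l₁, l₂, l₃, l₄⟩ := hK x y z h₂ i₁ i₂ i₃ i₄ k₁ j₁ j₂ j₃ j₄ k₂
    refine ⟨i₄.2.1.trans (le_max_left _ _), l₁.trans (le_max_right _ _), ?_⟩
    refine (hnorm x y z _ l₄).trans_eq ?_
    rw [Real.exp_add, exp_logMod_mul₄ l₂ i₃.1 i₄.1 l₃]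
    ring
  · intro y z h
    obtain ⟨h₁, h₂, h₃, h₄, h₅, h₆, h₇⟩ := hroot y z h _ rfl
    exact ⟨h₂, (hφ.continuousAt_comp h₅ h₆ continuousAt_id continuousAt_const h₃ h₄ h₂ h₁).mul
      (Complex.continuous_ofReal.continuousAt.comp h₇)⟩
  · obtain ⟨a, b, c, d, hs⟩ := hsolve
    refine ⟨a, b, c, d, fun y z h => ?_⟩
    obtain ⟨h₁, h₂, h₃, h₄, h₅, h₆⟩ := hs y z h _ rfl
    refine ⟨h₁, h₂, h₃, ?_⟩
    rw [h₄, h₅, h₆, Complex.ofReal_mul]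
    ring

theorem weight_nonneg (a c : ℝ) (X : F) : 0 ≤ weight a c X := by
  unfold weight
  split_ifs
  · exact le_rfl
  · exact Real.exp_nonneg _

end Weights

/-! ### The pair 13 -/

section Cases

variable {F : Type*} [NontriviallyNormedField F] [ProperSpace F] [MeasurableSpace F] [BorelSpace F]
  (μ : Measure F) [μ.IsAddHaarMeasure] {φ : F → F → F → F → ℂ}

theorem logMod_one_div (x : F) : logMod (1 / x) = -logMod x := by rw [one_div, logMod_inv]

theorem le_exp_of_eq {w S K t : ℝ} (hw : w = Real.exp S) (h : S ≤ K + t) :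
    w ≤ Real.exp (K + t) := hw ▸ Real.exp_le_exp.2 h

theorem norm_le_of_one_sub_eq {z p q n : F} {R : ℝ} (h : 1 - z = p⁻¹ * q⁻¹ * n⁻¹)
    (hp : p ∈ annulus F R) (hq : q ∈ annulus F R) (hn : n ∈ annulus F 2) :
    ‖z‖ ≤ 1 + R * R * 2 := by
  have h₁ : ‖z‖ ≤ 1 + ‖1 - z‖ := by
    have := norm_sub_le 1 (1 - z)
    rwa [sub_sub_cancel, norm_one] at this
  refine h₁.trans ?_
  have hR : 0 ≤ R := (norm_nonneg _).trans hp.2.1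
  rw [h, norm_mul, norm_mul]
  gcongr
  · exact hp.2.2
  · exact hq.2.2
  · exact hn.2.2

theorem ne_of_weight_mul_ne_zero {a₁ c₁ a₂ c₂ a₃ c₃ : ℝ} {X₁ X₂ X₃ : F}
    (h : weight a₁ c₁ X₁ * weight a₂ c₂ X₂ * weight a₃ c₃ X₃ ≠ 0) :
    (X₁ ≠ 0 ∧ 1 - X₁ ≠ 0) ∧ (X₂ ≠ 0 ∧ 1 - X₂ ≠ 0) ∧ X₃ ≠ 0 ∧ 1 - X₃ ≠ 0 :=
  ⟨ne_of_weight_ne_zero (left_ne_zero_of_mul (left_ne_zero_of_mul h)),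
    ne_of_weight_ne_zero (right_ne_zero_of_mul (left_ne_zero_of_mul h)),
    ne_of_weight_ne_zero (right_ne_zero_of_mul h)⟩

theorem weight_mul_nonneg (a₁ c₁ a₂ c₂ a₃ c₃ : ℝ) (X₁ X₂ X₃ : F) :
    0 ≤ weight a₁ c₁ X₁ * weight a₂ c₂ X₂ * weight a₃ c₃ X₃ :=
  mul_nonneg (mul_nonneg (weight_nonneg _ _ _) (weight_nonneg _ _ _)) (weight_nonneg _ _ _)

theorem norm_one_sub_le {y z : F} {R : ℝ} (hy : ‖y‖ ≤ R) (hz : ‖z‖ ≤ R) :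
    ‖1 - y * z‖ ≤ 1 + R * R := by
  have h : ‖1 - y * z‖ ≤ 1 + ‖y * z‖ := by simpa using norm_sub_le 1 (y * z)
  have hR : 0 ≤ R := (norm_nonneg _).trans hy
  refine h.trans (add_le_add_right ?_ 1)
  rw [norm_mul]
  gcongr

/-- The pentagon with the tetrahedra `T 1`, `T 3` on one side; here `x = 1 / X₁`, `y = X₃`,
`z = X₂`. -/
theorem affineData_one_three (hφ : IsKernel φ) {a c : Fin 5 → ℝ} (h₃₄ : a 1 = a 0 + a 2)
    (h₀₁ : a 3 = a 2 + a 4) (h₀₄ : c 2 = c 1 + c 3) (h₁₂ : c 3 = a 0 + c 4)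
    (h₂₃ : c 1 = c 0 + a 4) :
    AffineData μ
      (fun x y z => φ (y / z / (1 - 1 / (x * z))) (1 / (x * z) / (1 - y / z)) x y *
        ((weight (a 0) (c 0) (1 / (x * z)) * weight (a 2) (c 2) z *
          weight (a 4) (c 4) (y / z) : ℝ) : ℂ))
      (fun x y => φ (1 / (1 - 1 / x)) (1 / (1 - y)) x y *
        ((weight (a 1) (c 1) (1 / x) * weight (a 3) (c 3) y : ℝ) : ℂ))
      (fun y z => z * (1 - y / z) / ((1 - z) * (y / z)))
      (fun y z => -((1 - y / z) / ((1 - z) * (y / z))))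
      (fun y z => y * (1 - y) * z * (1 - z) * (z - y)) := by
  -- This is the five-term relation on N = 1: each 1 - X_i of the three integrated tetrahedra
  -- becomes a monomial in the X_j and in 1 - X₁, 1 - X₃. The choice x = 1/X₁ makes N affine in x.
  have key : ∀ y z : F, y * (1 - y) * z * (1 - z) * (z - y) ≠ 0 → ∀ x,
      x = (1 - -((1 - y / z) / ((1 - z) * (y / z)))) / (z * (1 - y / z) / ((1 - z) * (y / z))) →
      y ≠ 0 ∧ 1 - y ≠ 0 ∧ z ≠ 0 ∧ 1 - z ≠ 0 ∧ z - y ≠ 0 ∧ x ≠ 0 ∧ 1 - 1 / x ≠ 0 ∧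
        x = (1 - y) / (z - y) ∧ 1 - 1 / (x * z) = y / z * (1 - 1 / x) ∧
        1 - y / z = 1 / (x * z) * (1 - y) ∧ 1 - z = (1 - 1 / x) * (1 - y) := by
    intro y z hg x hx
    simp only [ne_eq, mul_eq_zero, not_or] at hg
    obtain ⟨⟨⟨⟨hy, hy'⟩, hz⟩, hz'⟩, hzy⟩ := hg
    have hx' : x = (1 - y) / (z - y) := by
      rw [hx]
      field_simp
      ring
    have hx₀ : x ≠ 0 := hx' ▸ div_ne_zero hy' hzy
    have hx₁ : 1 - z = (1 - 1 / x) * (1 - y) := by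
      rw [hx']
      field_simp
      ring
    refine ⟨hy, hy', hz, hz', hzy, hx₀, ?_, hx', ?_, ?_, hx₁⟩
    · intro h
      rw [h, zero_mul] at hx₁
      exact hz' hx₁
    · rw [hx']
      field_simp
      ring
    · rw [hx']
      field_simp
  refine affineData_of_kernel μ hφ (by fun_prop) (by fun_prop) ?_ (by fun_prop) (by fun_prop) ?_
    (by fun_prop) (by fun_prop) (by fun_prop) ?_ ?_ ?_ ?_ ?_ ?_ ?_
  · exact ((Measurable.weight (by fun_prop)).mul (Measurable.weight (by fun_prop))).mul
      (Measurable.weight (by fun_prop))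
  · exact (Measurable.weight (by fun_prop)).mul (Measurable.weight (by fun_prop))
  · classical
    refine ae_mul_ne_zero μ {0, 1} (fun y => {0, 1, y}) fun y hy z hz => ?_
    simp only [Finset.mem_insert, Finset.mem_singleton, not_or] at hy hz
    simp only [ne_eq, mul_eq_zero, sub_eq_zero, not_or]
    tauto
  · intro y z hg
    simp only [ne_eq, mul_eq_zero, not_or] at hg
    obtain ⟨⟨⟨⟨hy, hy'⟩, hz⟩, hz'⟩, hzy⟩ := hg
    have : 1 - y / z ≠ 0 := by
      rw [one_sub_div hz]
      exact div_ne_zero hzy hz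
    exact div_ne_zero (mul_ne_zero hz this) (mul_ne_zero hz' (div_ne_zero hy hz))
  · exact fun x y z => weight_mul_nonneg _ _ _ _ _ _ _ _ _
  -- Solving P = X₄/(1 - X₀) and Q = X₀/(1 - X₄) for 1 - X₀ and 1 - X₄ turns log w into a
  -- combination of bounded logarithms plus a function of z, which is constant on the slice. The
  -- fifth coefficient is a dummy 0.
  · refine Eventually.of_forall fun z R L => ⟨(|-(a 0 - 1)| + |-(a 4 - 1)| + |-c 0 - (a 4 - 1)| +
      |a 0 - 1 + c 4| + |(0 : ℝ)|) * L + ((c 2 - c 0 - (a 0 - 1) - c 4 - (a 4 - 1)) * logMod z +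
        (a 2 - 1) * logMod (1 - z)), ?_⟩
    intro x y hw hp hq hx hy kp kq kx ky
    replace hx := hx.1
    replace hy := hy.1
    obtain ⟨⟨-, hu₀⟩, ⟨hz, hu₂⟩, hX₄, hu₄⟩ := ne_of_weight_mul_ne_zero hw
    have hX₀ : 1 / (x * z) ≠ 0 := one_div_ne_zero (mul_ne_zero hx hz)
    have lX₀ : logMod (1 / (x * z)) = -logMod x - logMod z := by
      rw [logMod_one_div, logMod_mul hx hz, neg_add']
    have lX₄ : logMod (y / z) = logMod y - logMod z := logMod_div hy hz
    have lp := logMod_div hX₄ hu₀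
    have lq := logMod_div hX₀ hu₄
    refine le_exp_of_eq (S := _) (by
      rw [weight_eq hX₀ hu₀, weight_eq hz hu₂, weight_eq hX₄ hu₄, ← Real.exp_add, ← Real.exp_add]) ?_
    have := sum_mul_le (e₁ := -(a 0 - 1)) (e₂ := -(a 4 - 1)) (e₃ := -c 0 - (a 4 - 1))
      (e₄ := a 0 - 1 + c 4) (e₅ := 0) kp kq kx ky ky
    rw [lp, lq] at this
    rw [lX₀, lX₄] at this ⊢
    linarith
  -- Now n also bounds: 1 - z = (P Q n)⁻¹ keeps z in a ball and eliminates log ‖1 - z‖. The absolute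
  -- values contain the coefficients of log P, log Q, log x, log y, log n in log w - log ‖α x y z‖.
  · refine fun R L => ⟨(|-(a 0 - 1) - (a 2 - 1) - 1| + |-(a 4 - 1) - (a 2 - 1)| +
      |-c 0 - (a 4 - 1)| + |a 0 - 1 + c 4| + |-(a 2 - 1) - 1|) * L, 1 + R * R * 2, ?_⟩
    intro x y z hw hp hq hx hy hn kp kq kx ky kn
    replace hx := hx.1
    replace hy := hy.1
    obtain ⟨⟨-, hu₀⟩, ⟨hz, hu₂⟩, hX₄, hu₄⟩ := ne_of_weight_mul_ne_zero hw
    have hX₀ : 1 / (x * z) ≠ 0 := one_div_ne_zero (mul_ne_zero hx hz)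
    have en : z * (1 - y / z) / ((1 - z) * (y / z)) * x + -((1 - y / z) / ((1 - z) * (y / z))) =
        (1 - 1 / (x * z)) * (1 - y / z) / ((1 - z) * (y / z) * (1 / (x * z))) := by
      field_simp
      ring
    rw [en] at hn kn
    have hα := div_ne_zero (mul_ne_zero hz hu₄) (mul_ne_zero hu₂ hX₄)
    refine ⟨norm_le_of_one_sub_eq ?_ hp hq hn, hα, hz, ?_⟩
    · have key : ∀ u₀ u₂ u₄ X₀ X₄ : F, u₀ ≠ 0 → u₂ ≠ 0 → u₄ ≠ 0 → X₀ ≠ 0 → X₄ ≠ 0 →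
          u₂ = (X₄ / u₀)⁻¹ * (X₀ / u₄)⁻¹ * (u₀ * u₄ / (u₂ * X₄ * X₀))⁻¹ := by
        intros
        field_simp
      exact key _ _ _ _ _ hu₀ hu₂ hu₄ hX₀ hX₄
    have lX₀ : logMod (1 / (x * z)) = -logMod x - logMod z := by
      rw [logMod_one_div, logMod_mul hx hz, neg_add']
    have lX₄ : logMod (y / z) = logMod y - logMod z := logMod_div hy hz
    have lp := logMod_div hX₄ hu₀
    have lq := logMod_div hX₀ hu₄
    have ln := logMod_div (mul_ne_zero hu₀ hu₄) (mul_ne_zero (mul_ne_zero hu₂ hX₄) hX₀)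
    rw [logMod_mul hu₀ hu₄, logMod_mul (mul_ne_zero hu₂ hX₄) hX₀, logMod_mul hu₂ hX₄] at ln
    have lα := logMod_div (mul_ne_zero hz hu₄) (mul_ne_zero hu₂ hX₄)
    rw [logMod_mul hz hu₄, logMod_mul hu₂ hX₄] at lα
    refine le_exp_of_eq (S := _) (by
      rw [weight_eq hX₀ hu₀, weight_eq hz hu₂, weight_eq hX₄ hu₄, ← Real.exp_add, ← Real.exp_add]) ?_
    refine le_trans (le_of_eq ?_) (add_le_add_left (sum_mul_le kp kq kx ky kn) _)
    rw [lp, lq, ln, lα, lX₀, lX₄]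
    -- The remaining coefficient of log ‖z‖ vanishes by the angle relations; without this z could
    -- not approach 0 uniformly.
    linear_combination logMod z * (h₀₄ + h₂₃ + h₁₂)
  · intro y z hg x hx
    obtain ⟨hy, hy', hz, hz', hzy, hx₀, hu₁, -, e₀, e₄, -⟩ := key y z hg x hx
    have hX₀ : 1 / (x * z) ≠ 0 := one_div_ne_zero (mul_ne_zero hx₀ hz)
    have hX₄ : y / z ≠ 0 := div_ne_zero hy hz
    have hxz : x * z ≠ 0 := mul_ne_zero hx₀ hz
    have hu₀ : 1 - 1 / (x * z) ≠ 0 := e₀ ▸ mul_ne_zero hX₄ hu₁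
    have hu₄ : 1 - y / z ≠ 0 := e₄ ▸ mul_ne_zero hX₀ hy'
    refine ⟨hy, hx₀, div_ne_zero hX₄ hu₀, div_ne_zero hX₀ hu₄, by fun_prop (disch := assumption),
      by fun_prop (disch := assumption), ?_⟩
    exact ((ContinuousAt.weight (f := fun x => 1 / (x * z)) (by fun_prop (disch := assumption)) hX₀
      hu₀).mul continuousAt_const).mul continuousAt_const
  -- On N = 1 one has x = (1 - y)/(z - y).
  · refine ⟨fun _ => 0, fun y => 1 - y, fun _ => 1, fun y => -y, fun y z hg x hx => ?_⟩
    obtain ⟨hy, hy', hz, hz', hzy, hx₀, hu₁, ex, e₀, e₄, e₂⟩ := key y z hg x hx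
    have hX₀ : 1 / (x * z) ≠ 0 := one_div_ne_zero (mul_ne_zero hx₀ hz)
    have hX₄ : y / z ≠ 0 := div_ne_zero hy hz
    have hu₀ : 1 - 1 / (x * z) ≠ 0 := e₀ ▸ mul_ne_zero hX₄ hu₁
    have hu₄ : 1 - y / z ≠ 0 := e₄ ▸ mul_ne_zero hX₀ hy'
    have ed : 1 * z + -y = (1 - y) / x := by
      rw [ex]
      field_simp
      ring
    refine ⟨hz, ?_, ?_, ?_, ?_, ?_⟩
    · rw [zero_mul, zero_sub, mul_one]
      exact neg_ne_zero.2 hy'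
    · rw [ed]
      field_simp
      ring
    · rw [e₀]
      field_simp
    · rw [e₄]
      field_simp
    rw [ed, weight_eq hX₀ hu₀, weight_eq hz hz', weight_eq hX₄ hu₄,
      weight_eq (one_div_ne_zero hx₀) hu₁, weight_eq hy hy', zero_mul, zero_sub, mul_one,
      modulus_neg, ← exp_logMod hz, ← exp_logMod hy', ← exp_logMod (div_ne_zero hy' hx₀),
      ← exp_logMod (div_ne_zero (mul_ne_zero hz hu₄) (mul_ne_zero hz' hX₄)), ← Real.exp_nat_mul,
      ← Real.exp_sub]
    simp only [← Real.exp_add]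
    have lX₀ : logMod (1 / (x * z)) = -logMod x - logMod z := by
      rw [logMod_one_div, logMod_mul hx₀ hz, neg_add']
    rw [logMod_div (mul_ne_zero hz hu₄) (mul_ne_zero hz' hX₄), logMod_mul hz hu₄,
      logMod_mul hz' hX₄, logMod_div hy' hx₀, e₀, e₄, e₂, logMod_mul hX₄ hu₁, logMod_mul hX₀ hy',
      logMod_mul hu₁ hy', lX₀, logMod_div hy hz, logMod_one_div]
    congr 1
    push_cast
    -- After the five-term relations both exponents are linear in the logarithms of x, y, z, 1 - X₁
    -- and 1 - X₃; equality of each coefficient is a combination of the angle relations.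
    linear_combination logMod x * h₂₃ - logMod y * h₁₂ + logMod z * (h₀₄ + h₂₃ + h₁₂) -
      logMod (1 - 1 / x) * h₃₄ - logMod (1 - y) * h₀₁

end Cases

/-! ### The pairs 04, 12 and 34 -/

section Cases

variable {F : Type*} [NontriviallyNormedField F] [ProperSpace F] [MeasurableSpace F] [BorelSpace F]
  (μ : Measure F) [μ.IsAddHaarMeasure] {φ : F → F → F → F → ℂ}

/-- The pentagon with the tetrahedra `T 0`, `T 4` on one side; here `x = X₀`, `y = X₄`,
`z = X₂`. -/
theorem affineData_zero_four (hφ : IsKernel φ) {a c : Fin 5 → ℝ}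
    (h₃₄ : a 0 = a 1 + a 2) (h₀₁ : a 4 = a 2 + a 3)
    (h₀₄ : c 1 + c 2 + c 3 = 2) (h₁₂ : c 3 = a 0 + c 4) (h₂₃ : c 1 = c 0 + a 4) :
    AffineData μ
      (fun x y z => φ (y * (1 - x * z)) (x * (1 - z * y)) x y *
        ((weight (a 1) (c 1) (x * z) * weight (a 2) (c 2) (z) * weight (a 3) (c 3) (z * y) : ℝ) : ℂ))
      (fun x y => φ (1 - x) (1 - y) x y *
        ((weight (a 0) (c 0) (x) * weight (a 4) (c 4) (y) : ℝ) : ℂ))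
      (fun y z => -(z * (1 - z * y) / (1 - z)))
      (fun y z => (1 - z * y) / (1 - z))
      (fun y z => y * (1 - y) * z * (1 - z) * (1 - z * y)) := by
  have key : ∀ y z : F, y * (1 - y) * z * (1 - z) * (1 - z * y) ≠ 0 → ∀ x,
      x = (1 - ((1 - z * y) / (1 - z))) / (-(z * (1 - z * y) / (1 - z))) →
      y ≠ 0 ∧ 1 - y ≠ 0 ∧ z ≠ 0 ∧ 1 - z ≠ 0 ∧ 1 - z * y ≠ 0 ∧ x ≠ 0 ∧ 1 - x * z ≠ 0 ∧
        1 - x = y * (1 - x * z) ∧ 1 - y = x * (1 - z * y) ∧ 1 - z = (1 - x * z) * (1 - z * y) := by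
    intro y z hg x hx
    simp only [ne_eq, mul_eq_zero, not_or] at hg
    obtain ⟨⟨⟨⟨hy, hy'⟩, hz⟩, hz'⟩, hd⟩ := hg
    have hx' : x = (1 - y) / (1 - z * y) := by
      rw [hx, div_eq_div_iff (neg_ne_zero.2 (div_ne_zero (mul_ne_zero hz hd) hz')) hd]
      field_simp
      ring
    have hx₀ : x ≠ 0 := hx' ▸ div_ne_zero hy' hd
    have hx₁ : x * (1 - z * y) = 1 - y := by rw [hx', div_mul_cancel₀ _ hd]
    have e₂ : 1 - z = (1 - x * z) * (1 - z * y) := by linear_combination z * hx₁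
    refine ⟨hy, hy', hz, hz', hd, hx₀, ?_, by linear_combination -hx₁, hx₁.symm, e₂⟩
    intro h
    rw [h, zero_mul] at e₂
    exact hz' e₂
  refine affineData_of_kernel μ hφ (by fun_prop) (by fun_prop) ?_ (by fun_prop) (by fun_prop) ?_
    (by fun_prop) (by fun_prop) (by fun_prop) ?_ ?_ ?_ ?_ ?_ ?_ ?_
  · exact ((Measurable.weight (by fun_prop)).mul (Measurable.weight (by fun_prop))).mul
      (Measurable.weight (by fun_prop))
  · exact (Measurable.weight (by fun_prop)).mul (Measurable.weight (by fun_prop))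
  · classical
    refine ae_mul_ne_zero μ {0, 1} (fun y => {0, 1, y⁻¹}) fun y hy z hz => ?_
    simp only [Finset.mem_insert, Finset.mem_singleton, not_or] at hy hz
    have h : z * y ≠ 1 := fun h => hz.2.2 (eq_inv_of_mul_eq_one_left h)
    simp only [ne_eq, mul_eq_zero, sub_eq_zero, not_or]
    exact ⟨⟨⟨⟨hy.1, Ne.symm hy.2⟩, hz.1⟩, Ne.symm hz.2.1⟩, Ne.symm h⟩
  · intro y z hg
    simp only [ne_eq, mul_eq_zero, not_or] at hg
    obtain ⟨⟨⟨⟨hy, hy'⟩, hz⟩, hz'⟩, hd⟩ := hg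
    exact neg_ne_zero.2 (div_ne_zero (mul_ne_zero hz hd) hz')
  · exact fun x y z => weight_mul_nonneg _ _ _ _ _ _ _ _ _
  · refine Eventually.of_forall fun z R L => ⟨(|a 1 - 1| + |a 3 - 1| + |c 1 - (a 3 - 1)| +
      |c 3 - (a 1 - 1)| + |(0 : ℝ)|) * L + ((c 1 + c 2 + c 3) * logMod z +
        (a 2 - 1) * logMod (1 - z)), ?_⟩
    intro x y hw hp hq hx hy kp kq kx ky
    replace hx := hx.1
    replace hy := hy.1
    obtain ⟨⟨hX₁, hu₁⟩, ⟨hz, hu₂⟩, hX₃, hu₃⟩ := ne_of_weight_mul_ne_zero hw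
    refine le_exp_of_eq (S := _) (by
      rw [weight_eq hX₁ hu₁, weight_eq hz hu₂, weight_eq hX₃ hu₃, ← Real.exp_add, ← Real.exp_add]) ?_
    have := sum_mul_le (e₁ := a 1 - 1) (e₂ := a 3 - 1) (e₃ := c 1 - (a 3 - 1))
      (e₄ := c 3 - (a 1 - 1)) (e₅ := 0) kp kq kx ky ky
    rw [logMod_mul hy hu₁, logMod_mul hx hu₃] at this
    rw [logMod_mul hx hz, logMod_mul hz hy]
    linarith
  · refine fun R L => ⟨(|a 1 - 1 + (a 2 - 1) + 1| + |a 3 - 1 + (a 2 - 1)| + |c 1 - (a 3 - 1) - (a 2 - 1) - 1| + |c 3 - (a 1 - 1) - (a 2 - 1) - 2| + |-(a 2 - 1) - 1|) * L,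
      1 + R * R * R * R * 2, ?_⟩
    intro x y z hw hp hq hx hy hn kp kq kx ky kn
    obtain ⟨⟨hX₁, hu₁⟩, ⟨hz, hu₂⟩, hX₃, hu₃⟩ := ne_of_weight_mul_ne_zero hw
    have en : -(z * (1 - z * y) / (1 - z)) * x + (1 - z * y) / (1 - z) =
        (1 - x * z) * (1 - z * y) / (1 - z) := by
      field_simp
      ring
    rw [en] at hn kn
    have hα := div_ne_zero (mul_ne_zero hz hu₃) hu₂
    refine ⟨?_, neg_ne_zero.2 hα, hz, ?_⟩
    -- The bound on z comes from 1 - z = P Q y⁻¹ x⁻¹ n⁻¹, all of whose factors are bounded.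
    · have key : ∀ u₁ u₂ u₃ : F, u₁ ≠ 0 → u₂ ≠ 0 → u₃ ≠ 0 →
          u₂ = (y * u₁) * (x * u₃) * y⁻¹ * x⁻¹ * (u₁ * u₃ / u₂)⁻¹ := by
        intro u₁ u₂ u₃ _ _ _
        have := hx.1
        have := hy.1
        field_simp
      have hR : 0 ≤ R := (norm_nonneg _).trans hp.2.1
      have h₁ : ‖z‖ ≤ 1 + ‖1 - z‖ := by
        have := norm_sub_le 1 (1 - z)
        rwa [sub_sub_cancel, norm_one] at this
      refine h₁.trans (add_le_add_right ?_ 1)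
      rw [key _ _ _ hu₁ hu₂ hu₃, norm_mul, norm_mul, norm_mul, norm_mul]
      gcongr
      exacts [hp.2.1, hq.2.1, hy.2.2, hx.2.2, hn.2.2]
    replace hx := hx.1
    replace hy := hy.1
    refine le_exp_of_eq (S := _) (by
      rw [weight_eq hX₁ hu₁, weight_eq hz hu₂, weight_eq hX₃ hu₃, ← Real.exp_add, ← Real.exp_add]) ?_
    refine le_trans (le_of_eq ?_) (add_le_add_left (sum_mul_le kp kq kx ky kn) _)
    rw [logMod_neg, logMod_div (mul_ne_zero hu₁ hu₃) hu₂, logMod_mul hu₁ hu₃, logMod_mul hy hu₁,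
      logMod_mul hx hu₃, logMod_div (mul_ne_zero hz hu₃) hu₂, logMod_mul hz hu₃, logMod_mul hx hz,
      logMod_mul hz hy]
    -- The exponent c₁ + c₂ + c₃ of ‖z‖ has to match the exponent 2 that comes from ‖α‖‖z‖: this is
    -- the total angle 2ϖ at the edge 04.
    linear_combination logMod z * h₀₄
  · intro y z hg x hx
    obtain ⟨hy, hy', hz, hz', hd, hx₀, hu₁, -, -, -⟩ := key y z hg x hx
    refine ⟨hy, hx₀, mul_ne_zero hy hu₁, mul_ne_zero hx₀ hd, by fun_prop, by fun_prop, ?_⟩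
    exact ((ContinuousAt.weight (f := fun x => x * z) (by fun_prop) (mul_ne_zero hx₀ hz)
      hu₁).mul continuousAt_const).mul continuousAt_const
  -- On N = 1 one has x = (1 - y)/(1 - zy).
  · refine ⟨fun _ => 0, fun y => 1 - y, fun y => -y, fun _ => 1, fun y z hg x hx => ?_⟩
    obtain ⟨hy, hy', hz, hz', hd, hx₀, hu₁, e₀, e₄, e₂⟩ := key y z hg x hx
    have hu₀ : 1 - x ≠ 0 := e₀ ▸ mul_ne_zero hy hu₁
    have ed : -y * z + 1 = 1 - z * y := by ring
    refine ⟨hz, ?_, ?_, e₀.symm, e₄.symm, ?_⟩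
    · rw [zero_mul, zero_sub, mul_neg, neg_neg]
      exact mul_ne_zero hy' hy
    · change x = (0 * z + (1 - y)) / (-y * z + 1)
      rw [ed, e₄, zero_mul, zero_add, mul_div_cancel_right₀ _ hd]
    rw [ed, weight_eq (mul_ne_zero hx₀ hz) hu₁, weight_eq hz hz', weight_eq (mul_ne_zero hz hy) hd,
      weight_eq hx₀ hu₀, weight_eq hy hy', zero_mul, zero_sub, mul_neg, neg_neg, modulus_neg,
      ← exp_logMod hz, ← exp_logMod (mul_ne_zero hy' hy), ← exp_logMod hd,
      ← exp_logMod (div_ne_zero (mul_ne_zero hz hd) hz'), ← Real.exp_nat_mul, ← Real.exp_sub]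
    simp only [← Real.exp_add]
    rw [logMod_div (mul_ne_zero hz hd) hz', logMod_mul hz hd, logMod_mul hy' hy, e₀, e₄, e₂,
      logMod_mul hy hu₁, logMod_mul hx₀ hd, logMod_mul hu₁ hd, logMod_mul hx₀ hz, logMod_mul hz hy]
    congr 1
    push_cast
    linear_combination logMod x * h₂₃ + logMod y * h₁₂ + logMod z * h₀₄ -
      logMod (1 - x * z) * h₃₄ - logMod (1 - z * y) * h₀₁

/-- The pentagon with the tetrahedra `T 1`, `T 2` on one side; here `x = X₁`, `y = X₂`,
`z = X₄`. -/
theorem affineData_one_two (hφ : IsKernel φ) {a c : Fin 5 → ℝ}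
    (h₃₄ : a 0 = a 1 + a 2) (h₀₁ : a 2 = a 3 + a 4)
    (h₀₄ : c 3 = c 1 + c 2) (h₁₂ : a 0 + c 3 + c 4 = 2) (h₂₃ : c 1 = c 0 + a 4) :
    AffineData μ
      (fun x y z => φ (z / (1 - x / y)) ((1 - y * z) * (1 - x / y) / z) x y *
        ((weight (a 0) (c 0) (x / y) * weight (a 3) (c 3) (y * z) * weight (a 4) (c 4) (z) : ℝ) : ℂ))
      (fun x y => φ (1 / (1 - x)) (1 - y) x y *
        ((weight (a 1) (c 1) (x) * weight (a 2) (c 2) (y) : ℝ) : ℂ))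
      (fun y z => (1 - y * z) / (y * (1 - z)))
      (fun _ _ => 0)
      (fun y z => y * (1 - y) * z * (1 - z) * (1 - y * z)) := by
  have key : ∀ y z : F, y * (1 - y) * z * (1 - z) * (1 - y * z) ≠ 0 → ∀ x,
      x = (1 - 0) / ((1 - y * z) / (y * (1 - z))) →
      y ≠ 0 ∧ 1 - y ≠ 0 ∧ z ≠ 0 ∧ 1 - z ≠ 0 ∧ 1 - y * z ≠ 0 ∧ x ≠ 0 ∧ 1 - x ≠ 0 ∧
        1 - x / y = z * (1 - x) ∧ 1 - z = x / y * (1 - y * z) ∧ 1 - y = (1 - x) * (1 - y * z) := by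
    intro y z hg x hx
    simp only [ne_eq, mul_eq_zero, not_or] at hg
    obtain ⟨⟨⟨⟨hy, hy'⟩, hz⟩, hz'⟩, hd⟩ := hg
    have hx₁ : x * (1 - y * z) = y * (1 - z) := by
      rw [hx, sub_zero, one_div_div, div_mul_cancel₀ _ hd]
    have hx₀ : x ≠ 0 := fun h => mul_ne_zero hy hz' (by rw [← hx₁, h, zero_mul])
    have e₂ : 1 - y = (1 - x) * (1 - y * z) := by linear_combination hx₁
    refine ⟨hy, hy', hz, hz', hd, hx₀, ?_, ?_, ?_, e₂⟩
    · intro h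
      rw [h, zero_mul] at e₂
      exact hy' e₂
    · field_simp
      linear_combination -hx₁
    · field_simp
      linear_combination -hx₁
  refine affineData_of_kernel μ hφ (by fun_prop) (by fun_prop) ?_ (by fun_prop) (by fun_prop) ?_
    (by fun_prop) (by fun_prop) (by fun_prop) ?_ ?_ ?_ ?_ ?_ ?_ ?_
  · exact ((Measurable.weight (by fun_prop)).mul (Measurable.weight (by fun_prop))).mul
      (Measurable.weight (by fun_prop))
  · exact (Measurable.weight (by fun_prop)).mul (Measurable.weight (by fun_prop))
  · classical
    refine ae_mul_ne_zero μ {0, 1} (fun y => {0, 1, y⁻¹}) fun y hy z hz => ?_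
    simp only [Finset.mem_insert, Finset.mem_singleton, not_or] at hy hz
    have h : y * z ≠ 1 := fun h => hz.2.2 (eq_inv_of_mul_eq_one_right h)
    simp only [ne_eq, mul_eq_zero, sub_eq_zero, not_or]
    exact ⟨⟨⟨⟨hy.1, Ne.symm hy.2⟩, hz.1⟩, Ne.symm hz.2.1⟩, Ne.symm h⟩
  · intro y z hg
    simp only [ne_eq, mul_eq_zero, not_or] at hg
    obtain ⟨⟨⟨⟨hy, hy'⟩, hz⟩, hz'⟩, hd⟩ := hg
    exact div_ne_zero hd (mul_ne_zero hy hz')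
  · exact fun x y z => weight_mul_nonneg _ _ _ _ _ _ _ _ _
  · refine Eventually.of_forall fun z R L => ⟨(|-(a 0 - 1) + (a 3 - 1)| + |a 3 - 1| + |c 0| +
      |-c 0 + c 3| + |(0 : ℝ)|) * L + ((a 0 - 1 + c 3 + c 4) * logMod z +
        (a 4 - 1) * logMod (1 - z)), ?_⟩
    intro x y hw hp hq hx hy kp kq kx ky
    replace hx := hx.1
    replace hy := hy.1
    obtain ⟨⟨hX₀, hu₀⟩, ⟨hX₃, hu₃⟩, hz, hu₄⟩ := ne_of_weight_mul_ne_zero hw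
    refine le_exp_of_eq (S := _) (by
      rw [weight_eq hX₀ hu₀, weight_eq hX₃ hu₃, weight_eq hz hu₄, ← Real.exp_add, ← Real.exp_add]) ?_
    have := sum_mul_le (e₁ := -(a 0 - 1) + (a 3 - 1)) (e₂ := a 3 - 1) (e₃ := c 0)
      (e₄ := -c 0 + c 3) (e₅ := 0) kp kq kx ky ky
    rw [logMod_div hz hu₀, logMod_div (mul_ne_zero hu₃ hu₀) hz, logMod_mul hu₃ hu₀] at this
    rw [logMod_div hx hy, logMod_mul hy hz]
    linarith
  · refine fun R L => ⟨(|-(a 0 - 1) + (a 3 - 1) + (a 4 - 1)| + |a 3 - 1 + (a 4 - 1)| + |c 0 + (a 4 - 1)| + |-c 0 + c 3 - (a 4 - 1) - 1| + |-(a 4 - 1) - 1|) * L,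
      R * (1 + R * R), ?_⟩
    intro x y z hw hp hq hx hy hn kp kq kx ky kn
    obtain ⟨⟨hX₀, hu₀⟩, ⟨hX₃, hu₃⟩, hz, hu₄⟩ := ne_of_weight_mul_ne_zero hw
    have hα := div_ne_zero hu₃ (mul_ne_zero hy.1 hu₄)
    refine ⟨?_, hα, hz, ?_⟩
    · have hR : 0 ≤ R := (norm_nonneg _).trans hp.2.1
      -- Here z = P (1 - x/y), and both factors are bounded.
      rw [← div_mul_cancel₀ z hu₀, norm_mul]
      refine mul_le_mul hp.2.1 ?_ (norm_nonneg _) hR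
      rw [div_eq_mul_inv]
      exact norm_one_sub_le hx.2.1 hy.2.2
    replace hx := hx.1
    replace hy := hy.1
    refine le_exp_of_eq (S := _) (by
      rw [weight_eq hX₀ hu₀, weight_eq hX₃ hu₃, weight_eq hz hu₄, ← Real.exp_add, ← Real.exp_add]) ?_
    refine le_trans (le_of_eq ?_) (add_le_add_left (sum_mul_le kp kq kx ky kn) _)
    rw [add_zero, logMod_mul hα hx, logMod_div hu₃ (mul_ne_zero hy hu₄), logMod_mul hy hu₄,
      logMod_div hz hu₀, logMod_div (mul_ne_zero hu₃ hu₀) hz, logMod_mul hu₃ hu₀,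
      logMod_div hx hy, logMod_mul hy hz]
    linear_combination logMod z * h₁₂
  · intro y z hg x hx
    obtain ⟨hy, hy', hz, hz', hd, hx₀, hu₁, e₀, -, -⟩ := key y z hg x hx
    have hu₀ : 1 - x / y ≠ 0 := e₀ ▸ mul_ne_zero hz hu₁
    refine ⟨hy, hx₀, div_ne_zero hz hu₀, div_ne_zero (mul_ne_zero hd hu₀) hz,
      by fun_prop (disch := assumption), by fun_prop, ?_⟩
    exact ((ContinuousAt.weight (f := fun x => x / y) (by fun_prop) (div_ne_zero hx₀ hy)
      hu₀).mul continuousAt_const).mul continuousAt_const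
  -- On N = 1 one has x = y(1 - z)/(1 - yz).
  · refine ⟨fun y => -y, fun y => y, fun y => -y, fun _ => 1, fun y z hg x hx => ?_⟩
    obtain ⟨hy, hy', hz, hz', hd, hx₀, hu₁, e₀, e₄, e₂⟩ := key y z hg x hx
    have hX₀ : x / y ≠ 0 := div_ne_zero hx₀ hy
    have hu₀ : 1 - x / y ≠ 0 := e₀ ▸ mul_ne_zero hz hu₁
    have ed : -y * z + 1 = 1 - y * z := by ring
    have edet : -y * 1 - y * -y = -(y * (1 - y)) := by ring
    refine ⟨hz, ?_, ?_, ?_, ?_, ?_⟩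
    · rw [edet]
      exact neg_ne_zero.2 (mul_ne_zero hy hy')
    · rw [hx, ed, sub_zero, one_div_div]
      ring
    · rw [e₀]
      field_simp
    · rw [e₀, e₂]
      field_simp
    rw [ed, edet, weight_eq hX₀ hu₀, weight_eq (mul_ne_zero hy hz) hd, weight_eq hz hz',
      weight_eq hx₀ hu₁, weight_eq hy hy', modulus_neg,
      ← exp_logMod hz, ← exp_logMod (mul_ne_zero hy hy'), ← exp_logMod hd,
      ← exp_logMod (div_ne_zero hd (mul_ne_zero hy hz')), ← Real.exp_nat_mul, ← Real.exp_sub]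
    simp only [← Real.exp_add]
    rw [logMod_div hd (mul_ne_zero hy hz'), logMod_mul hy hz', logMod_mul hy hy', e₀, e₄, e₂,
      logMod_mul hz hu₁, logMod_mul hX₀ hd, logMod_mul hu₁ hd, logMod_mul hy hz,
      logMod_div hx₀ hy]
    congr 1
    push_cast
    linear_combination -logMod x * h₂₃ + logMod y * (h₀₄ + h₂₃) + logMod z * h₁₂ +
      logMod (1 - x) * h₃₄ - logMod (1 - y * z) * h₀₁

/-- The pentagon with the tetrahedra `T 3`, `T 4` on one side; here `x = X₀`, `y = X₂`,
`z = X₄`. -/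
theorem affineData_three_four (hφ : IsKernel φ) {a c : Fin 5 → ℝ}
    (h₃₄ : a 0 + a 1 + a 2 = 2) (h₀₁ : a 2 = a 3 + a 4)
    (h₀₄ : c 3 = c 1 + c 2) (h₁₂ : a 0 = c 3 + c 4) (h₂₃ : a 4 = c 0 + c 1) :
    AffineData μ
      (fun x y z => φ (1 / z) (1 / (1 - y * z)) x y *
        ((weight (a 3) (c 3) (y * z) * weight (a 4) (c 4) (z) : ℝ) : ℂ))
      (fun x y => φ ((1 - x * y) / (1 - x)) ((1 - x * y) / (1 - y)) x y *
        ((weight (a 0) (c 0) (x) * weight (a 1) (c 1) (x * y) * weight (a 2) (c 2) (y) : ℝ) : ℂ))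
      (fun y z => (1 - y * z) / (1 - z))
      (fun _ _ => 0)
      (fun y z => y * (1 - y) * z * (1 - z) * (1 - y * z)) := by
  have key : ∀ y z : F, y * (1 - y) * z * (1 - z) * (1 - y * z) ≠ 0 → ∀ x,
      x = (1 - 0) / ((1 - y * z) / (1 - z)) →
      y ≠ 0 ∧ 1 - y ≠ 0 ∧ z ≠ 0 ∧ 1 - z ≠ 0 ∧ 1 - y * z ≠ 0 ∧ x ≠ 0 ∧ 1 - x * y ≠ 0 ∧
        1 - x = z * (1 - x * y) ∧ 1 - z = x * (1 - y * z) ∧ 1 - y = (1 - x * y) * (1 - y * z) := by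
    intro y z hg x hx
    simp only [ne_eq, mul_eq_zero, not_or] at hg
    obtain ⟨⟨⟨⟨hy, hy'⟩, hz⟩, hz'⟩, hd⟩ := hg
    have hx₁ : x * (1 - y * z) = 1 - z := by
      rw [hx, sub_zero, one_div_div, div_mul_cancel₀ _ hd]
    have hx₀ : x ≠ 0 := fun h => hz' (by rw [← hx₁, h, zero_mul])
    have e₂ : 1 - y = (1 - x * y) * (1 - y * z) := by linear_combination y * hx₁
    refine ⟨hy, hy', hz, hz', hd, hx₀, ?_, by linear_combination -hx₁, hx₁.symm, e₂⟩
    intro h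
    rw [h, zero_mul] at e₂
    exact hy' e₂
  refine affineData_of_kernel μ hφ (by fun_prop) (by fun_prop) ?_ (by fun_prop) (by fun_prop) ?_
    (by fun_prop) (by fun_prop) (by fun_prop) ?_ ?_ ?_ ?_ ?_ ?_ ?_
  · exact (Measurable.weight (by fun_prop)).mul (Measurable.weight (by fun_prop))
  · exact ((Measurable.weight (by fun_prop)).mul (Measurable.weight (by fun_prop))).mul
      (Measurable.weight (by fun_prop))
  · classical
    refine ae_mul_ne_zero μ {0, 1} (fun y => {0, 1, y⁻¹}) fun y hy z hz => ?_
    simp only [Finset.mem_insert, Finset.mem_singleton, not_or] at hy hz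
    have h : y * z ≠ 1 := fun h => hz.2.2 (eq_inv_of_mul_eq_one_right h)
    simp only [ne_eq, mul_eq_zero, sub_eq_zero, not_or]
    exact ⟨⟨⟨⟨hy.1, Ne.symm hy.2⟩, hz.1⟩, Ne.symm hz.2.1⟩, Ne.symm h⟩
  · intro y z hg
    simp only [ne_eq, mul_eq_zero, not_or] at hg
    obtain ⟨⟨⟨⟨hy, hy'⟩, hz⟩, hz'⟩, hd⟩ := hg
    exact div_ne_zero hd hz'
  · exact fun x y z => mul_nonneg (weight_nonneg _ _ _) (weight_nonneg _ _ _)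
  · refine Eventually.of_forall fun z R L => ⟨(|(0 : ℝ)| + |-(a 3 - 1)| + |(0 : ℝ)| +
      |c 3| + |(0 : ℝ)|) * L + ((c 3 + c 4) * logMod z + (a 4 - 1) * logMod (1 - z)), ?_⟩
    intro x y hw hp hq hx hy kp kq kx ky
    replace hx := hx.1
    replace hy := hy.1
    obtain ⟨hX₃, hu₃⟩ := ne_of_weight_ne_zero (left_ne_zero_of_mul hw)
    obtain ⟨hz, hu₄⟩ := ne_of_weight_ne_zero (right_ne_zero_of_mul hw)
    refine le_exp_of_eq (S := _) (by rw [weight_eq hX₃ hu₃, weight_eq hz hu₄, ← Real.exp_add]) ?_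
    have := sum_mul_le (e₁ := 0) (e₂ := -(a 3 - 1)) (e₃ := 0) (e₄ := c 3) (e₅ := 0) kp kq kx ky ky
    rw [logMod_one_div, logMod_one_div] at this
    rw [logMod_mul hy hz]
    linarith
  · refine fun R L => ⟨(|-(c 3 + c 4) + 1| + |-(a 3 - 1) - (a 4 - 1)| + |a 4 - 1| + |c 3 - 1| + |-(a 4 - 1) - 1|) * L,
      R, ?_⟩
    intro x y z hw hp hq hx hy hn kp kq kx ky kn
    obtain ⟨hX₃, hu₃⟩ := ne_of_weight_ne_zero (left_ne_zero_of_mul hw)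
    obtain ⟨hz, hu₄⟩ := ne_of_weight_ne_zero (right_ne_zero_of_mul hw)
    have hα := div_ne_zero hu₃ hu₄
    refine ⟨?_, hα, hz, ?_⟩
    -- In this case P = 1/z, so z itself lies in the annulus and no angle relation is needed for the
    -- estimate.
    · simpa using hp.2.2
    replace hx := hx.1
    replace hy := hy.1
    refine le_exp_of_eq (S := _) (by rw [weight_eq hX₃ hu₃, weight_eq hz hu₄, ← Real.exp_add]) ?_
    refine le_trans (le_of_eq ?_) (add_le_add_left (sum_mul_le kp kq kx ky kn) _)
    rw [add_zero, logMod_mul hα hx, logMod_div hu₃ hu₄, logMod_one_div, logMod_one_div,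
      logMod_mul hy hz]
    ring
  · intro y z hg x hx
    obtain ⟨hy, hy', hz, hz', hd, hx₀, hu₁, -, -, -⟩ := key y z hg x hx
    exact ⟨hy, hx₀, one_div_ne_zero hz, one_div_ne_zero hd, by fun_prop, by fun_prop, by fun_prop⟩
  -- On N = 1 one has x = (1 - z)/(1 - yz). The two weights in z, y now produce the three weights of
  -- the limit.
  · refine ⟨fun _ => -1, fun _ => 1, fun y => -y, fun _ => 1, fun y z hg x hx => ?_⟩
    obtain ⟨hy, hy', hz, hz', hd, hx₀, hu₁, e₀, e₄, e₂⟩ := key y z hg x hx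
    have hu₀ : 1 - x ≠ 0 := e₀ ▸ mul_ne_zero hz hu₁
    have ed : -y * z + 1 = 1 - y * z := by ring
    have edet : -1 * 1 - 1 * -y = -(1 - y) := by ring
    refine ⟨hz, ?_, ?_, ?_, ?_, ?_⟩
    · rw [edet]
      exact neg_ne_zero.2 hy'
    · rw [hx, ed, sub_zero, one_div_div]
      ring
    · rw [e₀, div_mul_cancel_right₀ hu₁, one_div]
    · rw [e₂, div_mul_cancel_left₀ hu₁, one_div]
    rw [ed, edet, weight_eq (mul_ne_zero hy hz) hd, weight_eq hz hz',
      weight_eq hx₀ hu₀, weight_eq (mul_ne_zero hx₀ hy) hu₁, weight_eq hy hy', modulus_neg,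
      ← exp_logMod hz, ← exp_logMod hy', ← exp_logMod hd,
      ← exp_logMod (div_ne_zero hd hz'), ← Real.exp_nat_mul, ← Real.exp_sub]
    simp only [← Real.exp_add]
    rw [logMod_div hd hz', e₀, e₄, e₂, logMod_mul hz hu₁, logMod_mul hx₀ hd, logMod_mul hu₁ hd,
      logMod_mul hy hz, logMod_mul hx₀ hy]
    congr 1
    push_cast
    linear_combination logMod x * h₂₃ + logMod y * h₀₄ - logMod z * h₁₂ -
      logMod (1 - x * y) * h₃₄ - logMod (1 - y * z) * h₀₁

end Cases

/-! ### The pairs 02, 03 and 01 -/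

section Cases

variable {F : Type*} [NontriviallyNormedField F] [ProperSpace F] [MeasurableSpace F] [BorelSpace F]
  (μ : Measure F) [μ.IsAddHaarMeasure] {φ : F → F → F → F → ℂ}

/-- The pentagon with the tetrahedra `T 0`, `T 2` on one side; here `x = X₀`, `y = X₂`,
`z = 1 / X₄`. -/
theorem affineData_zero_two (hφ : IsKernel φ) {a c : Fin 5 → ℝ}
    (h₃₄ : a 1 = a 0 + a 2) (h₀₁ : a 2 = a 3 + a 4)
    (h₀₄ : c 2 = c 1 + c 3) (h₁₂ : a 0 = c 3 + c 4) (h₂₃ : c 0 = c 1 + a 4) :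
    AffineData μ
      (fun x y z => φ (1 / z * (1 - x * y)) ((1 - x * y) * (1 - y / z)) x y *
        ((weight (a 1) (c 1) (x * y) * weight (a 3) (c 3) (y / z) * weight (a 4) (c 4) (1 / z) : ℝ) : ℂ))
      (fun x y => φ (1 - x) (1 - y) x y *
        ((weight (a 0) (c 0) (x) * weight (a 2) (c 2) (y) : ℝ) : ℂ))
      (fun y z => (1 - y / z) / (1 - 1 / z))
      (fun _ _ => 0)
      (fun y z => y * (1 - y) * z * (1 - z) * (z - y)) := by
  have key : ∀ y z : F, y * (1 - y) * z * (1 - z) * (z - y) ≠ 0 → ∀ x,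
      x = (1 - 0) / ((1 - y / z) / (1 - 1 / z)) →
      y ≠ 0 ∧ 1 - y ≠ 0 ∧ z ≠ 0 ∧ 1 - 1 / z ≠ 0 ∧ 1 - y / z ≠ 0 ∧ x ≠ 0 ∧ 1 - x * y ≠ 0 ∧
        1 - x = 1 / z * (1 - x * y) ∧ 1 - 1 / z = x * (1 - y / z) ∧
        1 - y = (1 - x * y) * (1 - y / z) := by
    intro y z hg x hx
    simp only [ne_eq, mul_eq_zero, not_or] at hg
    obtain ⟨⟨⟨⟨hy, hy'⟩, hz⟩, hz'⟩, hd⟩ := hg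
    have hu₄ : 1 - 1 / z ≠ 0 := by
      rw [one_sub_div hz]
      exact div_ne_zero (by rwa [← neg_sub, neg_ne_zero]) hz
    have hu₃ : 1 - y / z ≠ 0 := by
      rw [one_sub_div hz]
      exact div_ne_zero hd hz
    have hx₁ : x * (1 - y / z) = 1 - 1 / z := by
      rw [hx, sub_zero, one_div_div, div_mul_cancel₀ _ hu₃]
    have hx₀ : x ≠ 0 := fun h => hu₄ (by rw [← hx₁, h, zero_mul])
    have e₂ : 1 - y = (1 - x * y) * (1 - y / z) := by linear_combination y * hx₁
    refine ⟨hy, hy', hz, hu₄, hu₃, hx₀, ?_, by linear_combination -hx₁, hx₁.symm, e₂⟩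
    intro h
    rw [h, zero_mul] at e₂
    exact hy' e₂
  refine affineData_of_kernel μ hφ (by fun_prop) (by fun_prop) ?_ (by fun_prop) (by fun_prop) ?_
    (by fun_prop) (by fun_prop) (by fun_prop) ?_ ?_ ?_ ?_ ?_ ?_ ?_
  · exact ((Measurable.weight (by fun_prop)).mul (Measurable.weight (by fun_prop))).mul
      (Measurable.weight (by fun_prop))
  · exact (Measurable.weight (by fun_prop)).mul (Measurable.weight (by fun_prop))
  · classical
    refine ae_mul_ne_zero μ {0, 1} (fun y => {0, 1, y}) fun y hy z hz => ?_
    simp only [Finset.mem_insert, Finset.mem_singleton, not_or] at hy hz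
    simp only [ne_eq, mul_eq_zero, sub_eq_zero, not_or]
    tauto
  · intro y z hg
    simp only [ne_eq, mul_eq_zero, not_or] at hg
    obtain ⟨⟨⟨⟨hy, hy'⟩, hz⟩, hz'⟩, hd⟩ := hg
    have hu₄ : 1 - 1 / z ≠ 0 := by
      rw [one_sub_div hz]
      exact div_ne_zero (by rwa [← neg_sub, neg_ne_zero]) hz
    have hu₃ : 1 - y / z ≠ 0 := by
      rw [one_sub_div hz]
      exact div_ne_zero hd hz
    exact div_ne_zero hu₃ hu₄
  · exact fun x y z => weight_mul_nonneg _ _ _ _ _ _ _ _ _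
  · refine Eventually.of_forall fun z R L => ⟨(|a 1 - 1 - (a 3 - 1)| + |a 3 - 1| + |c 1| +
      |c 1 + c 3| + |(0 : ℝ)|) * L + ((a 1 - 1 - (a 3 - 1) - c 3 - c 4) * logMod z +
        (a 4 - 1) * logMod (1 - 1 / z)), ?_⟩
    intro x y hw hp hq hx hy kp kq kx ky
    replace hx := hx.1
    replace hy := hy.1
    obtain ⟨⟨hX₁, hu₁⟩, ⟨hX₃, hu₃⟩, hX₄, hu₄⟩ := ne_of_weight_mul_ne_zero hw
    have hz : z ≠ 0 := fun h => hX₄ (by rw [h, div_zero])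
    refine le_exp_of_eq (S := _) (by
      rw [weight_eq hX₁ hu₁, weight_eq hX₃ hu₃, weight_eq hX₄ hu₄, ← Real.exp_add, ← Real.exp_add]) ?_
    have := sum_mul_le (e₁ := a 1 - 1 - (a 3 - 1)) (e₂ := a 3 - 1) (e₃ := c 1)
      (e₄ := c 1 + c 3) (e₅ := 0) kp kq kx ky ky
    rw [logMod_mul hX₄ hu₁, logMod_mul hu₁ hu₃, logMod_one_div] at this
    rw [logMod_mul hx hy, logMod_div hy hz, logMod_one_div]
    linarith
  · refine fun R L => ⟨(|a 1 - 1 - (a 3 - 1) - (a 4 - 1)| + |a 3 - 1 + (a 4 - 1)| + |c 1 + (a 4 - 1)| + |c 1 + c 3 - 1| + |-(a 4 - 1) - 1|) * L,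
      (1 + R * R) * R, ?_⟩
    intro x y z hw hp hq hx hy hn kp kq kx ky kn
    obtain ⟨⟨hX₁, hu₁⟩, ⟨hX₃, hu₃⟩, hX₄, hu₄⟩ := ne_of_weight_mul_ne_zero hw
    have hz : z ≠ 0 := fun h => hX₄ (by rw [h, div_zero])
    have hα := div_ne_zero hu₃ hu₄
    refine ⟨?_, hα, hz, ?_⟩
    -- As P = X₄(1 - xy) has a bounded inverse, it is 1/X₄ that stays bounded; this dictates the
    -- coordinate z = 1/X₄.
    · have key : ∀ u : F, u ≠ 0 → z = u * (1 / z * u)⁻¹ := by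
        intros
        field_simp
      have h := norm_one_sub_le hx.2.1 hy.2.1
      rw [key _ hu₁, norm_mul]
      exact mul_le_mul h hp.2.2 (norm_nonneg _) ((norm_nonneg _).trans h)
    replace hx := hx.1
    replace hy := hy.1
    refine le_exp_of_eq (S := _) (by
      rw [weight_eq hX₁ hu₁, weight_eq hX₃ hu₃, weight_eq hX₄ hu₄, ← Real.exp_add, ← Real.exp_add]) ?_
    refine le_trans (le_of_eq ?_) (add_le_add_left (sum_mul_le kp kq kx ky kn) _)
    rw [add_zero, logMod_mul hα hx, logMod_div hu₃ hu₄, logMod_mul hX₄ hu₁, logMod_mul hu₁ hu₃,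
      logMod_mul hx hy, logMod_div hy hz, logMod_one_div]
    linear_combination logMod z * (h₃₄ + h₁₂ + h₀₁)
  · intro y z hg x hx
    obtain ⟨hy, hy', hz, hu₄, hu₃, hx₀, hu₁, -, -, -⟩ := key y z hg x hx
    refine ⟨hy, hx₀, mul_ne_zero (one_div_ne_zero hz) hu₁, mul_ne_zero hu₁ hu₃, by fun_prop,
      by fun_prop, ?_⟩
    exact ((ContinuousAt.weight (f := fun x => x * y) (by fun_prop) (mul_ne_zero hx₀ hy)
      hu₁).mul continuousAt_const).mul continuousAt_const
  -- On N = 1 one has x = (z - 1)/(z - y).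
  · refine ⟨fun _ => 1, fun _ => -1, fun _ => 1, fun y => -y, fun y z hg x hx => ?_⟩
    obtain ⟨hy, hy', hz, hu₄, hu₃, hx₀, hu₁, e₀, e₄, e₂⟩ := key y z hg x hx
    have hX₄ : 1 / z ≠ 0 := one_div_ne_zero hz
    have hu₀ : 1 - x ≠ 0 := e₀ ▸ mul_ne_zero hX₄ hu₁
    have ed : 1 * z + -y = z * (1 - y / z) := by
      field_simp
      ring
    have edet : 1 * -y - -1 * 1 = 1 - y := by ring
    refine ⟨hz, ?_, ?_, e₀.symm, e₂.symm, ?_⟩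
    · rwa [edet]
    · rw [ed, eq_div_iff (mul_ne_zero hz hu₃), mul_left_comm, ← e₄]
      field_simp
      ring
    rw [ed, edet, weight_eq (mul_ne_zero hx₀ hy) hu₁, weight_eq (div_ne_zero hy hz) hu₃,
      weight_eq hX₄ hu₄, weight_eq hx₀ hu₀, weight_eq hy hy',
      ← exp_logMod hz, ← exp_logMod hy', ← exp_logMod (mul_ne_zero hz hu₃),
      ← exp_logMod (div_ne_zero hu₃ hu₄), ← Real.exp_nat_mul, ← Real.exp_sub]
    simp only [← Real.exp_add]
    rw [logMod_div hu₃ hu₄, logMod_mul hz hu₃, e₀, e₄, e₂, logMod_mul hX₄ hu₁, logMod_mul hx₀ hu₃,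
      logMod_mul hu₁ hu₃, logMod_mul hx₀ hy, logMod_div hy hz, logMod_one_div]
    congr 1
    push_cast
    linear_combination -logMod x * h₂₃ - logMod y * h₀₄ + logMod z * h₁₂ +
      logMod (1 - x * y) * h₃₄ - logMod (1 - y / z) * h₀₁

/-- The pentagon with the tetrahedra `T 0`, `T 3` on one side; here `x = 1 / X₀`, `y = X₃`,
`z = 1 / X₂`. -/
theorem affineData_zero_three (hφ : IsKernel φ) {a c : Fin 5 → ℝ}
    (h₃₄ : a 0 = a 1 + a 2) (h₀₁ : a 3 = a 2 + a 4)
    (h₀₄ : c 3 = c 1 + c 2) (h₁₂ : c 4 = a 0 + c 3) (h₂₃ : c 0 = c 1 + a 4) :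
    AffineData μ
      (fun x y z => φ (y * z * (1 - 1 / (x * z))) (1 / x / (1 - y * z)) x y *
        ((weight (a 1) (c 1) (1 / (x * z)) * weight (a 2) (c 2) (1 / z) * weight (a 4) (c 4) (y * z) : ℝ) : ℂ))
      (fun x y => φ (1 - 1 / x) (1 / (1 - y)) x y *
        ((weight (a 0) (c 0) (1 / x) * weight (a 3) (c 3) (y) : ℝ) : ℂ))
      (fun y z => (1 - y * z) / (1 - 1 / z))
      (fun y z => -(1 / z * (1 - y * z) / (1 - 1 / z)))
      (fun y z => y * (1 - y) * z * (1 - z) * (1 - y * z)) := by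
  have key : ∀ y z : F, y * (1 - y) * z * (1 - z) * (1 - y * z) ≠ 0 → ∀ x,
      x = (1 - (-(1 / z * (1 - y * z) / (1 - 1 / z)))) / ((1 - y * z) / (1 - 1 / z)) →
      y ≠ 0 ∧ 1 - y ≠ 0 ∧ z ≠ 0 ∧ 1 - 1 / z ≠ 0 ∧ 1 - y * z ≠ 0 ∧ x ≠ 0 ∧
        1 - 1 / (x * z) ≠ 0 ∧ 1 - 1 / x = y * z * (1 - 1 / (x * z)) ∧
        1 - y * z = 1 / x * (1 - y) ∧ 1 - 1 / z = (1 - 1 / (x * z)) * (1 - y) := by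
    intro y z hg x hx
    simp only [ne_eq, mul_eq_zero, not_or] at hg
    obtain ⟨⟨⟨⟨hy, hy'⟩, hz⟩, hz'⟩, hd⟩ := hg
    have hu₂ : 1 - 1 / z ≠ 0 := by
      rw [one_sub_div hz]
      exact div_ne_zero (by rwa [← neg_sub, neg_ne_zero]) hz
    have hx₁ : x * (1 - y * z) = 1 - y := by
      have h : ∀ d u : F, d ≠ 0 → u ≠ 0 → (1 - -(1 / z * d / u)) / (d / u) * d = u + 1 / z * d := by
        intros
        field_simp
        ring
      rw [hx, h _ _ hd hu₂]
      field_simp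
      ring
    have hx₀ : x ≠ 0 := fun h => hy' (by rw [← hx₁, h, zero_mul])
    have e₄ : 1 - y * z = 1 / x * (1 - y) := by
      rw [← hx₁, ← mul_assoc, one_div_mul_cancel hx₀, one_mul]
    have e₂ : 1 - 1 / z = (1 - 1 / (x * z)) * (1 - y) := by
      have h : 1 / (x * z) * (1 - y) = 1 / z - y := by
        rw [one_div_mul_eq_div, ← hx₁]
        field_simp
      linear_combination h
    refine ⟨hy, hy', hz, hu₂, hd, hx₀, ?_, ?_, e₄, e₂⟩
    · intro h
      rw [h, zero_mul] at e₂
      exact hu₂ e₂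
    · have h : y * z * (1 / (x * z)) = 1 / x * y := by field_simp
      linear_combination e₄ + h
  refine affineData_of_kernel μ hφ (by fun_prop) (by fun_prop) ?_ (by fun_prop) (by fun_prop) ?_
    (by fun_prop) (by fun_prop) (by fun_prop) ?_ ?_ ?_ ?_ ?_ ?_ ?_
  · exact ((Measurable.weight (by fun_prop)).mul (Measurable.weight (by fun_prop))).mul
      (Measurable.weight (by fun_prop))
  · exact (Measurable.weight (by fun_prop)).mul (Measurable.weight (by fun_prop))
  · classical
    refine ae_mul_ne_zero μ {0, 1} (fun y => {0, 1, y⁻¹}) fun y hy z hz => ?_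
    simp only [Finset.mem_insert, Finset.mem_singleton, not_or] at hy hz
    have h : y * z ≠ 1 := fun h => hz.2.2 (eq_inv_of_mul_eq_one_right h)
    simp only [ne_eq, mul_eq_zero, sub_eq_zero, not_or]
    exact ⟨⟨⟨⟨hy.1, Ne.symm hy.2⟩, hz.1⟩, Ne.symm hz.2.1⟩, Ne.symm h⟩
  · intro y z hg
    simp only [ne_eq, mul_eq_zero, not_or] at hg
    obtain ⟨⟨⟨⟨hy, hy'⟩, hz⟩, hz'⟩, hd⟩ := hg
    have hu₂ : 1 - 1 / z ≠ 0 := by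
      rw [one_sub_div hz]
      exact div_ne_zero (by rwa [← neg_sub, neg_ne_zero]) hz
    exact div_ne_zero hd hu₂
  · exact fun x y z => weight_mul_nonneg _ _ _ _ _ _ _ _ _
  · refine Eventually.of_forall fun z R L => ⟨(|a 1 - 1| + |-(a 4 - 1)| + |-c 1 - (a 4 - 1)| +
      |-(a 1 - 1) + c 4| + |(0 : ℝ)|) * L + ((-c 1 - (a 1 - 1) - c 2 + c 4) * logMod z +
        (a 2 - 1) * logMod (1 - 1 / z)), ?_⟩
    intro x y hw hp hq hx hy kp kq kx ky
    replace hx := hx.1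
    replace hy := hy.1
    obtain ⟨⟨hX₁, hu₁⟩, ⟨hX₂, hu₂⟩, hX₄, hu₄⟩ := ne_of_weight_mul_ne_zero hw
    have hz : z ≠ 0 := right_ne_zero_of_mul hX₄
    refine le_exp_of_eq (S := _) (by
      rw [weight_eq hX₁ hu₁, weight_eq hX₂ hu₂, weight_eq hX₄ hu₄, ← Real.exp_add, ← Real.exp_add]) ?_
    have := sum_mul_le (e₁ := a 1 - 1) (e₂ := -(a 4 - 1)) (e₃ := -c 1 - (a 4 - 1))
      (e₄ := -(a 1 - 1) + c 4) (e₅ := 0) kp kq kx ky ky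
    rw [logMod_mul hX₄ hu₁, logMod_div (one_div_ne_zero hx) hu₄, logMod_mul hy hz,
      logMod_one_div] at this
    rw [logMod_one_div, logMod_mul hx hz, logMod_mul hy hz, logMod_one_div]
    linarith
  · refine fun R L => ⟨(|a 1 - 1 + (a 2 - 1) + 1| + |-(a 4 - 1) - (a 2 - 1)| + |-c 1 - (a 4 - 1)| + |-(a 1 - 1) + c 4 - (a 2 - 1) - 2| + |-(a 2 - 1) - 1|) * L,
      R * (1 + R * R), ?_⟩
    intro x y z hw hp hq hx hy hn kp kq kx ky kn
    obtain ⟨⟨hX₁, hu₁⟩, ⟨hX₂, hu₂⟩, hX₄, hu₄⟩ := ne_of_weight_mul_ne_zero hw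
    have hz : z ≠ 0 := right_ne_zero_of_mul hX₄
    have hα := div_ne_zero hu₄ hu₂
    have en : (1 - y * z) / (1 - 1 / z) * x + -(1 / z * (1 - y * z) / (1 - 1 / z)) =
        (1 - 1 / (x * z)) * (1 - y * z) / ((1 - 1 / z) * (1 / x)) := by
      have h : x * (1 - 1 / (x * z)) = x - 1 / z := by
        have := hx.1
        field_simp
      rw [mul_one_div, div_div_eq_mul_div, mul_right_comm, mul_comm (1 - 1 / (x * z)) x, h]
      ring
    rw [en] at hn kn
    refine ⟨?_, hα, hz, ?_⟩
    -- Q = x⁻¹/(1 - yz) gives yz = 1 - x⁻¹Q⁻¹, which bounds yz and hence z = 1/X₂.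
    · have key : ∀ u : F, u ≠ 0 → 1 - u = 1 - x⁻¹ * (1 / x / u)⁻¹ := by
        intro u hu
        have := hx.1
        field_simp
      have h₁ := key _ hu₄
      rw [sub_sub_cancel] at h₁
      have h₂ : z = y⁻¹ * (y * z) := by rw [inv_mul_cancel_left₀ hy.1]
      have hR : 0 ≤ R := (norm_nonneg _).trans hp.2.1
      rw [h₂, h₁, norm_mul]
      exact mul_le_mul hy.2.2 (norm_one_sub_le hx.2.2 hq.2.2) (norm_nonneg _) hR
    replace hx := hx.1
    replace hy := hy.1
    refine le_exp_of_eq (S := _) (by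
      rw [weight_eq hX₁ hu₁, weight_eq hX₂ hu₂, weight_eq hX₄ hu₄, ← Real.exp_add, ← Real.exp_add]) ?_
    refine le_trans (le_of_eq ?_) (add_le_add_left (sum_mul_le kp kq kx ky kn) _)
    have hX₀ : 1 / x ≠ 0 := one_div_ne_zero hx
    rw [logMod_div (mul_ne_zero hu₁ hu₄) (mul_ne_zero hu₂ hX₀), logMod_mul hu₁ hu₄,
      logMod_mul hu₂ hX₀, logMod_div hu₄ hu₂, logMod_mul hX₄ hu₁, logMod_div hX₀ hu₄,
      logMod_mul hy hz, logMod_one_div, logMod_one_div, logMod_one_div, logMod_mul hx hz]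
    linear_combination logMod z * (h₁₂ + h₀₄ + h₃₄)
  · intro y z hg x hx
    obtain ⟨hy, hy', hz, hu₂, hd, hx₀, hu₁, -, -, -⟩ := key y z hg x hx
    have hxz := mul_ne_zero hx₀ hz
    refine ⟨hy, hx₀, mul_ne_zero (mul_ne_zero hy hz) hu₁, div_ne_zero (one_div_ne_zero hx₀) hd,
      by fun_prop (disch := assumption), by fun_prop (disch := assumption), ?_⟩
    exact ((ContinuousAt.weight (f := fun x => 1 / (x * z)) (by fun_prop (disch := assumption))
      (one_div_ne_zero hxz) hu₁).mul continuousAt_const).mul continuousAt_const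
  · refine ⟨fun _ => 0, fun y => 1 - y, fun y => -y, fun _ => 1, fun y z hg x hx => ?_⟩
    obtain ⟨hy, hy', hz, hu₂, hd, hx₀, hu₁, e₀, e₄, e₂⟩ := key y z hg x hx
    have hX₀ : 1 / x ≠ 0 := one_div_ne_zero hx₀
    have hX₁ : 1 / (x * z) ≠ 0 := one_div_ne_zero (mul_ne_zero hx₀ hz)
    have hX₄ : y * z ≠ 0 := mul_ne_zero hy hz
    have hu₀ : 1 - 1 / x ≠ 0 := e₀ ▸ mul_ne_zero hX₄ hu₁
    have ed : -y * z + 1 = 1 - y * z := by ring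
    refine ⟨hz, ?_, ?_, e₀.symm, ?_, ?_⟩
    · rw [zero_mul, zero_sub, mul_neg, neg_neg]
      exact mul_ne_zero hy' hy
    · change x = (0 * z + (1 - y)) / (-y * z + 1)
      rw [ed, e₄]
      field_simp
      ring
    · rw [e₄, div_mul_cancel_left₀ hX₀, one_div (1 - y)]
    rw [ed, weight_eq hX₁ hu₁, weight_eq (one_div_ne_zero hz) hu₂, weight_eq hX₄ hd,
      weight_eq hX₀ hu₀, weight_eq hy hy', zero_mul, zero_sub, mul_neg, neg_neg,
      ← exp_logMod hz, ← exp_logMod (mul_ne_zero hy' hy), ← exp_logMod hd,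
      ← exp_logMod (div_ne_zero hd hu₂), ← Real.exp_nat_mul, ← Real.exp_sub]
    simp only [← Real.exp_add]
    rw [logMod_div hd hu₂, logMod_mul hy' hy, e₀, e₄, e₂, logMod_mul hX₄ hu₁,
      logMod_mul hX₀ hy', logMod_mul hu₁ hy', logMod_mul hy hz, logMod_one_div (x * z),
      logMod_mul hx₀ hz, logMod_one_div, logMod_one_div]
    congr 1
    push_cast
    linear_combination logMod x * h₂₃ + logMod y * h₁₂ + logMod z * (h₁₂ + h₀₄) -
      logMod (1 - 1 / (x * z)) * h₃₄ - logMod (1 - y) * h₀₁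

/-- The pentagon with the tetrahedra `T 0`, `T 1` on one side; here `x = X₀`, `y = X₁`,
`z = X₄`. -/
theorem affineData_zero_one (hφ : IsKernel φ) {a c : Fin 5 → ℝ}
    (h₃₄ : a 2 = a 0 + a 1) (h₀₁ : a 2 + a 3 + a 4 = 2)
    (h₀₄ : c 1 = c 2 + c 3) (h₁₂ : a 0 = c 3 + c 4) (h₂₃ : a 4 = c 0 + c 1) :
    AffineData μ
      (fun x y z => φ (z * (1 - y / x) / (1 - y * z / x)) ((1 - y * z / x) / (1 - y / x)) x y *
        ((weight (a 2) (c 2) (y / x) * weight (a 3) (c 3) (y * z / x) * weight (a 4) (c 4) (z) : ℝ) : ℂ))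
      (fun x y => φ (1 - x) (1 / (1 - y)) x y *
        ((weight (a 0) (c 0) (x) * weight (a 1) (c 1) (y) : ℝ) : ℂ))
      (fun _ z => 1 / (1 - z))
      (fun y z => -(y * z / (1 - z)))
      (fun y z => y * (1 - y) * z * (1 - z) * (1 - z * (1 - y))) := by
  -- On the surface x = 1 - z(1 - y), so the last factor of the discriminant ensures x ≠ 0.
  have key : ∀ y z : F, y * (1 - y) * z * (1 - z) * (1 - z * (1 - y)) ≠ 0 → ∀ x,
      x = (1 - (-(y * z / (1 - z)))) / (1 / (1 - z)) →
      y ≠ 0 ∧ 1 - y ≠ 0 ∧ z ≠ 0 ∧ 1 - z ≠ 0 ∧ x ≠ 0 ∧ 1 - y / x ≠ 0 ∧ 1 - y * z / x ≠ 0 ∧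
        1 - x = z * (1 - y) ∧ 1 - y / x = (1 - z) * (1 - y) / x ∧ 1 - y * z / x = (1 - z) / x := by
    intro y z hg x hx
    simp only [ne_eq, mul_eq_zero, not_or] at hg
    obtain ⟨⟨⟨⟨hy, hy'⟩, hz⟩, hz'⟩, hd⟩ := hg
    have hx₁ : x = 1 - z * (1 - y) := by
      have h : ∀ u : F, u ≠ 0 → (1 - -(y * z / u)) / (1 / u) = u + y * z := by
        intros
        field_simp
        ring
      rw [hx, h _ hz']
      ring
    have hx₀ : x ≠ 0 := hx₁ ▸ hd
    have e₂ : 1 - y / x = (1 - z) * (1 - y) / x := by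
      rw [one_sub_div hx₀]
      congr 1
      linear_combination hx₁
    have e₃ : 1 - y * z / x = (1 - z) / x := by
      rw [one_sub_div hx₀]
      congr 1
      linear_combination hx₁
    refine ⟨hy, hy', hz, hz', hx₀, ?_, ?_, by linear_combination -hx₁, e₂, e₃⟩
    · rw [e₂]
      exact div_ne_zero (mul_ne_zero hz' hy') hx₀
    · rw [e₃]
      exact div_ne_zero hz' hx₀
  refine affineData_of_kernel μ hφ (by fun_prop) (by fun_prop) ?_ (by fun_prop) (by fun_prop) ?_
    (by fun_prop) (by fun_prop) (by fun_prop) ?_ ?_ ?_ ?_ ?_ ?_ ?_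
  · exact ((Measurable.weight (by fun_prop)).mul (Measurable.weight (by fun_prop))).mul
      (Measurable.weight (by fun_prop))
  · exact (Measurable.weight (by fun_prop)).mul (Measurable.weight (by fun_prop))
  · classical
    refine ae_mul_ne_zero μ {0, 1} (fun y => {0, 1, (1 - y)⁻¹}) fun y hy z hz => ?_
    simp only [Finset.mem_insert, Finset.mem_singleton, not_or] at hy hz
    have h : z * (1 - y) ≠ 1 := fun h => hz.2.2 (eq_inv_of_mul_eq_one_left h)
    simp only [ne_eq, mul_eq_zero, sub_eq_zero, not_or]
    exact ⟨⟨⟨⟨hy.1, Ne.symm hy.2⟩, hz.1⟩, Ne.symm hz.2.1⟩, Ne.symm h⟩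
  · intro y z hg
    simp only [ne_eq, mul_eq_zero, not_or] at hg
    obtain ⟨⟨⟨⟨hy, hy'⟩, hz⟩, hz'⟩, hd⟩ := hg
    exact one_div_ne_zero hz'
  · exact fun x y z => weight_mul_nonneg _ _ _ _ _ _ _ _ _
  · refine Eventually.of_forall fun z R L => ?_
    -- Here P = z/Q, so P and Q control only the quotient of 1 - X₃ and 1 - X₂. A separate bound for
    -- 1 - X₂ = 1 - y/x, depending on z, is required on the slice.
    obtain ⟨L', hL', hL⟩ :=
      exists_abs_logMod_le (F := F) (max (1 + R * R) ((R + ‖z‖) * ‖(1 - z)⁻¹‖))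
    refine ⟨(|(0 : ℝ)| + |a 3 - 1| + |-c 2 - c 3| + |c 2 + c 3| +
      |a 2 - 1 + (a 3 - 1)|) * max L L' + ((c 3 + c 4) * logMod z +
        (a 4 - 1) * logMod (1 - z)), ?_⟩
    intro x y hw hp hq hx hy kp kq kx ky
    obtain ⟨⟨hX₂, hu₂⟩, ⟨hX₃, hu₃⟩, hz, hu₄⟩ := ne_of_weight_mul_ne_zero hw
    have ku : |logMod (1 - y / x)| ≤ L' := by
      refine hL _ ?_ ?_ hu₂
      · rw [div_eq_mul_inv]
        exact (norm_one_sub_le hy.2.1 hx.2.2).trans (le_max_left _ _)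
      -- The identity (1 - y/x)⁻¹ = (Q - z)/(1 - z) bounds the inverse by (R + ‖z‖)‖(1 - z)⁻¹‖.
      · have e : (1 - y / x)⁻¹ = ((1 - y * z / x) / (1 - y / x) - z) * (1 - z)⁻¹ := by
          rw [inv_eq_one_div, div_sub' hu₂, ← div_eq_mul_inv, div_div, div_eq_div_iff hu₂
            (mul_ne_zero hu₂ hu₄)]
          ring
        refine le_trans ?_ (le_max_right _ _)
        rw [e, norm_mul]
        refine mul_le_mul_of_nonneg_right ((norm_sub_le _ _).trans ?_) (norm_nonneg _)
        exact add_le_add_left hq.2.1 _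
    replace hx := hx.1
    replace hy := hy.1
    refine le_exp_of_eq (S := _) (by
      rw [weight_eq hX₂ hu₂, weight_eq hX₃ hu₃, weight_eq hz hu₄, ← Real.exp_add, ← Real.exp_add]) ?_
    have := sum_mul_le (e₁ := 0) (e₂ := a 3 - 1) (e₃ := -c 2 - c 3) (e₄ := c 2 + c 3)
      (e₅ := a 2 - 1 + (a 3 - 1)) (kp.trans (le_max_left L L')) (kq.trans (le_max_left L L'))
      (kx.trans (le_max_left L L')) (ky.trans (le_max_left L L')) (ku.trans (le_max_right L L'))
    rw [logMod_div hu₃ hu₂] at this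
    rw [logMod_div (mul_ne_zero hy hz) hx, logMod_mul hy hz, logMod_div hy hx]
    linarith
  · refine fun R L => ⟨(|c 3 + c 4 - 1| + |-(a 2 - 1) + c 3 + c 4 - 1| + |-c 2 - c 3 + (a 4 - 1)| + |c 2 + c 3 - 1| + |-(a 4 - 1) - 1|) * L,
      R * R, ?_⟩
    intro x y z hw hp hq hx hy hn kp kq kx ky kn
    obtain ⟨⟨hX₂, hu₂⟩, ⟨hX₃, hu₃⟩, hz, hu₄⟩ := ne_of_weight_mul_ne_zero hw
    have hα := one_div_ne_zero hu₄
    have en : 1 / (1 - z) * x + -(y * z / (1 - z)) = x * (1 - y * z / x) / (1 - z) := by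
      rw [mul_sub, mul_one, mul_div_cancel₀ _ hx.1]
      ring
    rw [en] at hn kn
    refine ⟨?_, hα, hz, ?_⟩
    · have key : ∀ u₂ u₃ : F, u₂ ≠ 0 → u₃ ≠ 0 → z = z * u₂ / u₃ * (u₃ / u₂) := by
        intros
        field_simp
      rw [key _ _ hu₂ hu₃, norm_mul]
      exact mul_le_mul hp.2.1 hq.2.1 (norm_nonneg _) ((norm_nonneg _).trans hp.2.1)
    replace hx := hx.1
    replace hy := hy.1
    refine le_exp_of_eq (S := _) (by
      rw [weight_eq hX₂ hu₂, weight_eq hX₃ hu₃, weight_eq hz hu₄, ← Real.exp_add, ← Real.exp_add]) ?_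
    refine le_trans (le_of_eq ?_) (add_le_add_left (sum_mul_le kp kq kx ky kn) _)
    rw [logMod_div (mul_ne_zero hx hu₃) hu₄, logMod_mul hx hu₃, logMod_one_div,
      logMod_div (mul_ne_zero hz hu₂) hu₃, logMod_mul hz hu₂, logMod_div hu₃ hu₂,
      logMod_div (mul_ne_zero hy hz) hx, logMod_mul hy hz, logMod_div hy hx]
    -- Without the slice restriction n supplies the missing control; the leftover coefficient, that
    -- of log ‖1 - X₃‖, vanishes because the total angle at the edge 01 is 2ϖ.
    linear_combination logMod (1 - y * z / x) * h₀₁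
  · intro y z hg x hx
    obtain ⟨hy, hy', hz, hz', hx₀, hu₂, hu₃, -, -, -⟩ := key y z hg x hx
    refine ⟨hy, hx₀, div_ne_zero (mul_ne_zero hz hu₂) hu₃, div_ne_zero hu₃ hu₂,
      by fun_prop (disch := assumption), by fun_prop (disch := assumption), ?_⟩
    exact ((ContinuousAt.weight (f := fun x => y / x) (by fun_prop (disch := assumption))
      (div_ne_zero hy hx₀) hu₂).mul (ContinuousAt.weight (f := fun x => y * z / x)
        (by fun_prop (disch := assumption)) (div_ne_zero (mul_ne_zero hy hz) hx₀)
          hu₃)).mul continuousAt_const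
  · refine ⟨fun y => y - 1, fun _ => 1, fun _ => 0, fun _ => 1, fun y z hg x hx => ?_⟩
    obtain ⟨hy, hy', hz, hz', hx₀, hu₂, hu₃, e₀, e₂, e₃⟩ := key y z hg x hx
    have hu₀ : 1 - x ≠ 0 := e₀ ▸ mul_ne_zero hz hy'
    have edet : (y - 1) * 1 - 1 * 0 = -(1 - y) := by ring
    refine ⟨hz, ?_, ?_, ?_, ?_, ?_⟩
    · rw [edet]
      exact neg_ne_zero.2 hy'
    · rw [zero_mul, zero_add, div_one]
      linear_combination -e₀
    · rw [e₂, e₃, e₀, mul_div_assoc', div_div_div_cancel_right₀ hx₀]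
      field_simp
    · rw [e₂, e₃, div_div_div_cancel_right₀ hx₀, div_mul_cancel_left₀ hz', one_div]
    rw [edet, weight_eq (div_ne_zero hy hx₀) hu₂,
      weight_eq (div_ne_zero (mul_ne_zero hy hz) hx₀) hu₃, weight_eq hz hz',
      weight_eq hx₀ hu₀, weight_eq hy hy', modulus_neg, zero_mul, zero_add, modulus_one, one_pow,
      div_one, ← exp_logMod hz, ← exp_logMod hy', ← exp_logMod (one_div_ne_zero hz')]
    simp only [← Real.exp_add]
    rw [e₂, e₃, e₀, logMod_div (mul_ne_zero hz' hy') hx₀, logMod_mul hz' hy', logMod_div hz' hx₀,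
      logMod_one_div, logMod_mul hz hy', logMod_div (mul_ne_zero hy hz) hx₀, logMod_mul hy hz,
      logMod_div hy hx₀]
    congr 1
    linear_combination logMod x * (h₀₄ + h₂₃ - h₀₁) - logMod y * h₀₄ - logMod z * h₁₂ +
      logMod (1 - y) * h₃₄ + logMod (1 - z) * h₀₁

end Cases

/-! ## Transport of concentration to the multiplicative group -/

section Transport

variable {G H : Type*} [One G] [TopologicalSpace G] [MeasurableSpace G]
  [One H] [TopologicalSpace H] [MeasurableSpace H]

/-- The peaks on the source need to correspond to peaks on the target only along N and where T' does
not vanish; elsewhere the integrand is zero on both sides. -/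
theorem Concentrates.comp {η : Measure G} {θ : Measure H} [SFinite η] [SFinite θ]
    {T : H → H → H → ℂ} {N : H → H → H → H} {T₀ : H → H → ℂ} (h : Concentrates θ T N T₀)
    {X Y Z : G → H} (hX : MeasurePreserving X η θ) (hX' : MeasurableEmbedding X)
    (hY : MeasurePreserving Y η θ) (hY' : MeasurableEmbedding Y)
    (hZ : MeasurePreserving Z η θ) (hZ' : MeasurableEmbedding Z)
    {T' : G → G → G → ℂ} {N' : G → G → G → G} {T₀' : G → G → ℂ}
    (hT : ∀ x y z, T' x y z = T (X x) (Y y) (Z z)) (hT₀ : ∀ x y, T₀' x y = T₀ (X x) (Y y))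
    (hN : ∀ r, IsPeak η r → ∃ r', IsPeak θ r' ∧ ∀ k x y z, T' x y z ≠ 0 →
      r k (N' x y z) = r' k (N (X x) (Y y) (Z z))) :
    Concentrates η T' N' T₀' := by
  have h₂ := hX.prod hY
  have h₂' := hX'.prodMap hY'
  have h₃ := h₂.prod hZ
  have h₃' := h₂'.prodMap hZ'
  have key : ∀ r r' : ℕ → _ → ℝ, (∀ k x y z, T' x y z ≠ 0 →
      r k (N' x y z) = r' k (N (X x) (Y y) (Z z))) → ∀ k,
      (fun s : (G × G) × G => T' s.1.1 s.1.2 s.2 * (r k (N' s.1.1 s.1.2 s.2) : ℂ)) =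
      (fun s : (H × H) × H => T s.1.1 s.1.2 s.2 * (r' k (N s.1.1 s.1.2 s.2) : ℂ)) ∘
        Prod.map (Prod.map X Y) Z := by
    intro r r' hr k
    funext ⟨⟨x, y⟩, z⟩
    simp only [Function.comp_apply, Prod.map_apply, ← hT]
    by_cases h0 : T' x y z = 0
    · simp [h0]
    · rw [hr k x y z h0]
  refine ⟨?_, ?_, fun r hr => ?_, fun r hr => ?_⟩
  · filter_upwards [hZ.quasiMeasurePreserving.ae h.integrable_slice] with z hz
    simp only [hT]
    exact (h₂.integrable_comp_emb h₂').2 hz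
  · simp only [hT₀]
    exact (h₂.integrable_comp_emb h₂').2 h.integrable_limit
  · obtain ⟨r', hr', he⟩ := hN r hr
    filter_upwards [h.integrable r' hr'] with k hk
    rw [key r r' he k]
    exact (h₃.integrable_comp_emb h₃').2 hk
  · obtain ⟨r', hr', he⟩ := hN r hr
    have e₀ := h₂.integral_comp h₂' fun s : H × H => T₀ s.1 s.2
    simp only [Prod.map_fst, Prod.map_snd, ← hT₀] at e₀
    rw [e₀]
    refine (h.tendsto r' hr').congr fun k => ?_
    rw [key r r' he k]
    exact (h₃.integral_comp h₃' _).symm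

theorem Concentrates.swap {η : Measure G} [SFinite η] {T : G → G → G → ℂ} {N : G → G → G → G}
    {T₀ : G → G → ℂ} (h : Concentrates η T N T₀) :
    Concentrates η (fun x y z => T y x z) (fun x y z => N y x z) (fun x y => T₀ y x) := by
  have h₂ : MeasurePreserving (Prod.swap : G × G → G × G) (η.prod η) (η.prod η) :=
    Measure.measurePreserving_swap
  have h₂' : MeasurableEmbedding (Prod.swap : G × G → G × G) :=
    MeasurableEquiv.prodComm.measurableEmbedding
  have h₃ := h₂.prod (MeasurePreserving.id η)
  have h₃' : MeasurableEmbedding (Prod.map (Prod.swap : G × G → G × G) (id : G → G)) :=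
    h₂'.prodMap (MeasurableEquiv.refl G).measurableEmbedding
  refine ⟨?_, ?_, fun r hr => ?_, fun r hr => ?_⟩
  · filter_upwards [h.integrable_slice] with z hz
    exact (h₂.integrable_comp_emb h₂').2 hz
  · exact (h₂.integrable_comp_emb h₂').2 h.integrable_limit
  · filter_upwards [h.integrable r hr] with k hk
    exact (h₃.integrable_comp_emb h₃').2 hk
  · have e₀ := h₂.integral_comp h₂' fun s : G × G => T₀ s.1 s.2
    simp only [Prod.fst_swap, Prod.snd_swap] at e₀
    rw [e₀]
    refine (h.tendsto r hr).congr fun k => ?_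
    exact (h₃.integral_comp h₃' _).symm

end Transport

/-! ### Passage from the field to its multiplicative group -/

section Units

variable {F : Type*} [NontriviallyNormedField F] [ProperSpace F] [MeasurableSpace F] [BorelSpace F]

/-- Inverted peaks arise from Fourier inversion, which yields ρ_k(N⁻¹), and from odd orderings,
which replace N by its inverse. -/
theorem IsPeak.inv {m : Measure Fˣ} [m.IsInvInvariant] {r : ℕ → Fˣ → ℝ} (hr : IsPeak m r) :
    IsPeak m fun k t => r k t⁻¹ where
  measurable k := (hr.measurable k).comp measurable_inv
  nonneg k t := hr.nonneg k t⁻¹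
  integral_eq_one k := by rw [integral_inv_eq_self (r k) m, hr.integral_eq_one]
  shrink U hU := by
    have hU' : (fun t : Fˣ => t⁻¹) ⁻¹' U ∈ 𝓝 (1 : Fˣ) :=
      continuous_inv.continuousAt.preimage_mem_nhds (by simpa using hU)
    filter_upwards [hr.shrink _ hU'] with k hk t ht
    simpa using hk _ ht

variable (μ : Measure F) [μ.IsAddHaarMeasure]

theorem IsPeak.extend {r : ℕ → Fˣ → ℝ} (hr : IsPeak (unitsMeasure μ) r) :
    IsPeak (mulMeasure μ) fun k => Function.extend Units.val (r k) 0 where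
  measurable k := measurableEmbedding_val.measurable_extend (hr.measurable k) measurable_zero
  nonneg k x := by
    by_cases hx : ∃ u : Fˣ, (u : F) = x
    · obtain ⟨u, rfl⟩ := hx
      rw [Units.val_injective.extend_apply]
      exact hr.nonneg k u
    · rw [Function.extend_apply' _ _ _ hx, Pi.zero_apply]
  integral_eq_one k := by
    rw [← map_val_unitsMeasure, measurableEmbedding_val.integral_map, ← hr.integral_eq_one k]
    simp only [Units.val_injective.extend_apply]
  shrink U hU := by
    have hU' : (Units.val : Fˣ → F) ⁻¹' U ∈ 𝓝 (1 : Fˣ) :=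
      Units.continuous_val.continuousAt.preimage_mem_nhds (by simpa using hU)
    filter_upwards [hr.shrink _ hU'] with k hk x hx
    by_cases hx' : ∃ u : Fˣ, (u : F) = x
    · obtain ⟨u, rfl⟩ := hx'
      rw [Units.val_injective.extend_apply] at hx
      exact hk u hx
    · exact absurd (Function.extend_apply' _ _ _ hx') hx

variable {μ} in
-- Where T' vanishes, N' may carry default values, so the two equations N and N' are compared only
-- on the support of T'.
theorem Concentrates.units {T : F → F → F → ℂ} {N : F → F → F → F} {T₀ : F → F → ℂ}
    (h : Concentrates (mulMeasure μ) T N T₀)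
    {T' : Fˣ → Fˣ → Fˣ → ℂ} {N' : Fˣ → Fˣ → Fˣ → Fˣ} {T₀' : Fˣ → Fˣ → ℂ}
    (hT : ∀ x y z : Fˣ, T' x y z = T x y z) (hT₀ : ∀ x y : Fˣ, T₀' x y = T₀ x y)
    (hN : ∀ x y z : Fˣ, T' x y z ≠ 0 → N x y z = (N' x y z : F)) :
    Concentrates (unitsMeasure μ) T' N' T₀' :=
  h.comp (measurePreserving_val μ) measurableEmbedding_val (measurePreserving_val μ)
    measurableEmbedding_val (measurePreserving_val μ) measurableEmbedding_val hT hT₀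
    fun _ hr => ⟨_, hr.extend μ, fun k x y z h0 => by
      rw [hN x y z h0, Units.val_injective.extend_apply]⟩

/-- The substitution of equivalences which preserve the measure; the exponent `s = ± 1` of the
variable of the delta function is irrelevant. -/
theorem Concentrates.substitution {m : Measure Fˣ} [SFinite m] [m.IsInvInvariant]
    {T : Fˣ → Fˣ → Fˣ → ℂ} {N : Fˣ → Fˣ → Fˣ → Fˣ} {T₀ : Fˣ → Fˣ → ℂ}
    (h : Concentrates m T N T₀) (X Y Z : Fˣ ≃ᵐ Fˣ) (hX : MeasurePreserving X m m)
    (hY : MeasurePreserving Y m m) (hZ : MeasurePreserving Z m m) (s : ℤˣ)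
    {T' : Fˣ → Fˣ → Fˣ → ℂ} {N' : Fˣ → Fˣ → Fˣ → Fˣ} {T₀' : Fˣ → Fˣ → ℂ}
    (hT : ∀ x y z, T' x y z = T (X x) (Y y) (Z z)) (hT₀ : ∀ x y, T₀' x y = T₀ (X x) (Y y))
    (hN : ∀ x y z, N' x y z = N (X x) (Y y) (Z z) ^ (s : ℤ)) :
    Concentrates m T' N' T₀' := by
  refine h.comp hX X.measurableEmbedding hY Y.measurableEmbedding hZ Z.measurableEmbedding hT hT₀
    fun r hr => ?_
  rcases Int.units_eq_one_or s with rfl | rfl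
  · exact ⟨r, hr, fun k x y z _ => by rw [hN]; simp⟩
  · exact ⟨_, hr.inv, fun k x y z _ => by rw [hN]; simp⟩

end Units

/-! ### Extension of kernels from the multiplicative group to the field -/

section ExtendKernel

variable {F : Type*} [NontriviallyNormedField F]

/-- The element `x` as a unit; the value `1` is assigned at `0`. -/
def toUnit (x : F) : Fˣ := by
  classical exact if h : x = 0 then 1 else Units.mk0 x h

theorem coe_toUnit {x : F} (h : x ≠ 0) : ((toUnit x : Fˣ) : F) = x := by
  simp [toUnit, h]

@[simp]
theorem toUnit_coe (u : Fˣ) : toUnit (u : F) = u :=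
  Units.ext (coe_toUnit u.ne_zero)

open Classical in
/-- Extension by zero of a function on `B⁴`. -/
def extendKernel (g : (Fˣ × Fˣ) × (Fˣ × Fˣ) → ℂ) (p q x y : F) : ℂ :=
  if p ≠ 0 ∧ q ≠ 0 ∧ x ≠ 0 ∧ y ≠ 0 then
    g ((toUnit p, toUnit q), (toUnit x, toUnit y)) else 0

@[simp]
theorem extendKernel_coe (g : (Fˣ × Fˣ) × (Fˣ × Fˣ) → ℂ) (p q x y : Fˣ) :
    extendKernel g p q x y = g ((p, q), (x, y)) := by
  simp [extendKernel]

theorem continuousAt_toUnit {x : F} (h : x ≠ 0) : ContinuousAt (toUnit : F → Fˣ) x := by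
  rw [Units.isEmbedding_val₀.continuousAt_iff]
  refine continuousAt_id.congr ?_
  filter_upwards [isOpen_ne.mem_nhds h] with y hy
  exact (coe_toUnit hy).symm

variable [ProperSpace F] [MeasurableSpace F] [BorelSpace F]

theorem measurable_toUnit : Measurable (toUnit : F → Fˣ) := by
  have h : (toUnit : F → Fˣ) = Function.extend Units.val id fun _ => 1 := by
    funext x
    by_cases hx : x = 0
    · rw [Function.extend_apply', toUnit]
      · simp [hx]
      · rintro ⟨u, rfl⟩
        exact u.ne_zero hx
    · have := Units.val_injective.extend_apply (id : Fˣ → Fˣ) (fun _ => 1) (Units.mk0 x hx)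
      rw [Units.val_mk0] at this
      rw [this, toUnit, dif_neg hx, id]
  rw [h]
  exact measurableEmbedding_val.measurable_extend measurable_id measurable_const

theorem isKernel_extendKernel {g : (Fˣ × Fˣ) × (Fˣ × Fˣ) → ℂ} (hg : Continuous g)
    (hc : HasCompactSupport g) : IsKernel (extendKernel g) where
  measurable := by
    unfold extendKernel
    refine Measurable.ite ?_ ?_ measurable_const
    · exact ((measurable_fst (measurableSet_singleton (0 : F)).compl).inter
        ((measurable_snd.fst (measurableSet_singleton (0 : F)).compl).inter
        ((measurable_snd.snd.fst (measurableSet_singleton (0 : F)).compl).inter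
        (measurable_snd.snd.snd (measurableSet_singleton (0 : F)).compl))))
    · exact hg.measurable.comp
        (((measurable_toUnit.comp measurable_fst).prodMk
          (measurable_toUnit.comp measurable_snd.fst)).prodMk
        ((measurable_toUnit.comp measurable_snd.snd.fst).prodMk
          (measurable_toUnit.comp measurable_snd.snd.snd)))
  bounded := by
    obtain ⟨M, hM⟩ := hg.bounded_above_of_compact_support hc
    refine ⟨max M 0, le_max_right _ _, fun p q x y => ?_⟩
    unfold extendKernel
    split_ifs
    · exact (hM _).trans (le_max_left _ _)
    · simp
  support := by
    have hK := hc.isCompact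
    obtain ⟨R₁, h₁⟩ := exists_annulus_of_isCompact (hK.image continuous_fst.fst)
    obtain ⟨R₂, h₂⟩ := exists_annulus_of_isCompact (hK.image continuous_fst.snd)
    obtain ⟨R₃, h₃⟩ := exists_annulus_of_isCompact (hK.image continuous_snd.fst)
    obtain ⟨R₄, h₄⟩ := exists_annulus_of_isCompact (hK.image continuous_snd.snd)
    have mono : ∀ {R R' : ℝ} {x : F}, R ≤ R' → x ∈ annulus F R → x ∈ annulus F R' :=
      fun h hx => ⟨hx.1, hx.2.1.trans h, hx.2.2.trans h⟩
    refine ⟨max (max R₁ R₂) (max R₃ R₄), fun p q x y h => ?_⟩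
    unfold extendKernel at h
    split_ifs at h with h0
    · obtain ⟨hp, hq, hx, hy⟩ := h0
      have ht := subset_tsupport _ h
      have e₁ := h₁ _ ⟨_, ht, rfl⟩
      have e₂ := h₂ _ ⟨_, ht, rfl⟩
      have e₃ := h₃ _ ⟨_, ht, rfl⟩
      have e₄ := h₄ _ ⟨_, ht, rfl⟩
      simp only [coe_toUnit hp, coe_toUnit hq, coe_toUnit hx, coe_toUnit hy] at e₁ e₂ e₃ e₄
      exact ⟨mono ((le_max_left _ _).trans (le_max_left _ _)) e₁,
        mono ((le_max_right _ _).trans (le_max_left _ _)) e₂,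
        mono ((le_max_left _ _).trans (le_max_right _ _)) e₃,
        mono ((le_max_right _ _).trans (le_max_right _ _)) e₄⟩
    · exact absurd rfl h
  continuousAt p q x y hp hq hx hy := by
    have hU : IsOpen {s : F × F × F × F | s.1 ≠ 0 ∧ s.2.1 ≠ 0 ∧ s.2.2.1 ≠ 0 ∧ s.2.2.2 ≠ 0} := by
      refine (isOpen_ne.preimage continuous_fst).inter ((isOpen_ne.preimage continuous_snd.fst).inter
        ((isOpen_ne.preimage continuous_snd.snd.fst).inter
          (isOpen_ne.preimage continuous_snd.snd.snd)))
    have hc : ContinuousAt (fun s : F × F × F × F =>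
        g ((toUnit s.1, toUnit s.2.1), (toUnit s.2.2.1, toUnit s.2.2.2))) (p, q, x, y) := by
      refine hg.continuousAt.comp (ContinuousAt.prodMk (ContinuousAt.prodMk ?_ ?_)
        (ContinuousAt.prodMk ?_ ?_))
      · exact (continuousAt_toUnit hp).comp (f := fun s : F × F × F × F => s.1)
          (x := (p, q, x, y)) continuous_fst.continuousAt
      · exact (continuousAt_toUnit hq).comp (f := fun s : F × F × F × F => s.2.1)
          (x := (p, q, x, y)) continuous_snd.fst.continuousAt
      · exact (continuousAt_toUnit hx).comp (f := fun s : F × F × F × F => s.2.2.1)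
          (x := (p, q, x, y)) continuous_snd.snd.fst.continuousAt
      · exact (continuousAt_toUnit hy).comp (f := fun s : F × F × F × F => s.2.2.2)
          (x := (p, q, x, y)) continuous_snd.snd.snd.continuousAt
    refine hc.congr ?_
    filter_upwards [hU.mem_nhds ⟨hp, hq, hx, hy⟩] with s hs
    exact (if_pos hs).symm

end ExtendKernel

/-! ## Distributions given by characters -/

section Distributions

variable {F : Type*} [NontriviallyNormedField F]

theorem continuous_circle_coe : Continuous fun z : Circle => (z : ℂ) := continuous_subtype_val

/-- B is locally compact and its dual carries the compact-open topology, so evaluation is jointly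
continuous. -/
theorem continuous_pontryaginDual_eval [ProperSpace F] :
    Continuous fun s : PontryaginDual Fˣ × Fˣ => ((s.1 s.2 : Circle) : ℂ) := by
  have h : Continuous fun s : (Fˣ →ₜ* Circle) × Fˣ => s.1 s.2 := continuous_eval
  exact continuous_circle_coe.comp h

theorem continuous_pontryaginDual_apply [ProperSpace F] (t : Fˣ) :
    Continuous fun γ : PontryaginDual Fˣ => ((γ t : Circle) : ℂ) :=
  continuous_pontryaginDual_eval.comp (Continuous.prodMk_left t)

theorem continuous_character (γ : PontryaginDual Fˣ) :
    Continuous fun t : Fˣ => ((γ t : Circle) : ℂ) :=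
  continuous_circle_coe.comp (map_continuous γ)

instance [ProperSpace F] : SecondCountableTopology (PontryaginDual Fˣ) := by
  have : SecondCountableTopology C(Fˣ, Circle) := inferInstance
  exact (ContinuousMonoidHom.isEmbedding_toContinuousMap Fˣ Circle).secondCountableTopology

variable [ProperSpace F] [MeasurableSpace F] [BorelSpace F]
  [MeasurableSpace (PontryaginDual Fˣ)] [BorelSpace (PontryaginDual Fˣ)]
  {m : Measure Fˣ} {ν : Measure (PontryaginDual Fˣ)}

/-- The partial Fourier transform of a function on `A²`. -/
def partialTransform (ν : Measure (PontryaginDual Fˣ)) (f : GaussGroup F → GaussGroup F → ℂ)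
    (s : (Fˣ × Fˣ) × (Fˣ × Fˣ)) : ℂ :=
  ∫ χ : PontryaginDual Fˣ × PontryaginDual Fˣ,
    (χ.1 s.1.1 : ℂ) * (χ.2 s.1.2 : ℂ) * f (χ.1, s.2.1) (χ.2, s.2.2) ∂(ν.prod ν)

namespace IsTestFunction

variable {f : GaussGroup F → GaussGroup F → ℂ}

theorem continuous_characters (hf : IsTestFunction ν f) (x y : Fˣ) :
    Continuous fun χ : PontryaginDual Fˣ × PontryaginDual Fˣ => f (χ.1, x) (χ.2, y) :=
  hf.continuous.comp ((continuous_fst.prodMk continuous_const).prodMk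
    (continuous_snd.prodMk continuous_const))

theorem integrable_characters (hf : IsTestFunction ν f) (s : (Fˣ × Fˣ) × (Fˣ × Fˣ)) :
    Integrable (fun χ : PontryaginDual Fˣ × PontryaginDual Fˣ =>
      (χ.1 s.1.1 : ℂ) * (χ.2 s.1.2 : ℂ) * f (χ.1, s.2.1) (χ.2, s.2.2)) (ν.prod ν) := by
  obtain ⟨g, hg, hfg⟩ := hf.dominated
  refine hg.mono' ?_ (Eventually.of_forall fun χ => ?_)
  · exact ((((continuous_pontryaginDual_apply _).comp continuous_fst).mul
      ((continuous_pontryaginDual_apply _).comp continuous_snd)).mul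
        (hf.continuous_characters _ _)).aestronglyMeasurable
  · simpa only [norm_mul, Circle.norm_coe, one_mul] using hfg (χ.1, s.2.1) (χ.2, s.2.2)

theorem continuous_partialTransform (hf : IsTestFunction ν f) :
    Continuous (partialTransform ν f) := by
  obtain ⟨g, hg, hfg⟩ := hf.dominated
  refine continuous_of_dominated (fun s => (hf.integrable_characters s).aestronglyMeasurable)
    (fun s => Eventually.of_forall fun χ => ?_) hg (Eventually.of_forall fun χ => ?_)
  · simpa only [norm_mul, Circle.norm_coe, one_mul] using hfg (χ.1, s.2.1) (χ.2, s.2.2)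
  · exact (((continuous_character χ.1).comp continuous_fst.fst).mul
      ((continuous_character χ.2).comp continuous_fst.snd)).mul (hf.continuous.comp
        ((continuous_const.prodMk continuous_snd.fst).prodMk
          (continuous_const.prodMk continuous_snd.snd)))

end IsTestFunction

/-- The normalization of ν is inversion at the point 1. Translating ρ by w multiplies its transform
by γ(w) and moves the evaluation point to w⁻¹. -/
theorem integral_transform_mul [m.IsMulLeftInvariant] (hν : IsDualMeasure m ν) {ρ : Fˣ → ℂ}
    (hρ : Continuous ρ) (hc : HasCompactSupport ρ) (hi : Integrable (charTransform m ρ) ν)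
    (w : Fˣ) : ∫ γ, charTransform m ρ γ * (γ w : ℂ) ∂ν = ρ w⁻¹ := by
  have key : charTransform m (fun t => ρ (w⁻¹ * t)) =
      fun γ => charTransform m ρ γ * (γ w : ℂ) := by
    funext γ
    have h := integral_mul_left_eq_self (μ := m) (fun t => (γ t : ℂ) * ρ (w⁻¹ * t)) w
    rw [charTransform, ← h, charTransform, ← integral_mul_const]
    refine integral_congr_ae (Eventually.of_forall fun t => ?_)
    simp only [map_mul, Circle.coe_mul, inv_mul_cancel_left]
    ring
  have hi' : Integrable (charTransform m fun t => ρ (w⁻¹ * t)) ν := by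
    rw [key]
    refine Integrable.mul_bdd (c := 1) hi (continuous_pontryaginDual_apply w).aestronglyMeasurable
      (Eventually.of_forall fun γ => (Circle.norm_coe _).le)
  have h := hν (fun t => ρ (w⁻¹ * t)) (hρ.comp (continuous_const_mul _))
    (hc.comp_homeomorph (Homeomorph.mulLeft w⁻¹)) hi'
  rw [key, mul_one] at h
  exact h

theorem IsApproxIdentity.isPeak {ρ : ℕ → Fˣ → ℝ} (hρ : IsApproxIdentity m ν ρ) : IsPeak m ρ where
  measurable k := (hρ.continuous k).measurable
  nonneg := hρ.nonneg
  integral_eq_one := hρ.integral_eq_one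
  shrink U hU := by
    filter_upwards [hρ.shrink U hU] with k hk t ht
    exact hk (subset_tsupport _ ht)

theorem integral_characters {f : GaussGroup F → GaussGroup F → ℂ} {G : GaussGroup F → GaussGroup F → ℂ}
    {P Q x y : Fˣ} {w : ℂ} (hG : ∀ α β : PontryaginDual Fˣ, G (α, x) (β, y) = α P * β Q * w) :
    ∫ χ : PontryaginDual Fˣ × PontryaginDual Fˣ, f (χ.1, x) (χ.2, y) * G (χ.1, x) (χ.2, y)
      ∂(ν.prod ν) = partialTransform ν f ((P, Q), (x, y)) * w := by
  rw [partialTransform, ← integral_mul_const]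
  refine integral_congr_ae (Eventually.of_forall fun χ => ?_)
  simp only [hG]
  ring

/-- Characters have absolute value one, so the integral over them converges by the domination of f
and equals the partial transform at (P, Q); only the integral over B² remains as a condition. -/
theorem pairingConverges_of_integrable {f G : GaussGroup F → GaussGroup F → ℂ}
    (hf : IsTestFunction ν f) {P Q : Fˣ → Fˣ → Fˣ} {w : Fˣ → Fˣ → ℂ}
    (hG : ∀ (α β : PontryaginDual Fˣ) x y, G (α, x) (β, y) = α (P x y) * β (Q x y) * w x y)
    (hi : Integrable (fun s : Fˣ × Fˣ =>
      partialTransform ν f ((P s.1 s.2, Q s.1 s.2), (s.1, s.2)) * w s.1 s.2) (m.prod m)) :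
    PairingConverges m ν f G ∧ distPairing m ν f G = ∫ s : Fˣ × Fˣ,
      partialTransform ν f ((P s.1 s.2, Q s.1 s.2), (s.1, s.2)) * w s.1 s.2 ∂m.prod m := by
  have e : (fun s : Fˣ × Fˣ => ∫ χ : PontryaginDual Fˣ × PontryaginDual Fˣ,
      f (χ.1, s.1) (χ.2, s.2) * G (χ.1, s.1) (χ.2, s.2) ∂(ν.prod ν)) = fun s : Fˣ × Fˣ =>
      partialTransform ν f ((P s.1 s.2, Q s.1 s.2), (s.1, s.2)) * w s.1 s.2 :=
    funext fun s => integral_characters fun α β => hG α β s.1 s.2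
  refine ⟨⟨Eventually.of_forall fun s => ?_, by rwa [e]⟩, by rw [distPairing, e]⟩
  refine ((hf.integrable_characters ((P s.1 s.2, Q s.1 s.2), (s.1, s.2))).mul_const
    (w s.1 s.2)).congr (Eventually.of_forall fun χ => ?_)
  simp only [hG]
  ring

/-- The reduction of a distributional integral to the concentration of an integral on `B³`. -/
theorem hasImproperIntegral_of_concentrates [SigmaFinite m] [m.IsMulLeftInvariant]
    [m.IsInvInvariant] [SigmaFinite ν] (hν : IsDualMeasure m ν)
    {f G : GaussGroup F → GaussGroup F → ℂ} {W : GaussGroup F → GaussGroup F → GaussGroup F → ℂ}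
    (hf : IsTestFunction ν f) {P Q N : Fˣ → Fˣ → Fˣ → Fˣ} {w : Fˣ → Fˣ → Fˣ → ℂ}
    {P₀ Q₀ : Fˣ → Fˣ → Fˣ} {w₀ : Fˣ → Fˣ → ℂ}
    (hW : ∀ (α β γ : PontryaginDual Fˣ) x y z, W (α, x) (β, y) (γ, z) =
      α (P x y z) * β (Q x y z) * γ (N x y z) * w x y z)
    (hG : ∀ (α β : PontryaginDual Fˣ) x y, G (α, x) (β, y) = α (P₀ x y) * β (Q₀ x y) * w₀ x y)
    (hN : Measurable fun s : Fˣ × Fˣ × Fˣ => N s.1 s.2.1 s.2.2)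
    (h : Concentrates m
      (fun x y z => partialTransform ν f ((P x y z, Q x y z), (x, y)) * w x y z) N
      (fun x y => partialTransform ν f ((P₀ x y, Q₀ x y), (x, y)) * w₀ x y)) :
    PairingConverges m ν f G ∧ HasImproperIntegral m ν f W (distPairing m ν f G) := by
  obtain ⟨hG₁, hG₂⟩ := pairingConverges_of_integrable hf hG h.integrable_limit
  refine ⟨hG₁, ?_⟩
  rw [hG₂]
  set T : Fˣ → Fˣ → Fˣ → ℂ := fun x y z =>
    partialTransform ν f ((P x y z, Q x y z), (x, y)) * w x y z with hT
  have hNz : ∀ z, Measurable fun s : Fˣ × Fˣ => N s.1 s.2 z := fun z =>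
    hN.comp (measurable_fst.prodMk (measurable_snd.prodMk measurable_const))
  have step : ∀ z, Integrable (fun s : Fˣ × Fˣ => T s.1 s.2 z) (m.prod m) →
      ∀ γ : PontryaginDual Fˣ, PairingConverges m ν f (fun p q => W p q (γ, z)) ∧
        distPairing m ν f (fun p q => W p q (γ, z)) =
          ∫ s : Fˣ × Fˣ, (γ (N s.1 s.2 z) : ℂ) * T s.1 s.2 z ∂m.prod m := by
    intro z hz γ
    have e : ∀ s : Fˣ × Fˣ, partialTransform ν f ((P s.1 s.2 z, Q s.1 s.2 z), (s.1, s.2)) *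
        ((γ (N s.1 s.2 z) : ℂ) * w s.1 s.2 z) = (γ (N s.1 s.2 z) : ℂ) * T s.1 s.2 z := fun s => by
      simp only [hT]
      ring
    have hi : Integrable (fun s : Fˣ × Fˣ =>
        (γ (N s.1 s.2 z) : ℂ) * T s.1 s.2 z) (m.prod m) :=
      hz.bdd_mul (c := 1) ((continuous_character γ).measurable.comp (hNz z)).aestronglyMeasurable
        (Eventually.of_forall fun s => (Circle.norm_coe _).le)
    have := pairingConverges_of_integrable (m := m) hf (G := fun p q => W p q (γ, z))
      (P := fun x y => P x y z) (Q := fun x y => Q x y z)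
      (w := fun x y => (γ (N x y z) : ℂ) * w x y z)
      (fun α β x y => by rw [hW]; ring) (by simpa only [e] using hi)
    simpa only [e] using this
  refine ⟨?_, fun ρ hρ => ?_⟩
  · filter_upwards [h.integrable_slice] with z hz γ
    exact (step z hz γ).1
  -- For fixed z Fubini applies, as the transform of ρ_k is integrable in γ and T in (x, y). The
  -- inner integral over γ is then ρ_k(N⁻¹) by Fourier inversion.
  have inner : ∀ k, ∀ᵐ z ∂m,
      Integrable (fun γ => charTransform m (fun t => (ρ k t : ℂ)) γ *
        distPairing m ν f fun p q => W p q (γ, z)) ν ∧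
      ∫ γ, charTransform m (fun t => (ρ k t : ℂ)) γ *
        distPairing m ν f (fun p q => W p q (γ, z)) ∂ν =
        ∫ s : Fˣ × Fˣ, T s.1 s.2 z * (ρ k (N s.1 s.2 z)⁻¹ : ℂ) ∂m.prod m := by
    intro k
    filter_upwards [h.integrable_slice] with z hz
    have e₁ : (fun γ => charTransform m (fun t => (ρ k t : ℂ)) γ *
        distPairing m ν f fun p q => W p q (γ, z)) = fun γ => ∫ s : Fˣ × Fˣ,
          charTransform m (fun t => (ρ k t : ℂ)) γ * T s.1 s.2 z * (γ (N s.1 s.2 z) : ℂ)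
            ∂m.prod m := by
      funext γ
      rw [(step z hz γ).2, ← integral_const_mul]
      refine integral_congr_ae (Eventually.of_forall fun s => ?_)
      simp only
      ring
    have hi : Integrable (fun r : PontryaginDual Fˣ × (Fˣ × Fˣ) =>
        charTransform m (fun t => (ρ k t : ℂ)) r.1 * T r.2.1 r.2.2 z *
          (r.1 (N r.2.1 r.2.2 z) : ℂ)) (ν.prod (m.prod m)) := by
      refine Integrable.mul_bdd (c := 1) ((hρ.integrable_transform k).mul_prod hz) ?_
        (Eventually.of_forall fun γ => (Circle.norm_coe _).le)
      exact (continuous_pontryaginDual_eval.measurable.comp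
        (measurable_fst.prodMk ((hNz z).comp measurable_snd))).aestronglyMeasurable
    rw [e₁]
    refine ⟨hi.integral_prod_left, ?_⟩
    rw [integral_integral_swap hi]
    refine integral_congr_ae (Eventually.of_forall fun s => ?_)
    simp only
    have h₁ := integral_transform_mul hν (ρ := fun t => (ρ k t : ℂ))
      (Complex.continuous_ofReal.comp (hρ.continuous k))
      ((hρ.compactSupport k).comp_left Complex.ofReal_zero) (hρ.integrable_transform k)
      (N s.1 s.2 z)
    rw [← h₁, ← integral_const_mul]
    refine integral_congr_ae (Eventually.of_forall fun γ => ?_)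
    simp only
    ring
  have hpeak : IsPeak m fun k t => ρ k t⁻¹ := hρ.isPeak.inv
  refine ⟨?_, ?_⟩
  · filter_upwards [h.integrable _ hpeak] with k hk
    refine ⟨(inner k).mono fun z hz => hz.1, ?_⟩
    exact hk.integral_prod_right.congr ((inner k).mono fun z hz => hz.2.symm)
  · refine (h.tendsto _ hpeak).congr' ?_
    filter_upwards [h.integrable _ hpeak] with k hk
    -- The variable z has to be the outermost one, as in the improper integral.
    rw [integral_prod_symm _ hk]
    exact integral_congr_ae ((inner k).mono fun z hz => hz.2.symm)

end Distributions

/-! ## Concentration of kernels on the multiplicative group -/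

section KernelConcentrates

variable {F : Type*} [NontriviallyNormedField F] [MeasurableSpace F]

/-- The distributions `g(P, Q, x, y) w(x, y, z) δ(N)` on `B³` concentrate, for every continuous
function `g` on `B⁴` with compact support. -/
def KernelConcentrates (m : Measure Fˣ) (P Q N : Fˣ → Fˣ → Fˣ → Fˣ) (w : Fˣ → Fˣ → Fˣ → ℝ)
    (P₀ Q₀ : Fˣ → Fˣ → Fˣ) (w₀ : Fˣ → Fˣ → ℝ) : Prop :=
  ∀ g : (Fˣ × Fˣ) × (Fˣ × Fˣ) → ℂ, Continuous g → HasCompactSupport g →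
    Concentrates m (fun x y z => g ((P x y z, Q x y z), (x, y)) * (w x y z : ℂ)) N
      (fun x y => g ((P₀ x y, Q₀ x y), (x, y)) * (w₀ x y : ℂ))

variable {m : Measure Fˣ} {P Q N : Fˣ → Fˣ → Fˣ → Fˣ} {w : Fˣ → Fˣ → Fˣ → ℝ}
  {P₀ Q₀ : Fˣ → Fˣ → Fˣ} {w₀ : Fˣ → Fˣ → ℝ}

theorem KernelConcentrates.swap [SFinite m] (h : KernelConcentrates m P Q N w P₀ Q₀ w₀) :
    KernelConcentrates m (fun x y z => Q y x z) (fun x y z => P y x z) (fun x y z => N y x z)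
      (fun x y z => w y x z) (fun x y => Q₀ y x) (fun x y => P₀ y x) (fun x y => w₀ y x) := by
  intro g hg hc
  let e : (Fˣ × Fˣ) × (Fˣ × Fˣ) ≃ₜ (Fˣ × Fˣ) × (Fˣ × Fˣ) :=
    (Homeomorph.prodComm Fˣ Fˣ).prodCongr (Homeomorph.prodComm Fˣ Fˣ)
  exact (h (g ∘ e) (hg.comp e.continuous) (hc.comp_homeomorph e)).swap

/-- The map `t ↦ A t ^ e`, `e = ± 1`, of `B`. -/
def monomialHomeomorph (A : Fˣ) (e : ℤˣ) : Fˣ ≃ₜ Fˣ where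
  toFun t := A * t ^ (e : ℤ)
  invFun t := (A⁻¹ * t) ^ (e : ℤ)
  left_inv t := by simp [← zpow_mul, ← Units.val_mul, Int.units_mul_self]
  right_inv t := by simp [← zpow_mul, ← Units.val_mul, Int.units_mul_self]
  continuous_toFun := continuous_const.mul (continuous_zpow _)
  continuous_invFun := (continuous_zpow _).comp (continuous_const_mul _)

theorem measurePreserving_monomialHomeomorph [ProperSpace F] [BorelSpace F] [m.IsMulLeftInvariant]
    [m.IsInvInvariant] (A : Fˣ) (e : ℤˣ) : MeasurePreserving (monomialHomeomorph A e) m m := by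
  rcases Int.units_eq_one_or e with rfl | rfl
  · have h := measurePreserving_mul_left m A
    convert h using 2 with t
    simp [monomialHomeomorph]
  · have h := (measurePreserving_mul_left m A).comp (Measure.measurePreserving_inv m)
    convert h using 1
    funext t
    simp [monomialHomeomorph]

/-- The class of kernels g is stable under homeomorphisms of B⁴. Hence the constants κ, κ' and the
exponent s of the arguments P, Q are absorbed into g, and A, B, D into translations and inversions
of B, which preserve the Haar measure. -/
theorem KernelConcentrates.substitution [ProperSpace F] [BorelSpace F] [SFinite m]
    [m.IsMulLeftInvariant] [m.IsInvInvariant] (h : KernelConcentrates m P Q N w P₀ Q₀ w₀)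
    (κ κ' A B D : Fˣ) (d e k s r : ℤˣ)
    {P' Q' N' : Fˣ → Fˣ → Fˣ → Fˣ} {w' : Fˣ → Fˣ → Fˣ → ℝ}
    {P₀' Q₀' : Fˣ → Fˣ → Fˣ} {w₀' : Fˣ → Fˣ → ℝ}
    (hP : ∀ x y z, P' x y z =
      (κ * P (A * x ^ (d : ℤ)) (B * y ^ (e : ℤ)) (D * z ^ (k : ℤ))) ^ (s : ℤ))
    (hQ : ∀ x y z, Q' x y z =
      (κ' * Q (A * x ^ (d : ℤ)) (B * y ^ (e : ℤ)) (D * z ^ (k : ℤ))) ^ (s : ℤ))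
    (hN : ∀ x y z, N' x y z =
      N (A * x ^ (d : ℤ)) (B * y ^ (e : ℤ)) (D * z ^ (k : ℤ)) ^ (r : ℤ))
    (hw : ∀ x y z, w' x y z = w (A * x ^ (d : ℤ)) (B * y ^ (e : ℤ)) (D * z ^ (k : ℤ)))
    (hP₀ : ∀ x y, P₀' x y = (κ * P₀ (A * x ^ (d : ℤ)) (B * y ^ (e : ℤ))) ^ (s : ℤ))
    (hQ₀ : ∀ x y, Q₀' x y = (κ' * Q₀ (A * x ^ (d : ℤ)) (B * y ^ (e : ℤ))) ^ (s : ℤ))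
    (hw₀ : ∀ x y, w₀' x y = w₀ (A * x ^ (d : ℤ)) (B * y ^ (e : ℤ))) :
    KernelConcentrates m P' Q' N' w' P₀' Q₀' w₀' := by
  intro g hg hc
  have hs : ∀ (t l : Fˣ), monomialHomeomorph (l ^ (s : ℤ)) s t = (l * t) ^ (s : ℤ) :=
    fun t l => (mul_zpow l t _).symm
  let E : (Fˣ × Fˣ) × (Fˣ × Fˣ) ≃ₜ (Fˣ × Fˣ) × (Fˣ × Fˣ) :=
    ((monomialHomeomorph (κ ^ (s : ℤ)) s).prodCongr (monomialHomeomorph (κ' ^ (s : ℤ)) s)).prodCongr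
      ((monomialHomeomorph A d).symm.prodCongr (monomialHomeomorph B e).symm)
  have hE : ∀ p q x y, (g ∘ E) ((p, q), (A * x ^ (d : ℤ), B * y ^ (e : ℤ))) =
      g (((κ * p) ^ (s : ℤ), (κ' * q) ^ (s : ℤ)), (x, y)) := by
    intro p q x y
    have h₁ : E ((p, q), (A * x ^ (d : ℤ), B * y ^ (e : ℤ))) =
        ((monomialHomeomorph (κ ^ (s : ℤ)) s p, monomialHomeomorph (κ' ^ (s : ℤ)) s q),
          ((monomialHomeomorph A d).symm (monomialHomeomorph A d x),
            (monomialHomeomorph B e).symm (monomialHomeomorph B e y))) := rfl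
    rw [Function.comp_apply, h₁, Homeomorph.symm_apply_apply, Homeomorph.symm_apply_apply, hs, hs]
  refine (h (g ∘ E) (hg.comp E.continuous) (hc.comp_homeomorph E)).substitution
    (monomialHomeomorph A d).toMeasurableEquiv (monomialHomeomorph B e).toMeasurableEquiv
    (monomialHomeomorph D k).toMeasurableEquiv (measurePreserving_monomialHomeomorph A d)
    (measurePreserving_monomialHomeomorph B e) (measurePreserving_monomialHomeomorph D k) r
    (fun x y z => ?_) (fun x y => ?_) hN
  · rw [hP, hQ, hw]
    exact congrArg (· * _) (hE _ _ x y).symm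
  · rw [hP₀, hQ₀, hw₀]
    exact congrArg (· * _) (hE _ _ x y).symm

end KernelConcentrates

/-! ### The seven normal forms on the multiplicative group -/

section NormalForms

variable {F : Type*} [NontriviallyNormedField F] [ProperSpace F] [MeasurableSpace F] [BorelSpace F]
  (μ : Measure F) [μ.IsAddHaarMeasure]

/-- `1 - t` as a unit, for `t ≠ 1`. -/
def oneSub (t : Fˣ) : Fˣ := toUnit (1 - (t : F))

/-- The weight of a tetrahedron as a function on `B`. -/
def unitWeight (a c : ℝ) (t : Fˣ) : ℝ := weight a c (t : F)

theorem coe_oneSub {a c : ℝ} {t : Fˣ} (h : unitWeight a c t ≠ 0) :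
    (oneSub t : F) = 1 - t :=
  coe_toUnit (ne_of_weight_ne_zero h).2

variable {μ}

/-- The expressions over F and over B have to agree only where the weight is nonzero. There every 1
- X_i in question is invertible and `oneSub` is the actual difference rather than its default value.
-/
theorem kernelConcentrates_of_affineData {p q : F → F → F → F} {w : F → F → F → ℝ}
    {p₀ q₀ : F → F → F} {w₀ : F → F → ℝ} {α β d : F → F → F}
    (h : ∀ φ, IsKernel φ → AffineData μ (fun x y z => φ (p x y z) (q x y z) x y * (w x y z : ℂ))
      (fun x y => φ (p₀ x y) (q₀ x y) x y * (w₀ x y : ℂ)) α β d)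
    {P Q N : Fˣ → Fˣ → Fˣ → Fˣ} {w' : Fˣ → Fˣ → Fˣ → ℝ}
    {P₀ Q₀ : Fˣ → Fˣ → Fˣ} {w₀' : Fˣ → Fˣ → ℝ}
    (hw : ∀ x y z, w' x y z = w x y z) (hw₀ : ∀ x y, w₀' x y = w₀ x y)
    (hP : ∀ x y z, w' x y z ≠ 0 → p x y z = P x y z ∧ q x y z = Q x y z ∧
      α y z * x + β y z = N x y z)
    (hP₀ : ∀ x y, w₀' x y ≠ 0 → p₀ x y = P₀ x y ∧ q₀ x y = Q₀ x y) :
    KernelConcentrates (unitsMeasure μ) P Q N w' P₀ Q₀ w₀' := by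
  intro g hg hc
  refine ((h _ (isKernel_extendKernel hg hc)).concentrates (N := fun x y z => α y z * x + β y z)
    fun _ _ _ _ => rfl).units (fun x y z => ?_) (fun x y => ?_) fun x y z h0 => ?_
  · by_cases h0 : w' x y z = 0
    · simp [← hw, h0]
    · obtain ⟨h₁, h₂, -⟩ := hP x y z h0
      simp only [h₁, h₂, extendKernel_coe, hw]
  · by_cases h0 : w₀' x y = 0
    · simp [← hw₀, h0]
    · obtain ⟨h₁, h₂⟩ := hP₀ x y h0
      simp only [h₁, h₂, extendKernel_coe, hw₀]
  · exact (hP x y z fun h => h0 (by simp [h])).2.2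

variable {a c : Fin 5 → ℝ}

theorem kernelConcentrates_zero_four
    (h₃₄ : a 0 = a 1 + a 2) (h₀₁ : a 4 = a 2 + a 3) (h₀₄ : c 1 + c 2 + c 3 = 2) (h₁₂ : c 3 = a 0 + c 4) (h₂₃ : c 1 = c 0 + a 4) :
    KernelConcentrates (unitsMeasure μ) (fun x y z => y * oneSub (x * z))
      (fun x y z => x * oneSub (z * y))
      (fun x y z => oneSub (x * z) * oneSub (z * y) / oneSub z)
      (fun x y z => unitWeight (a 1) (c 1) (x * z) * unitWeight (a 2) (c 2) z * unitWeight (a 3) (c 3) (z * y))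
      (fun x _ => oneSub x) (fun _ y => oneSub y)
      (fun x y => unitWeight (a 0) (c 0) x * unitWeight (a 4) (c 4) y) := by
  refine kernelConcentrates_of_affineData
    (fun φ hφ => affineData_zero_four μ hφ h₃₄ h₀₁ h₀₄ h₁₂ h₂₃)
    (fun _ y _ => by simp [unitWeight]) (fun _ y => by simp [unitWeight])
    (fun x y z h => ?_) (fun x y h => ?_)
  · have hx := x.ne_zero
    have hy := y.ne_zero
    have hz := z.ne_zero
    obtain ⟨h, e₃⟩ := mul_ne_zero_iff.1 h
    obtain ⟨e₁, e₂⟩ := mul_ne_zero_iff.1 h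
    replace e₁ := coe_oneSub e₁
    replace e₂ := coe_oneSub e₂
    replace e₃ := coe_oneSub e₃
    have n := (oneSub z).ne_zero
    rw [e₂] at n
    push_cast at *
    simp only [e₁, e₂, e₃]
    refine ⟨by simp, by simp, ?_⟩
    field_simp
    try ring
  · obtain ⟨e₁, e₂⟩ := mul_ne_zero_iff.1 h
    replace e₁ := coe_oneSub e₁
    replace e₂ := coe_oneSub e₂
    simp only [e₁, e₂]
    exact ⟨by simp, by simp⟩

theorem kernelConcentrates_one_two
    (h₃₄ : a 0 = a 1 + a 2) (h₀₁ : a 2 = a 3 + a 4) (h₀₄ : c 3 = c 1 + c 2) (h₁₂ : a 0 + c 3 + c 4 = 2) (h₂₃ : c 1 = c 0 + a 4) :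
    KernelConcentrates (unitsMeasure μ) (fun x y z => z / oneSub (x / y))
      (fun x y z => oneSub (y * z) * oneSub (x / y) / z)
      (fun x y z => x / y * oneSub (y * z) / oneSub z)
      (fun x y z => unitWeight (a 0) (c 0) (x / y) * unitWeight (a 3) (c 3) (y * z) * unitWeight (a 4) (c 4) z)
      (fun x _ => (oneSub x)⁻¹) (fun _ y => oneSub y)
      (fun x y => unitWeight (a 1) (c 1) x * unitWeight (a 2) (c 2) y) := by
  refine kernelConcentrates_of_affineData
    (fun φ hφ => affineData_one_two μ hφ h₃₄ h₀₁ h₀₄ h₁₂ h₂₃)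
    (fun _ y _ => by simp [unitWeight]) (fun _ y => by simp [unitWeight])
    (fun x y z h => ?_) (fun x y h => ?_)
  · have hx := x.ne_zero
    have hy := y.ne_zero
    have hz := z.ne_zero
    obtain ⟨h, e₃⟩ := mul_ne_zero_iff.1 h
    obtain ⟨e₁, e₂⟩ := mul_ne_zero_iff.1 h
    replace e₁ := coe_oneSub e₁
    replace e₂ := coe_oneSub e₂
    replace e₃ := coe_oneSub e₃
    have n := (oneSub z).ne_zero
    rw [e₃] at n
    push_cast at *
    simp only [e₁, e₂, e₃]
    refine ⟨by simp, by simp, ?_⟩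
    field_simp
    try ring
  · obtain ⟨e₁, e₂⟩ := mul_ne_zero_iff.1 h
    replace e₁ := coe_oneSub e₁
    replace e₂ := coe_oneSub e₂
    push_cast at *
    simp only [e₁, e₂]
    exact ⟨by simp, by simp⟩

theorem kernelConcentrates_three_four
    (h₃₄ : a 0 + a 1 + a 2 = 2) (h₀₁ : a 2 = a 3 + a 4) (h₀₄ : c 3 = c 1 + c 2) (h₁₂ : a 0 = c 3 + c 4) (h₂₃ : a 4 = c 0 + c 1) :
    KernelConcentrates (unitsMeasure μ) (fun _ _ z => z⁻¹)
      (fun x y z => (oneSub (y * z))⁻¹)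
      (fun x y z => x * oneSub (y * z) / oneSub z)
      (fun _ y z => unitWeight (a 3) (c 3) (y * z) * unitWeight (a 4) (c 4) z)
      (fun x y => oneSub (x * y) / oneSub x) (fun x y => oneSub (x * y) / oneSub y)
      (fun x y => unitWeight (a 0) (c 0) x * unitWeight (a 1) (c 1) (x * y) * unitWeight (a 2) (c 2) y) := by
  refine kernelConcentrates_of_affineData
    (fun φ hφ => affineData_three_four μ hφ h₃₄ h₀₁ h₀₄ h₁₂ h₂₃)
    (fun _ y _ => by simp [unitWeight]) (fun _ y => by simp [unitWeight])
    (fun x y z h => ?_) (fun x y h => ?_)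
  · have hx := x.ne_zero
    have hy := y.ne_zero
    have hz := z.ne_zero
    obtain ⟨e₁, e₂⟩ := mul_ne_zero_iff.1 h
    replace e₁ := coe_oneSub e₁
    replace e₂ := coe_oneSub e₂
    have n := (oneSub z).ne_zero
    rw [e₂] at n
    push_cast at *
    simp only [e₁, e₂]
    refine ⟨by simp, by simp, ?_⟩
    field_simp
    try ring
  · obtain ⟨h, e₃⟩ := mul_ne_zero_iff.1 h
    obtain ⟨e₁, e₂⟩ := mul_ne_zero_iff.1 h
    replace e₁ := coe_oneSub e₁
    replace e₂ := coe_oneSub e₂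
    replace e₃ := coe_oneSub e₃
    push_cast at *
    simp only [e₁, e₂, e₃]
    exact ⟨by simp, by simp⟩

theorem kernelConcentrates_zero_two
    (h₃₄ : a 1 = a 0 + a 2) (h₀₁ : a 2 = a 3 + a 4) (h₀₄ : c 2 = c 1 + c 3) (h₁₂ : a 0 = c 3 + c 4) (h₂₃ : c 0 = c 1 + a 4) :
    KernelConcentrates (unitsMeasure μ) (fun x y z => z⁻¹ * oneSub (x * y))
      (fun x y z => oneSub (x * y) * oneSub (y / z))
      (fun x y z => x * oneSub (y / z) / oneSub z⁻¹)
      (fun x y z => unitWeight (a 1) (c 1) (x * y) * unitWeight (a 3) (c 3) (y / z) * unitWeight (a 4) (c 4) z⁻¹)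
      (fun x _ => oneSub x) (fun _ y => oneSub y)
      (fun x y => unitWeight (a 0) (c 0) x * unitWeight (a 2) (c 2) y) := by
  refine kernelConcentrates_of_affineData
    (fun φ hφ => affineData_zero_two μ hφ h₃₄ h₀₁ h₀₄ h₁₂ h₂₃)
    (fun _ y _ => by simp [unitWeight]) (fun _ y => by simp [unitWeight])
    (fun x y z h => ?_) (fun x y h => ?_)
  · have hx := x.ne_zero
    have hy := y.ne_zero
    have hz := z.ne_zero
    obtain ⟨h, e₃⟩ := mul_ne_zero_iff.1 h
    obtain ⟨e₁, e₂⟩ := mul_ne_zero_iff.1 h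
    replace e₁ := coe_oneSub e₁
    replace e₂ := coe_oneSub e₂
    replace e₃ := coe_oneSub e₃
    have n := (oneSub z⁻¹).ne_zero
    rw [e₃] at n
    push_cast at *
    simp only [e₁, e₂, e₃]
    refine ⟨by simp, by simp, ?_⟩
    field_simp
    try ring
  · obtain ⟨e₁, e₂⟩ := mul_ne_zero_iff.1 h
    replace e₁ := coe_oneSub e₁
    replace e₂ := coe_oneSub e₂
    simp only [e₁, e₂]
    exact ⟨by simp, by simp⟩

theorem kernelConcentrates_zero_three
    (h₃₄ : a 0 = a 1 + a 2) (h₀₁ : a 3 = a 2 + a 4) (h₀₄ : c 3 = c 1 + c 2) (h₁₂ : c 4 = a 0 + c 3) (h₂₃ : c 0 = c 1 + a 4) :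
    KernelConcentrates (unitsMeasure μ) (fun x y z => y * z * oneSub (x * z)⁻¹)
      (fun x y z => x⁻¹ / oneSub (y * z))
      (fun x y z => x * oneSub (x * z)⁻¹ * oneSub (y * z) / oneSub z⁻¹)
      (fun x y z => unitWeight (a 1) (c 1) (x * z)⁻¹ * unitWeight (a 2) (c 2) z⁻¹ * unitWeight (a 4) (c 4) (y * z))
      (fun x _ => oneSub x⁻¹) (fun _ y => (oneSub y)⁻¹)
      (fun x y => unitWeight (a 0) (c 0) x⁻¹ * unitWeight (a 3) (c 3) y) := by
  refine kernelConcentrates_of_affineData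
    (fun φ hφ => affineData_zero_three μ hφ h₃₄ h₀₁ h₀₄ h₁₂ h₂₃)
    (fun _ y _ => by simp [unitWeight]) (fun _ y => by simp [unitWeight])
    (fun x y z h => ?_) (fun x y h => ?_)
  · have hx := x.ne_zero
    have hy := y.ne_zero
    have hz := z.ne_zero
    obtain ⟨h, e₃⟩ := mul_ne_zero_iff.1 h
    obtain ⟨e₁, e₂⟩ := mul_ne_zero_iff.1 h
    replace e₁ := coe_oneSub e₁
    replace e₂ := coe_oneSub e₂
    replace e₃ := coe_oneSub e₃
    have n := (oneSub z⁻¹).ne_zero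
    rw [e₂] at n
    push_cast at *
    simp only [e₁, e₂, e₃]
    refine ⟨by simp, by simp, ?_⟩
    field_simp
    try ring
  · obtain ⟨e₁, e₂⟩ := mul_ne_zero_iff.1 h
    replace e₁ := coe_oneSub e₁
    replace e₂ := coe_oneSub e₂
    push_cast at *
    simp only [e₁, e₂]
    exact ⟨by simp, by simp⟩

theorem kernelConcentrates_zero_one
    (h₃₄ : a 2 = a 0 + a 1) (h₀₁ : a 2 + a 3 + a 4 = 2) (h₀₄ : c 1 = c 2 + c 3) (h₁₂ : a 0 = c 3 + c 4) (h₂₃ : a 4 = c 0 + c 1) :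
    KernelConcentrates (unitsMeasure μ) (fun x y z => z * oneSub (y / x) / oneSub (y * z / x))
      (fun x y z => oneSub (y * z / x) / oneSub (y / x))
      (fun x y z => x * oneSub (y * z / x) / oneSub z)
      (fun x y z => unitWeight (a 2) (c 2) (y / x) * unitWeight (a 3) (c 3) (y * z / x) * unitWeight (a 4) (c 4) z)
      (fun x _ => oneSub x) (fun _ y => (oneSub y)⁻¹)
      (fun x y => unitWeight (a 0) (c 0) x * unitWeight (a 1) (c 1) y) := by
  refine kernelConcentrates_of_affineData
    (fun φ hφ => affineData_zero_one μ hφ h₃₄ h₀₁ h₀₄ h₁₂ h₂₃)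
    (fun _ y _ => by simp [unitWeight]) (fun _ y => by simp [unitWeight])
    (fun x y z h => ?_) (fun x y h => ?_)
  · have hx := x.ne_zero
    have hy := y.ne_zero
    have hz := z.ne_zero
    obtain ⟨h, e₃⟩ := mul_ne_zero_iff.1 h
    obtain ⟨e₁, e₂⟩ := mul_ne_zero_iff.1 h
    replace e₁ := coe_oneSub e₁
    replace e₂ := coe_oneSub e₂
    replace e₃ := coe_oneSub e₃
    have n := (oneSub z).ne_zero
    rw [e₃] at n
    push_cast at *
    simp only [e₁, e₂, e₃]
    refine ⟨by simp, by simp, ?_⟩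
    field_simp
    try ring
  · obtain ⟨e₁, e₂⟩ := mul_ne_zero_iff.1 h
    replace e₁ := coe_oneSub e₁
    replace e₂ := coe_oneSub e₂
    push_cast at *
    simp only [e₁, e₂]
    exact ⟨by simp, by simp⟩

theorem kernelConcentrates_one_three
    (h₃₄ : a 1 = a 0 + a 2) (h₀₁ : a 3 = a 2 + a 4) (h₀₄ : c 2 = c 1 + c 3) (h₁₂ : c 3 = a 0 + c 4) (h₂₃ : c 1 = c 0 + a 4) :
    KernelConcentrates (unitsMeasure μ) (fun x y z => y / z / oneSub (x * z)⁻¹)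
      (fun x y z => (x * z)⁻¹ / oneSub (y / z))
      (fun x y z => oneSub (x * z)⁻¹ * oneSub (y / z) * (x * z) / (oneSub z * (y / z)))
      (fun x y z => unitWeight (a 0) (c 0) (x * z)⁻¹ * unitWeight (a 2) (c 2) z * unitWeight (a 4) (c 4) (y / z))
      (fun x _ => (oneSub x⁻¹)⁻¹) (fun _ y => (oneSub y)⁻¹)
      (fun x y => unitWeight (a 1) (c 1) x⁻¹ * unitWeight (a 3) (c 3) y) := by
  refine kernelConcentrates_of_affineData
    (fun φ hφ => affineData_one_three μ hφ h₃₄ h₀₁ h₀₄ h₁₂ h₂₃)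
    (fun _ y _ => by simp [unitWeight]) (fun _ y => by simp [unitWeight])
    (fun x y z h => ?_) (fun x y h => ?_)
  · have hx := x.ne_zero
    have hy := y.ne_zero
    have hz := z.ne_zero
    obtain ⟨h, e₃⟩ := mul_ne_zero_iff.1 h
    obtain ⟨e₁, e₂⟩ := mul_ne_zero_iff.1 h
    replace e₁ := coe_oneSub e₁
    replace e₂ := coe_oneSub e₂
    replace e₃ := coe_oneSub e₃
    have n := (oneSub z).ne_zero
    rw [e₂] at n
    push_cast at *
    simp only [e₁, e₂, e₃]
    refine ⟨by simp, by simp, ?_⟩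
    field_simp
    try ring
  · obtain ⟨e₁, e₂⟩ := mul_ne_zero_iff.1 h
    replace e₁ := coe_oneSub e₁
    replace e₂ := coe_oneSub e₂
    push_cast at *
    simp only [e₁, e₂]
    exact ⟨by simp, by simp⟩

end NormalForms

/-! ## The ten pentagons -/

section Pentagons

variable {F : Type*} [NontriviallyNormedField F]

/-- The relations between the multiplicative parts of the signed angles. -/
structure AnglePattern (A C : Fin 5 → Fˣ) : Prop where
  one : A 1 = A 0 * A 2
  three : A 3 = A 2 * A 4
  inner : C 2 = C 1 * C 3
  left : C 1 = C 0 * A 4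
  right : C 3 = A 0 * C 4

/-- The second components of `tetVars`. -/
def tetUnits (x₀ x₂ x₄ : Fˣ) : Fin 5 → Fˣ := ![x₀, x₀ * x₂, x₂, x₂ * x₄, x₄]

/-- The argument of the character of `T i` in its weight, for `i ∈ S`. -/
def charArg (A C : Fin 5 → Fˣ) (S : Finset (Fin 5)) (x₀ x₂ x₄ : Fˣ) (i : Fin 5) : Fˣ :=
  if i ∈ S then oneSub (A i * tetUnits x₀ x₂ x₄ i) * C i else 1

/-- The arguments of the characters of `z₀`, `z₂`, `z₄` in the integrand. -/
def innerArg (A C : Fin 5 → Fˣ) (S : Finset (Fin 5)) (x₀ x₂ x₄ : Fˣ) : Fin 3 → Fˣ :=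
  ![x₄ * charArg A C S x₀ x₂ x₄ 1 / charArg A C S x₀ x₂ x₄ 0,
    charArg A C S x₀ x₂ x₄ 1 * charArg A C S x₀ x₂ x₄ 3 / charArg A C S x₀ x₂ x₄ 2,
    x₀ * charArg A C S x₀ x₂ x₄ 3 / charArg A C S x₀ x₂ x₄ 4]

/-- The arguments of the characters of `z₀`, `z₂`, `z₄` in the side without the integral. -/
def outerArg (A C : Fin 5 → Fˣ) (S : Finset (Fin 5)) (x₀ x₂ x₄ : Fˣ) : Fin 3 → Fˣ :=
  ![charArg A C S x₀ x₂ x₄ 0 / charArg A C S x₀ x₂ x₄ 1,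
    charArg A C S x₀ x₂ x₄ 2 / (charArg A C S x₀ x₂ x₄ 1 * charArg A C S x₀ x₂ x₄ 3),
    charArg A C S x₀ x₂ x₄ 4 / charArg A C S x₀ x₂ x₄ 3]

variable [ProperSpace F] [MeasurableSpace F] [BorelSpace F] {μ : Measure F} [μ.IsAddHaarMeasure]
  {A C : Fin 5 → Fˣ} {a c : Fin 5 → ℝ}

/-- The absolute value of the weight of a side. -/
def sideModulus (a c : Fin 5 → ℝ) (A : Fin 5 → Fˣ) (S : Finset (Fin 5)) (x₀ x₂ x₄ : Fˣ) : ℝ :=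
  ∏ i ∈ S, unitWeight (a i) (c i) (A i * tetUnits x₀ x₂ x₄ i)

/-- The scaled variables A_i x_i satisfy the same monomial relations as the x_i, which makes the
weights those of the normal form. The constants κ, κ' collect the factors C_i and the A_i created by
the scaling; the remaining relations among A and C make N and the limit consistent with them. -/
theorem kernelConcentrates_pentagon_zero_one (h : AnglePattern A C) (s : ℤˣ)
    (h₃₄ : a 2 = a 0 + a 1) (h₀₁ : a 2 + a 3 + a 4 = 2) (h₀₄ : c 1 = c 2 + c 3)
    (h₁₂ : a 0 = c 3 + c 4) (h₂₃ : a 4 = c 0 + c 1) :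
    KernelConcentrates (unitsMeasure μ)
      (fun x y z => (innerArg A C {0, 1}ᶜ x (y / x) z 0 / innerArg A C {0, 1}ᶜ x (y / x) z 1) ^ (s : ℤ))
      (fun x y z => (innerArg A C {0, 1}ᶜ x (y / x) z 1) ^ (s : ℤ))
      (fun x y z => (innerArg A C {0, 1}ᶜ x (y / x) z 2) ^ (s : ℤ))
      (fun x y z => sideModulus a c A {0, 1}ᶜ x (y / x) z)
      (fun x y => (outerArg A C {0, 1} x (y / x) 1 0 / outerArg A C {0, 1} x (y / x) 1 1) ^ (s : ℤ))
      (fun x y => (outerArg A C {0, 1} x (y / x) 1 1) ^ (s : ℤ))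
      (fun x y => sideModulus a c A {0, 1} x (y / x) 1) := by
  obtain ⟨e₁, e₂, e₃, e₄, e₅⟩ :
      (∀ x y z, A 2 * tetUnits x (y / x) z 2 = (A 1 * y) / (A 0 * x)) ∧
      (∀ x y z, A 3 * tetUnits x (y / x) z 3 = (A 1 * y) * (A 4 * z) / (A 0 * x)) ∧
      (∀ x y z, A 4 * tetUnits x (y / x) z 4 = (A 4 * z)) ∧
      (∀ x y z, A 0 * tetUnits x (y / x) z 0 = (A 0 * x)) ∧
      (∀ x y z, A 1 * tetUnits x (y / x) z 1 = (A 1 * y)) := by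
    refine ⟨?_, ?_, ?_, ?_, ?_⟩ <;> intro x y z <;> apply Additive.ofMul.injective <;>
      simp only [tetUnits, h.one, h.three, Matrix.cons_val, ofMul_mul, ofMul_div, ofMul_inv] <;> abel
  have hI : ({0, 1}ᶜ : Finset (Fin 5)) = {2, 3, 4} := by decide
  rw [hI]
  refine (kernelConcentrates_zero_one (μ := μ) h₃₄ h₀₁ h₀₄ h₁₂ h₂₃).substitution
    (C 2 / (A 4 * C 3)) (C 3 / C 2) (A 0) (A 1) (A 4) 1 1 1 s s
    (fun x y z => ?_) (fun x y z => ?_) (fun x y z => ?_) (fun x y z => ?_) (fun x y => ?_)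
    (fun x y => ?_) (fun x y => ?_)
  on_goal 7 => rw [sideModulus, Finset.prod_pair (by decide), e₄, e₅]
  on_goal 4 => rw [sideModulus, Finset.prod_insert (by decide), Finset.prod_pair (by decide), e₁, e₂, e₃]
  all_goals simp only [innerArg, outerArg, charArg, e₁, e₂, e₃, e₄, e₅, Finset.mem_insert,
    Finset.mem_singleton, Fin.reduceEq, or_false, or_true, or_self, if_true, if_false,
    Matrix.cons_val, Units.val_neg, Units.val_one, zpow_neg, zpow_one]
  all_goals first
  | ring1
  | congr 1
    apply Additive.ofMul.injective
    simp only [h.inner, h.left, h.right, h.one, h.three, ofMul_mul, ofMul_div, ofMul_inv, ofMul_one]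
    abel

theorem kernelConcentrates_pentagon_zero_two (h : AnglePattern A C) (s : ℤˣ)
    (h₃₄ : a 1 = a 0 + a 2) (h₀₁ : a 2 = a 3 + a 4) (h₀₄ : c 2 = c 1 + c 3)
    (h₁₂ : a 0 = c 3 + c 4) (h₂₃ : c 0 = c 1 + a 4) :
    KernelConcentrates (unitsMeasure μ)
      (fun x y z => (innerArg A C {0, 2}ᶜ x y z 0) ^ (s : ℤ))
      (fun x y z => (innerArg A C {0, 2}ᶜ x y z 1) ^ (s : ℤ))
      (fun x y z => (innerArg A C {0, 2}ᶜ x y z 2) ^ (s : ℤ))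
      (fun x y z => sideModulus a c A {0, 2}ᶜ x y z)
      (fun x y => (outerArg A C {0, 2} x y 1 0) ^ (s : ℤ))
      (fun x y => (outerArg A C {0, 2} x y 1 1) ^ (s : ℤ))
      (fun x y => sideModulus a c A {0, 2} x y 1) := by
  obtain ⟨e₁, e₂, e₃, e₄, e₅⟩ :
      (∀ x y z, A 1 * tetUnits x y z 1 = (A 0 * x) * (A 2 * y)) ∧
      (∀ x y z, A 3 * tetUnits x y z 3 = (A 2 * y) / ((A 4)⁻¹ * z⁻¹)) ∧
      (∀ x y z, A 4 * tetUnits x y z 4 = ((A 4)⁻¹ * z⁻¹)⁻¹) ∧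
      (∀ x y z, A 0 * tetUnits x y z 0 = (A 0 * x)) ∧
      (∀ x y z, A 2 * tetUnits x y z 2 = (A 2 * y)) := by
    refine ⟨?_, ?_, ?_, ?_, ?_⟩ <;> intro x y z <;> apply Additive.ofMul.injective <;>
      simp only [tetUnits, h.one, h.three, Matrix.cons_val, ofMul_mul, ofMul_div, ofMul_inv] <;> abel
  have hI : ({0, 2}ᶜ : Finset (Fin 5)) = {1, 3, 4} := by decide
  rw [hI]
  refine (kernelConcentrates_zero_two (μ := μ) h₃₄ h₀₁ h₀₄ h₁₂ h₂₃).substitution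
    (C 1 / A 4) (C 1 * C 3) (A 0) (A 2) ((A 4)⁻¹) 1 1 (-1) s s
    (fun x y z => ?_) (fun x y z => ?_) (fun x y z => ?_) (fun x y z => ?_) (fun x y => ?_)
    (fun x y => ?_) (fun x y => ?_)
  on_goal 7 => rw [sideModulus, Finset.prod_pair (by decide), e₄, e₅]
  on_goal 4 => rw [sideModulus, Finset.prod_insert (by decide), Finset.prod_pair (by decide), e₁, e₂, e₃]
  all_goals simp only [innerArg, outerArg, charArg, e₁, e₂, e₃, e₄, e₅, Finset.mem_insert,
    Finset.mem_singleton, Fin.reduceEq, or_false, or_true, or_self, if_true, if_false,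
    Matrix.cons_val, Units.val_neg, Units.val_one, zpow_neg, zpow_one]
  all_goals first
  | ring1
  | congr 1
    apply Additive.ofMul.injective
    simp only [h.inner, h.left, h.right, h.one, h.three, ofMul_mul, ofMul_div, ofMul_inv, ofMul_one]
    abel

theorem kernelConcentrates_pentagon_one_two (h : AnglePattern A C) (s : ℤˣ)
    (h₃₄ : a 0 = a 1 + a 2) (h₀₁ : a 2 = a 3 + a 4) (h₀₄ : c 3 = c 1 + c 2)
    (h₁₂ : a 0 + c 3 + c 4 = 2) (h₂₃ : c 1 = c 0 + a 4) :
    KernelConcentrates (unitsMeasure μ)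
      (fun x y z => (innerArg A C {1, 2}ᶜ (x / y) y z 0) ^ (s : ℤ))
      (fun x y z => (innerArg A C {1, 2}ᶜ (x / y) y z 1 / innerArg A C {1, 2}ᶜ (x / y) y z 0) ^ (s : ℤ))
      (fun x y z => (innerArg A C {1, 2}ᶜ (x / y) y z 2) ^ (s : ℤ))
      (fun x y z => sideModulus a c A {1, 2}ᶜ (x / y) y z)
      (fun x y => (outerArg A C {1, 2} (x / y) y 1 0) ^ (s : ℤ))
      (fun x y => (outerArg A C {1, 2} (x / y) y 1 1 / outerArg A C {1, 2} (x / y) y 1 0) ^ (s : ℤ))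
      (fun x y => sideModulus a c A {1, 2} (x / y) y 1) := by
  obtain ⟨e₁, e₂, e₃, e₄, e₅⟩ :
      (∀ x y z, A 0 * tetUnits (x / y) y z 0 = (A 1 * x) / (A 2 * y)) ∧
      (∀ x y z, A 3 * tetUnits (x / y) y z 3 = (A 2 * y) * (A 4 * z)) ∧
      (∀ x y z, A 4 * tetUnits (x / y) y z 4 = (A 4 * z)) ∧
      (∀ x y z, A 1 * tetUnits (x / y) y z 1 = (A 1 * x)) ∧
      (∀ x y z, A 2 * tetUnits (x / y) y z 2 = (A 2 * y)) := by
    refine ⟨?_, ?_, ?_, ?_, ?_⟩ <;> intro x y z <;> apply Additive.ofMul.injective <;>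
      simp only [tetUnits, h.one, h.three, Matrix.cons_val, ofMul_mul, ofMul_div, ofMul_inv] <;> abel
  have hI : ({1, 2}ᶜ : Finset (Fin 5)) = {0, 3, 4} := by decide
  rw [hI]
  refine (kernelConcentrates_one_two (μ := μ) h₃₄ h₀₁ h₀₄ h₁₂ h₂₃).substitution
    (1 / (A 4 * C 0)) (A 4 * C 3 * C 0) (A 1) (A 2) (A 4) 1 1 1 s s
    (fun x y z => ?_) (fun x y z => ?_) (fun x y z => ?_) (fun x y z => ?_) (fun x y => ?_)
    (fun x y => ?_) (fun x y => ?_)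
  on_goal 7 => rw [sideModulus, Finset.prod_pair (by decide), e₄, e₅]
  on_goal 4 => rw [sideModulus, Finset.prod_insert (by decide), Finset.prod_pair (by decide), e₁, e₂, e₃]
  all_goals simp only [innerArg, outerArg, charArg, e₁, e₂, e₃, e₄, e₅, Finset.mem_insert,
    Finset.mem_singleton, Fin.reduceEq, or_false, or_true, or_self, if_true, if_false,
    Matrix.cons_val, Units.val_neg, Units.val_one, zpow_neg, zpow_one]
  all_goals first
  | ring1
  | congr 1
    apply Additive.ofMul.injective
    simp only [h.inner, h.left, h.right, h.one, h.three, ofMul_mul, ofMul_div, ofMul_inv, ofMul_one]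
    abel

theorem kernelConcentrates_pentagon_three_four (h : AnglePattern A C) (s : ℤˣ)
    (h₃₄ : a 0 + a 1 + a 2 = 2) (h₀₁ : a 2 = a 3 + a 4) (h₀₄ : c 3 = c 1 + c 2)
    (h₁₂ : a 0 = c 3 + c 4) (h₂₃ : a 4 = c 0 + c 1) :
    KernelConcentrates (unitsMeasure μ)
      (fun x y z => (innerArg A C {3, 4} x y z 0) ^ (s : ℤ))
      (fun x y z => (innerArg A C {3, 4} x y z 1) ^ (s : ℤ))
      (fun x y z => (innerArg A C {3, 4} x y z 2) ^ (s : ℤ))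
      (fun x y z => sideModulus a c A {3, 4} x y z)
      (fun x y => (outerArg A C {3, 4}ᶜ x y 1 0) ^ (s : ℤ))
      (fun x y => (outerArg A C {3, 4}ᶜ x y 1 1) ^ (s : ℤ))
      (fun x y => sideModulus a c A {3, 4}ᶜ x y 1) := by
  obtain ⟨e₁, e₂, e₃, e₄, e₅⟩ :
      (∀ x y z, A 3 * tetUnits x y z 3 = (A 2 * y) * (A 4 * z)) ∧
      (∀ x y z, A 4 * tetUnits x y z 4 = (A 4 * z)) ∧
      (∀ x y z, A 0 * tetUnits x y z 0 = (A 0 * x)) ∧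
      (∀ x y z, A 1 * tetUnits x y z 1 = (A 0 * x) * (A 2 * y)) ∧
      (∀ x y z, A 2 * tetUnits x y z 2 = (A 2 * y)) := by
    refine ⟨?_, ?_, ?_, ?_, ?_⟩ <;> intro x y z <;> apply Additive.ofMul.injective <;>
      simp only [tetUnits, h.one, h.three, Matrix.cons_val, ofMul_mul, ofMul_div, ofMul_inv] <;> abel
  have hI : ({3, 4}ᶜ : Finset (Fin 5)) = {0, 1, 2} := by decide
  rw [hI]
  -- The normal form contains the inverses of the arguments P and Q, hence the exponent -s.
  refine (kernelConcentrates_three_four (μ := μ) h₃₄ h₀₁ h₀₄ h₁₂ h₂₃).substitution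
    (A 4) ((C 3)⁻¹) (A 0) (A 2) (A 4) 1 1 1 (-s) s
    (fun x y z => ?_) (fun x y z => ?_) (fun x y z => ?_) (fun x y z => ?_) (fun x y => ?_)
    (fun x y => ?_) (fun x y => ?_)
  on_goal 7 => rw [sideModulus, Finset.prod_insert (by decide), Finset.prod_pair (by decide), e₃, e₄, e₅]
  on_goal 4 => rw [sideModulus, Finset.prod_pair (by decide), e₁, e₂]
  on_goal 6 => rw [Units.val_neg, zpow_neg, ← inv_zpow]
  on_goal 5 => rw [Units.val_neg, zpow_neg, ← inv_zpow]
  on_goal 2 => rw [Units.val_neg, zpow_neg, ← inv_zpow]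
  on_goal 1 => rw [Units.val_neg, zpow_neg, ← inv_zpow]
  all_goals simp only [innerArg, outerArg, charArg, e₁, e₂, e₃, e₄, e₅, Finset.mem_insert,
    Finset.mem_singleton, Fin.reduceEq, or_false, or_true, or_self, if_true, if_false,
    Matrix.cons_val, Units.val_neg, Units.val_one, zpow_neg, zpow_one]
  all_goals first
  | ring1
  | congr 1
    apply Additive.ofMul.injective
    simp only [h.inner, h.left, h.right, h.one, h.three, ofMul_mul, ofMul_div, ofMul_inv, ofMul_one]
    abel

theorem kernelConcentrates_pentagon_zero_three (h : AnglePattern A C) (s : ℤˣ)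
    (h₃₄ : a 0 = a 1 + a 2) (h₀₁ : a 3 = a 2 + a 4) (h₀₄ : c 3 = c 1 + c 2)
    (h₁₂ : c 4 = a 0 + c 3) (h₂₃ : c 0 = c 1 + a 4) :
    KernelConcentrates (unitsMeasure μ)
      (fun x y z => (innerArg A C {0, 3}ᶜ x z (y / z) 0) ^ (s : ℤ))
      (fun x y z => (innerArg A C {0, 3}ᶜ x z (y / z) 2) ^ (s : ℤ))
      (fun x y z => (innerArg A C {0, 3}ᶜ x z (y / z) 1 / innerArg A C {0, 3}ᶜ x z (y / z) 2) ^ (s : ℤ))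
      (fun x y z => sideModulus a c A {0, 3}ᶜ x z (y / z))
      (fun x y => (outerArg A C {0, 3} x 1 (y / 1) 0) ^ (s : ℤ))
      (fun x y => (outerArg A C {0, 3} x 1 (y / 1) 2) ^ (s : ℤ))
      (fun x y => sideModulus a c A {0, 3} x 1 (y / 1)) := by
  obtain ⟨e₁, e₂, e₃, e₄, e₅⟩ :
      (∀ x y z, A 1 * tetUnits x z (y / z) 1 = (((A 0)⁻¹ * x⁻¹) * ((A 2)⁻¹ * z⁻¹))⁻¹) ∧
      (∀ x y z, A 2 * tetUnits x z (y / z) 2 = ((A 2)⁻¹ * z⁻¹)⁻¹) ∧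
      (∀ x y z, A 4 * tetUnits x z (y / z) 4 = (A 3 * y) * ((A 2)⁻¹ * z⁻¹)) ∧
      (∀ x y z, A 0 * tetUnits x z (y / z) 0 = ((A 0)⁻¹ * x⁻¹)⁻¹) ∧
      (∀ x y z, A 3 * tetUnits x z (y / z) 3 = (A 3 * y)) := by
    refine ⟨?_, ?_, ?_, ?_, ?_⟩ <;> intro x y z <;> apply Additive.ofMul.injective <;>
      simp only [tetUnits, h.one, h.three, Matrix.cons_val, ofMul_mul, ofMul_div, ofMul_inv] <;> abel
  have hI : ({0, 3}ᶜ : Finset (Fin 5)) = {1, 2, 4} := by decide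
  rw [hI]
  refine (kernelConcentrates_zero_three (μ := μ) h₃₄ h₀₁ h₀₄ h₁₂ h₂₃).substitution
    (C 1 / A 4) (1 / (A 0 * C 4)) ((A 0)⁻¹) (A 3) ((A 2)⁻¹) (-1) 1 (-1) s s
    (fun x y z => ?_) (fun x y z => ?_) (fun x y z => ?_) (fun x y z => ?_) (fun x y => ?_)
    (fun x y => ?_) (fun x y => ?_)
  on_goal 7 => rw [sideModulus, Finset.prod_pair (by decide), e₄, e₅]
  on_goal 4 => rw [sideModulus, Finset.prod_insert (by decide), Finset.prod_pair (by decide), e₁, e₂, e₃]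
  all_goals simp only [innerArg, outerArg, charArg, e₁, e₂, e₃, e₄, e₅, Finset.mem_insert,
    Finset.mem_singleton, Fin.reduceEq, or_false, or_true, or_self, if_true, if_false,
    Matrix.cons_val, Units.val_neg, Units.val_one, zpow_neg, zpow_one]
  all_goals first
  | ring1
  | congr 1
    apply Additive.ofMul.injective
    simp only [h.inner, h.left, h.right, h.one, h.three, ofMul_mul, ofMul_div, ofMul_inv, ofMul_one]
    abel

theorem kernelConcentrates_pentagon_zero_four (h : AnglePattern A C) (s : ℤˣ)
    (h₃₄ : a 0 = a 1 + a 2) (h₀₁ : a 4 = a 2 + a 3) (h₀₄ : c 1 + c 2 + c 3 = 2)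
    (h₁₂ : c 3 = a 0 + c 4) (h₂₃ : c 1 = c 0 + a 4) :
    KernelConcentrates (unitsMeasure μ)
      (fun x y z => (innerArg A C {0, 4}ᶜ x z y 0) ^ (s : ℤ))
      (fun x y z => (innerArg A C {0, 4}ᶜ x z y 2) ^ (s : ℤ))
      (fun x y z => (innerArg A C {0, 4}ᶜ x z y 1) ^ (s : ℤ))
      (fun x y z => sideModulus a c A {0, 4}ᶜ x z y)
      (fun x y => (outerArg A C {0, 4} x 1 y 0) ^ (s : ℤ))
      (fun x y => (outerArg A C {0, 4} x 1 y 2) ^ (s : ℤ))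
      (fun x y => sideModulus a c A {0, 4} x 1 y) := by
  obtain ⟨e₁, e₂, e₃, e₄, e₅⟩ :
      (∀ x y z, A 1 * tetUnits x z y 1 = (A 0 * x) * (A 2 * z)) ∧
      (∀ x y z, A 2 * tetUnits x z y 2 = (A 2 * z)) ∧
      (∀ x y z, A 3 * tetUnits x z y 3 = (A 2 * z) * (A 4 * y)) ∧
      (∀ x y z, A 0 * tetUnits x z y 0 = (A 0 * x)) ∧
      (∀ x y z, A 4 * tetUnits x z y 4 = (A 4 * y)) := by
    refine ⟨?_, ?_, ?_, ?_, ?_⟩ <;> intro x y z <;> apply Additive.ofMul.injective <;>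
      simp only [tetUnits, h.one, h.three, Matrix.cons_val, ofMul_mul, ofMul_div, ofMul_inv] <;> abel
  have hI : ({0, 4}ᶜ : Finset (Fin 5)) = {1, 2, 3} := by decide
  rw [hI]
  refine (kernelConcentrates_zero_four (μ := μ) h₃₄ h₀₁ h₀₄ h₁₂ h₂₃).substitution
    (C 1 / A 4) (C 3 / A 0) (A 0) (A 4) (A 2) 1 1 1 s s
    (fun x y z => ?_) (fun x y z => ?_) (fun x y z => ?_) (fun x y z => ?_) (fun x y => ?_)
    (fun x y => ?_) (fun x y => ?_)
  on_goal 7 => rw [sideModulus, Finset.prod_pair (by decide), e₄, e₅]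
  on_goal 4 => rw [sideModulus, Finset.prod_insert (by decide), Finset.prod_pair (by decide), e₁, e₂, e₃]
  all_goals simp only [innerArg, outerArg, charArg, e₁, e₂, e₃, e₄, e₅, Finset.mem_insert,
    Finset.mem_singleton, Fin.reduceEq, or_false, or_true, or_self, if_true, if_false,
    Matrix.cons_val, Units.val_neg, Units.val_one, zpow_neg, zpow_one]
  all_goals first
  | ring1
  | congr 1
    apply Additive.ofMul.injective
    simp only [h.inner, h.left, h.right, h.one, h.three, ofMul_mul, ofMul_div, ofMul_inv, ofMul_one]
    abel

theorem kernelConcentrates_pentagon_one_three (h : AnglePattern A C) (s : ℤˣ)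
    (h₃₄ : a 1 = a 0 + a 2) (h₀₁ : a 3 = a 2 + a 4) (h₀₄ : c 2 = c 1 + c 3)
    (h₁₂ : c 3 = a 0 + c 4) (h₂₃ : c 1 = c 0 + a 4) :
    KernelConcentrates (unitsMeasure μ)
      (fun x y z => (innerArg A C {1, 3}ᶜ (x / z) z (y / z) 0) ^ (s : ℤ))
      (fun x y z => (innerArg A C {1, 3}ᶜ (x / z) z (y / z) 2) ^ (s : ℤ))
      (fun x y z => (innerArg A C {1, 3}ᶜ (x / z) z (y / z) 1 / (innerArg A C {1, 3}ᶜ (x / z) z (y / z) 0 * innerArg A C {1, 3}ᶜ (x / z) z (y / z) 2)) ^ (s : ℤ))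
      (fun x y z => sideModulus a c A {1, 3}ᶜ (x / z) z (y / z))
      (fun x y => (outerArg A C {1, 3} (x / 1) 1 (y / 1) 0) ^ (s : ℤ))
      (fun x y => (outerArg A C {1, 3} (x / 1) 1 (y / 1) 2) ^ (s : ℤ))
      (fun x y => sideModulus a c A {1, 3} (x / 1) 1 (y / 1)) := by
  obtain ⟨e₁, e₂, e₃, e₄, e₅⟩ :
      (∀ x y z, A 0 * tetUnits (x / z) z (y / z) 0 = (((A 1)⁻¹ * x⁻¹) * (A 2 * z))⁻¹) ∧
      (∀ x y z, A 2 * tetUnits (x / z) z (y / z) 2 = (A 2 * z)) ∧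
      (∀ x y z, A 4 * tetUnits (x / z) z (y / z) 4 = (A 3 * y) / (A 2 * z)) ∧
      (∀ x y z, A 1 * tetUnits (x / z) z (y / z) 1 = ((A 1)⁻¹ * x⁻¹)⁻¹) ∧
      (∀ x y z, A 3 * tetUnits (x / z) z (y / z) 3 = (A 3 * y)) := by
    refine ⟨?_, ?_, ?_, ?_, ?_⟩ <;> intro x y z <;> apply Additive.ofMul.injective <;>
      simp only [tetUnits, h.one, h.three, Matrix.cons_val, ofMul_mul, ofMul_div, ofMul_inv] <;> abel
  have hI : ({1, 3}ᶜ : Finset (Fin 5)) = {0, 2, 4} := by decide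
  rw [hI]
  refine (kernelConcentrates_one_three (μ := μ) h₃₄ h₀₁ h₀₄ h₁₂ h₂₃).substitution
    (1 / (A 4 * C 0)) (1 / (A 0 * C 4)) ((A 1)⁻¹) (A 3) (A 2) (-1) 1 1 s s
    (fun x y z => ?_) (fun x y z => ?_) (fun x y z => ?_) (fun x y z => ?_) (fun x y => ?_)
    (fun x y => ?_) (fun x y => ?_)
  on_goal 7 => rw [sideModulus, Finset.prod_pair (by decide), e₄, e₅]
  on_goal 4 => rw [sideModulus, Finset.prod_insert (by decide), Finset.prod_pair (by decide), e₁, e₂, e₃]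
  all_goals simp only [innerArg, outerArg, charArg, e₁, e₂, e₃, e₄, e₅, Finset.mem_insert,
    Finset.mem_singleton, Fin.reduceEq, or_false, or_true, or_self, if_true, if_false,
    Matrix.cons_val, Units.val_neg, Units.val_one, zpow_neg, zpow_one]
  all_goals first
  | ring1
  | congr 1
    apply Additive.ofMul.injective
    simp only [h.inner, h.left, h.right, h.one, h.three, ofMul_mul, ofMul_div, ofMul_inv, ofMul_one]
    abel

/-- The reflection i ↦ 4 - i preserves the five-term relation. It turns the pair 03 into 14 and
exchanges the two external variables, whence the reversed families and the swap. -/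
theorem kernelConcentrates_pentagon_one_four (h : AnglePattern A C) (s : ℤˣ)
    (h₃₄ : a 4 = a 3 + a 2) (h₀₁ : a 1 = a 2 + a 0) (h₀₄ : c 1 = c 3 + c 2)
    (h₁₂ : c 0 = a 4 + c 1) (h₂₃ : c 4 = c 3 + a 0) :
    KernelConcentrates (unitsMeasure μ)
      (fun x y z => (innerArg A C {1, 4}ᶜ (x / z) z y 0) ^ (s : ℤ))
      (fun x y z => (innerArg A C {1, 4}ᶜ (x / z) z y 2) ^ (s : ℤ))
      (fun x y z => (innerArg A C {1, 4}ᶜ (x / z) z y 1 / innerArg A C {1, 4}ᶜ (x / z) z y 0) ^ (s : ℤ))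
      (fun x y z => sideModulus a c A {1, 4}ᶜ (x / z) z y)
      (fun x y => (outerArg A C {1, 4} (x / 1) 1 y 0) ^ (s : ℤ))
      (fun x y => (outerArg A C {1, 4} (x / 1) 1 y 2) ^ (s : ℤ))
      (fun x y => sideModulus a c A {1, 4} (x / 1) 1 y) := by
  obtain ⟨e₁, e₂, e₃, e₄, e₅⟩ :
      (∀ x y z, A 0 * tetUnits (x / z) z y 0 = (A 1 * x) * ((A 2)⁻¹ * z⁻¹)) ∧
      (∀ x y z, A 2 * tetUnits (x / z) z y 2 = ((A 2)⁻¹ * z⁻¹)⁻¹) ∧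
      (∀ x y z, A 3 * tetUnits (x / z) z y 3 = (((A 4)⁻¹ * y⁻¹) * ((A 2)⁻¹ * z⁻¹))⁻¹) ∧
      (∀ x y z, A 1 * tetUnits (x / z) z y 1 = (A 1 * x)) ∧
      (∀ x y z, A 4 * tetUnits (x / z) z y 4 = ((A 4)⁻¹ * y⁻¹)⁻¹) := by
    refine ⟨?_, ?_, ?_, ?_, ?_⟩ <;> intro x y z <;> apply Additive.ofMul.injective <;>
      simp only [tetUnits, h.one, h.three, Matrix.cons_val, ofMul_mul, ofMul_div, ofMul_inv] <;> abel
  have hI : ({1, 4}ᶜ : Finset (Fin 5)) = {0, 2, 3} := by decide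
  rw [hI]
  refine (kernelConcentrates_zero_three (a := ![a 4, a 3, a 2, a 1, a 0]) (c := ![c 4, c 3, c 2, c 1, c 0]) (μ := μ)
    h₃₄ h₀₁ h₀₄ h₁₂ h₂₃).swap.substitution
    (1 / (A 4 * C 0)) (C 3 / A 0) (A 1) ((A 4)⁻¹) ((A 2)⁻¹) 1 (-1) (-1) s s
    (fun x y z => ?_) (fun x y z => ?_) (fun x y z => ?_) (fun x y z => ?_) (fun x y => ?_)
    (fun x y => ?_) (fun x y => ?_)
  on_goal 7 => rw [sideModulus, Finset.prod_pair (by decide), e₄, e₅]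
  on_goal 4 => rw [sideModulus, Finset.prod_insert (by decide), Finset.prod_pair (by decide), e₁, e₂, e₃]
  all_goals simp only [innerArg, outerArg, charArg, e₁, e₂, e₃, e₄, e₅, Finset.mem_insert,
    Finset.mem_singleton, Fin.reduceEq, or_false, or_true, or_self, if_true, if_false,
    Matrix.cons_val, Units.val_neg, Units.val_one, zpow_neg, zpow_one]
  all_goals first
  | ring1
  | congr 1
    apply Additive.ofMul.injective
    simp only [h.inner, h.left, h.right, h.one, h.three, ofMul_mul, ofMul_div, ofMul_inv, ofMul_one]
    abel

/-- Reflection of the pair 12. -/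
theorem kernelConcentrates_pentagon_two_three (h : AnglePattern A C) (s : ℤˣ)
    (h₃₄ : a 4 = a 3 + a 2) (h₀₁ : a 2 = a 1 + a 0) (h₀₄ : c 1 = c 3 + c 2)
    (h₁₂ : a 4 + c 1 + c 0 = 2) (h₂₃ : c 3 = c 4 + a 0) :
    KernelConcentrates (unitsMeasure μ)
      (fun x y z => (innerArg A C {2, 3}ᶜ z x (y / x) 1 / innerArg A C {2, 3}ᶜ z x (y / x) 2) ^ (s : ℤ))
      (fun x y z => (innerArg A C {2, 3}ᶜ z x (y / x) 2) ^ (s : ℤ))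
      (fun x y z => (innerArg A C {2, 3}ᶜ z x (y / x) 0) ^ (s : ℤ))
      (fun x y z => sideModulus a c A {2, 3}ᶜ z x (y / x))
      (fun x y => (outerArg A C {2, 3} 1 x (y / x) 1 / outerArg A C {2, 3} 1 x (y / x) 2) ^ (s : ℤ))
      (fun x y => (outerArg A C {2, 3} 1 x (y / x) 2) ^ (s : ℤ))
      (fun x y => sideModulus a c A {2, 3} 1 x (y / x)) := by
  obtain ⟨e₁, e₂, e₃, e₄, e₅⟩ :
      (∀ x y z, A 0 * tetUnits z x (y / x) 0 = (A 0 * z)) ∧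
      (∀ x y z, A 1 * tetUnits z x (y / x) 1 = (A 2 * x) * (A 0 * z)) ∧
      (∀ x y z, A 4 * tetUnits z x (y / x) 4 = (A 3 * y) / (A 2 * x)) ∧
      (∀ x y z, A 2 * tetUnits z x (y / x) 2 = (A 2 * x)) ∧
      (∀ x y z, A 3 * tetUnits z x (y / x) 3 = (A 3 * y)) := by
    refine ⟨?_, ?_, ?_, ?_, ?_⟩ <;> intro x y z <;> apply Additive.ofMul.injective <;>
      simp only [tetUnits, h.one, h.three, Matrix.cons_val, ofMul_mul, ofMul_div, ofMul_inv] <;> abel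
  have hI : ({2, 3}ᶜ : Finset (Fin 5)) = {0, 1, 4} := by decide
  rw [hI]
  refine (kernelConcentrates_one_two (a := ![a 4, a 3, a 2, a 1, a 0]) (c := ![c 4, c 3, c 2, c 1, c 0]) (μ := μ)
    h₃₄ h₀₁ h₀₄ h₁₂ h₂₃).swap.substitution
    (A 0 * C 1 * C 4) (1 / (A 0 * C 4)) (A 2) (A 3) (A 0) 1 1 1 s s
    (fun x y z => ?_) (fun x y z => ?_) (fun x y z => ?_) (fun x y z => ?_) (fun x y => ?_)
    (fun x y => ?_) (fun x y => ?_)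
  on_goal 7 => rw [sideModulus, Finset.prod_pair (by decide), e₄, e₅]
  on_goal 4 => rw [sideModulus, Finset.prod_insert (by decide), Finset.prod_pair (by decide), e₁, e₂, e₃]
  all_goals simp only [innerArg, outerArg, charArg, e₁, e₂, e₃, e₄, e₅, Finset.mem_insert,
    Finset.mem_singleton, Fin.reduceEq, or_false, or_true, or_self, if_true, if_false,
    Matrix.cons_val, Units.val_neg, Units.val_one, zpow_neg, zpow_one]
  all_goals first
  | ring1
  | congr 1
    apply Additive.ofMul.injective
    simp only [h.inner, h.left, h.right, h.one, h.three, ofMul_mul, ofMul_div, ofMul_inv, ofMul_one]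
    abel

/-- Reflection of the pair 02. -/
theorem kernelConcentrates_pentagon_two_four (h : AnglePattern A C) (s : ℤˣ)
    (h₃₄ : a 3 = a 4 + a 2) (h₀₁ : a 2 = a 1 + a 0) (h₀₄ : c 2 = c 3 + c 1)
    (h₁₂ : a 4 = c 1 + c 0) (h₂₃ : c 4 = c 3 + a 0) :
    KernelConcentrates (unitsMeasure μ)
      (fun x y z => (innerArg A C {2, 4}ᶜ z x y 1) ^ (s : ℤ))
      (fun x y z => (innerArg A C {2, 4}ᶜ z x y 2) ^ (s : ℤ))
      (fun x y z => (innerArg A C {2, 4}ᶜ z x y 0) ^ (s : ℤ))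
      (fun x y z => sideModulus a c A {2, 4}ᶜ z x y)
      (fun x y => (outerArg A C {2, 4} 1 x y 1) ^ (s : ℤ))
      (fun x y => (outerArg A C {2, 4} 1 x y 2) ^ (s : ℤ))
      (fun x y => sideModulus a c A {2, 4} 1 x y) := by
  obtain ⟨e₁, e₂, e₃, e₄, e₅⟩ :
      (∀ x y z, A 0 * tetUnits z x y 0 = ((A 0)⁻¹ * z⁻¹)⁻¹) ∧
      (∀ x y z, A 1 * tetUnits z x y 1 = (A 2 * x) / ((A 0)⁻¹ * z⁻¹)) ∧
      (∀ x y z, A 3 * tetUnits z x y 3 = (A 4 * y) * (A 2 * x)) ∧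
      (∀ x y z, A 2 * tetUnits z x y 2 = (A 2 * x)) ∧
      (∀ x y z, A 4 * tetUnits z x y 4 = (A 4 * y)) := by
    refine ⟨?_, ?_, ?_, ?_, ?_⟩ <;> intro x y z <;> apply Additive.ofMul.injective <;>
      simp only [tetUnits, h.one, h.three, Matrix.cons_val, ofMul_mul, ofMul_div, ofMul_inv] <;> abel
  have hI : ({2, 4}ᶜ : Finset (Fin 5)) = {0, 1, 3} := by decide
  rw [hI]
  refine (kernelConcentrates_zero_two (a := ![a 4, a 3, a 2, a 1, a 0]) (c := ![c 4, c 3, c 2, c 1, c 0]) (μ := μ)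
    h₃₄ h₀₁ h₀₄ h₁₂ h₂₃).swap.substitution
    (C 3 * C 1) (C 3 / A 0) (A 2) (A 4) ((A 0)⁻¹) 1 1 (-1) s s
    (fun x y z => ?_) (fun x y z => ?_) (fun x y z => ?_) (fun x y z => ?_) (fun x y => ?_)
    (fun x y => ?_) (fun x y => ?_)
  on_goal 7 => rw [sideModulus, Finset.prod_pair (by decide), e₄, e₅]
  on_goal 4 => rw [sideModulus, Finset.prod_insert (by decide), Finset.prod_pair (by decide), e₁, e₂, e₃]
  all_goals simp only [innerArg, outerArg, charArg, e₁, e₂, e₃, e₄, e₅, Finset.mem_insert,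
    Finset.mem_singleton, Fin.reduceEq, or_false, or_true, or_self, if_true, if_false,
    Matrix.cons_val, Units.val_neg, Units.val_one, zpow_neg, zpow_one]
  all_goals first
  | ring1
  | congr 1
    apply Additive.ofMul.injective
    simp only [h.inner, h.left, h.right, h.one, h.three, ofMul_mul, ofMul_div, ofMul_inv, ofMul_one]
    abel

end Pentagons

/-! ## Angles and signs of an ordered pentagon -/

section Angles

variable {F : Type*} [NontriviallyNormedField F]

/-- The type of the edge `jk` of `T i`: `0`, `1`, `2` if its angle is `a`, `c`, `b`. -/
def edgeType (i j k : Fin 5) : Fin 3 :=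
  let e : Finset ℕ := {position i j, position i k}
  if e = {0, 1} ∨ e = {2, 3} then 0 else if e = {0, 3} ∨ e = {1, 2} then 1 else 2

theorem edgeAngle_eq (a c : Fin 5 → AngleGroup F) (i j k : Fin 5) :
    edgeAngle a c i j k = ![a i, c i, thirdAngle (a i) (c i)] (edgeType i j k) := by
  unfold edgeAngle edgeType
  dsimp only
  split_ifs <;> rfl

theorem image_edgeType : ∀ i j : Fin 5, i ≠ j →
    (Finset.univ \ {i, j}).image (edgeType i j) = Finset.univ := by decide

/-- The three edges of a tetrahedron at a vertex have the three different types, so their angles are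
a, b, c in some order. -/
theorem sum_edgeAngle_vertex (a c : Fin 5 → AngleGroup F) {i j : Fin 5} (h : i ≠ j) :
    ∑ k ∈ Finset.univ \ {i, j}, edgeAngle a c i j k = halfTurn F := by
  have hc : (Finset.univ \ {i, j}).card = 3 := by
    rw [Finset.card_sdiff_of_subset (Finset.subset_univ _), Finset.card_pair h]
    rfl
  have hinj : Set.InjOn (edgeType i j) (Finset.univ \ {i, j} : Finset (Fin 5)) :=
    Finset.card_image_iff.1 (by rw [image_edgeType i j h, hc]; rfl)
  simp only [edgeAngle_eq]
  rw [← Finset.sum_image (g := edgeType i j)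
    (f := fun t => ![a i, c i, thirdAngle (a i) (c i)] t) hinj, image_edgeType i j h,
    Fin.sum_univ_three]
  simp only [Matrix.cons_val, thirdAngle]
  abel

/-- The sign of a side in the matching conditions. -/
def sideSign (I : Finset (Fin 5)) (i : Fin 5) : ℤ := if i ∈ I then 1 else -1

/-- The relation at the exceptional edge jk follows from the other nine. Sum the signed angles over
all edges at j: every tetrahedron containing j contributes its sign times ϖ, and these signs, one
positive and three negative, add up to -2. All edges except jk contribute zero. -/
theorem sum_sideSign_edgeAngle {a c : Fin 5 → AngleGroup F} {I : Finset (Fin 5)}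
    (h : ∀ j k : Fin 5, j ≠ k → ({j, k} : Finset (Fin 5)) ≠ I →
      ∑ i ∈ I \ {j, k}, edgeAngle a c i j k = ∑ i ∈ Iᶜ \ {j, k}, edgeAngle a c i j k)
    {j k : Fin 5} (hjk : j ≠ k) :
    ∑ i ∈ Finset.univ \ {j, k}, sideSign I i • edgeAngle a c i j k =
      if ({j, k} : Finset (Fin 5)) = I then (-2 : ℤ) • halfTurn F else 0 := by
  have key : ∀ j k : Fin 5, j ≠ k → ({j, k} : Finset (Fin 5)) ≠ I →
      ∑ i ∈ Finset.univ \ {j, k}, sideSign I i • edgeAngle a c i j k = 0 := by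
    intro j k hjk hne
    have hu : (Finset.univ \ {j, k} : Finset (Fin 5)) = (I \ {j, k}) ∪ (Iᶜ \ {j, k}) := by
      rw [← Finset.union_sdiff_distrib, Finset.union_compl]
    have hd : Disjoint (I \ {j, k}) (Iᶜ \ {j, k}) :=
      disjoint_compl_right.mono Finset.sdiff_subset Finset.sdiff_subset
    rw [hu, Finset.sum_union hd]
    have e₁ : ∑ i ∈ I \ {j, k}, sideSign I i • edgeAngle a c i j k =
        ∑ i ∈ I \ {j, k}, edgeAngle a c i j k := by
      refine Finset.sum_congr rfl fun i hi => ?_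
      rw [sideSign, if_pos (Finset.mem_sdiff.1 hi).1, one_smul]
    have e₂ : ∑ i ∈ Iᶜ \ {j, k}, sideSign I i • edgeAngle a c i j k =
        -∑ i ∈ Iᶜ \ {j, k}, edgeAngle a c i j k := by
      rw [← Finset.sum_neg_distrib]
      refine Finset.sum_congr rfl fun i hi => ?_
      rw [sideSign, if_neg (Finset.mem_compl.1 (Finset.mem_sdiff.1 hi).1), neg_smul, one_smul]
    rw [e₁, e₂, h j k hjk hne, add_neg_cancel]
  split_ifs with hI'
  · have e₁ : ∑ l ∈ Finset.univ.erase j, ∑ i ∈ Finset.univ \ {j, l},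
        sideSign I i • edgeAngle a c i j l =
        ∑ i ∈ Finset.univ.erase j, ∑ l ∈ Finset.univ \ {i, j},
          sideSign I i • edgeAngle a c i j l := by
      refine Finset.sum_comm' fun l i => ?_
      simp only [Finset.mem_erase, Finset.mem_sdiff, Finset.mem_univ, Finset.mem_insert,
        Finset.mem_singleton, true_and, and_true, not_or]
      tauto
    have e₂ : ∀ i ∈ Finset.univ.erase j, ∑ l ∈ Finset.univ \ {i, j},
        sideSign I i • edgeAngle a c i j l = sideSign I i • halfTurn F := fun i hi => by
      exact (map_sum (zsmulAddGroupHom (α := AngleGroup F) (sideSign I i)) _ _).symm.trans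
        (congrArg (sideSign I i • ·) (sum_edgeAngle_vertex a c (Finset.ne_of_mem_erase hi)))
    have e₃ : ∑ i ∈ Finset.univ.erase j, sideSign I i • halfTurn F =
        (∑ i ∈ Finset.univ.erase j, sideSign I i) • halfTurn F :=
      (map_sum (zmultiplesHom (AngleGroup F) (halfTurn F)) _ _).symm
    have e₄ : ∀ j k : Fin 5, j ≠ k →
        ∑ i ∈ Finset.univ.erase j, sideSign {j, k} i = -2 := by decide
    rw [Finset.sum_congr rfl e₂, e₃, ← hI', e₄ j k hjk, hI',
      Finset.sum_eq_single_of_mem k (by simp [hjk.symm]) fun l hl hlk =>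
        key j l (Finset.ne_of_mem_erase hl).symm fun h' => hlk ?_] at e₁
    · exact e₁
    · have h₁ : l ∈ ({j, k} : Finset (Fin 5)) := by
        rw [hI', ← h']
        simp
      simpa [Finset.ne_of_mem_erase hl] using h₁
  · exact key j k hjk hI'

/-- The index σ⁻¹(i) is odd exactly when i belongs to I. The signs thus depend on σ only through I
and the sign of σ, and alternate with i on either side. -/
theorem tetSign_eq (σ : Equiv.Perm (Fin 5)) (i : Fin 5) : tetSign σ i =
    -(Equiv.Perm.sign σ * (-1) ^ (i : ℕ) * if i ∈ twoSide σ then 1 else -1) := by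
  have h : i ∈ twoSide σ ↔ σ.symm i = 1 ∨ σ.symm i = 3 := by
    simp only [twoSide, Finset.mem_insert, Finset.mem_singleton, Equiv.symm_apply_eq]
  have hk : ∀ k : Fin 5, (-1 : ℤˣ) ^ (k : ℕ) = -if k = 1 ∨ k = 3 then 1 else -1 := by decide
  rw [tetSign, pow_add, hk]
  simp only [h]
  split_ifs <;> simp

theorem twoSide_eq (σ : Equiv.Perm (Fin 5)) : twoSide σ = {min (σ 1) (σ 3), max (σ 1) (σ 3)} := by
  rw [twoSide]
  rcases le_total (σ 1) (σ 3) with h | h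
  · rw [min_eq_left h, max_eq_right h]
  · rw [min_eq_right h, max_eq_left h, Finset.pair_comm]

variable [ProperSpace F]

/-- On the excluded set äx = 1 both sides vanish, the right one through the default value of
`weight`. -/
theorem psi_eq (a c : AngleGroup F) (p : GaussGroup F) : Psi a c p =
    (((p.1 (oneSub (a.2.toMul * p.2) * c.2.toMul))⁻¹ : Circle) : ℂ) *
      (unitWeight a.1 c.1 (a.2.toMul * p.2) : ℂ) := by
  rw [Psi, unitWeight]
  split_ifs with h
  · rw [weight, if_pos (Or.inr (sub_eq_zero.1 h).symm), Complex.ofReal_zero, mul_zero]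
  · have h₁ : oneSub (a.2.toMul * p.2) = Units.mk0 _ h := Units.ext (coe_toUnit h)
    rw [h₁, weight, if_neg (not_or.2 ⟨Units.ne_zero _, fun e => h (by rw [e, sub_self])⟩)]
    congr 2
    rw [div_eq_mul_inv, ← Real.rpow_neg (modulus_nonneg _), neg_sub,
      Real.rpow_def_of_pos (modulus_pos (Units.ne_zero _)), Real.rpow_def_of_pos (modulus_pos h),
      ← Real.exp_add, mul_comm c.1, mul_comm (a.1 - 1)]
    rfl

/-- Complex conjugation inverts the value of the character and the bar inverts the B-components of
the angles, so a single formula with powers of ε covers both signs. -/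
theorem psiSign_eq (ε : ℤˣ) (a c : AngleGroup F) (p : GaussGroup F) : PsiSign ε a c p =
    ((p.1 (oneSub (a.2.toMul ^ (ε : ℤ) * p.2) * c.2.toMul ^ (ε : ℤ)) ^ (-(ε : ℤ)) : Circle) : ℂ) *
      (unitWeight a.1 c.1 (a.2.toMul ^ (ε : ℤ) * p.2) : ℂ) := by
  rcases Int.units_eq_one_or ε with rfl | rfl
  · rw [PsiSign, if_pos rfl, psi_eq]
    simp only [Units.val_one, zpow_one, zpow_neg]
  · rw [PsiSign, if_neg (by decide), PsiBar, psi_eq, map_mul, Complex.conj_ofReal,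
      ← Circle.coe_inv_eq_conj, inv_inv]
    simp only [Units.val_neg, Units.val_one, zpow_one, zpow_neg, neg_neg]
    rfl

end Angles

/-! ### Relations between the angles -/

section Relations

variable {F : Type*} [NontriviallyNormedField F]

/-- The edges 34, 01, 04, 12, 23 are those at which no angle b occurs. -/
theorem signed_relations {a c : Fin 5 → AngleGroup F} {I : Finset (Fin 5)}
    (h : ∀ j k : Fin 5, j ≠ k → ({j, k} : Finset (Fin 5)) ≠ I →
      ∑ i ∈ I \ {j, k}, edgeAngle a c i j k = ∑ i ∈ Iᶜ \ {j, k}, edgeAngle a c i j k) :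
    (sideSign I 0 • a 0 + (sideSign I 1 • a 1 + sideSign I 2 • a 2) =
      if ({3, 4} : Finset (Fin 5)) = I then (-2 : ℤ) • halfTurn F else 0) ∧
    (sideSign I 2 • a 2 + (sideSign I 3 • a 3 + sideSign I 4 • a 4) =
      if ({0, 1} : Finset (Fin 5)) = I then (-2 : ℤ) • halfTurn F else 0) ∧
    (sideSign I 1 • c 1 + (sideSign I 2 • c 2 + sideSign I 3 • c 3) =
      if ({0, 4} : Finset (Fin 5)) = I then (-2 : ℤ) • halfTurn F else 0) ∧
    (sideSign I 0 • a 0 + (sideSign I 3 • c 3 + sideSign I 4 • c 4) =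
      if ({1, 2} : Finset (Fin 5)) = I then (-2 : ℤ) • halfTurn F else 0) ∧
    (sideSign I 0 • c 0 + (sideSign I 1 • c 1 + sideSign I 4 • a 4) =
      if ({2, 3} : Finset (Fin 5)) = I then (-2 : ℤ) • halfTurn F else 0) := by
  have key : ∀ {j k : Fin 5} (_ : j ≠ k) {l m n : Fin 5} {p q r : Fin 3}
      (_ : (Finset.univ \ {j, k} : Finset (Fin 5)) = {l, m, n}) (_ : l ∉ ({m, n} : Finset (Fin 5)))
      (_ : m ≠ n) (_ : edgeType l j k = p) (_ : edgeType m j k = q) (_ : edgeType n j k = r),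
      sideSign I l • ![a l, c l, thirdAngle (a l) (c l)] p +
        (sideSign I m • ![a m, c m, thirdAngle (a m) (c m)] q +
          sideSign I n • ![a n, c n, thirdAngle (a n) (c n)] r) =
      if ({j, k} : Finset (Fin 5)) = I then (-2 : ℤ) • halfTurn F else 0 := by
    intro j k hjk l m n p q r hu hl hm hp hq hr
    have e := sum_sideSign_edgeAngle h hjk
    rw [hu, Finset.sum_insert hl, Finset.sum_pair hm] at e
    simpa only [edgeAngle_eq, hp, hq, hr] using e
  exact ⟨key (j := 3) (k := 4) (l := 0) (m := 1) (n := 2) (p := 0) (q := 0) (r := 0)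
      (by decide) (by decide) (by decide) (by decide) (by decide) (by decide) (by decide),
    key (j := 0) (k := 1) (l := 2) (m := 3) (n := 4) (p := 0) (q := 0) (r := 0)
      (by decide) (by decide) (by decide) (by decide) (by decide) (by decide) (by decide),
    key (j := 0) (k := 4) (l := 1) (m := 2) (n := 3) (p := 1) (q := 1) (r := 1)
      (by decide) (by decide) (by decide) (by decide) (by decide) (by decide) (by decide),
    key (j := 1) (k := 2) (l := 0) (m := 3) (n := 4) (p := 0) (q := 1) (r := 1)
      (by decide) (by decide) (by decide) (by decide) (by decide) (by decide) (by decide),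
    key (j := 2) (k := 3) (l := 0) (m := 1) (n := 4) (p := 1) (q := 1) (r := 0)
      (by decide) (by decide) (by decide) (by decide) (by decide) (by decide) (by decide)⟩

/-- The B-component of ϖ is -1, so that of 2ϖ is trivial and the exceptional edge becomes invisible.
Since ε_i is s(-1)^i times the side sign, the five signed relations acquire the same form for every
I. -/
theorem anglePattern_of_match {a c : Fin 5 → AngleGroup F} {I : Finset (Fin 5)} {ε : Fin 5 → ℤˣ}
    {s : ℤ} (h : ∀ j k : Fin 5, j ≠ k → ({j, k} : Finset (Fin 5)) ≠ I →
      ∑ i ∈ I \ {j, k}, edgeAngle a c i j k = ∑ i ∈ Iᶜ \ {j, k}, edgeAngle a c i j k)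
    (hε : ∀ i, (ε i : ℤ) = s * (-1) ^ (i : ℕ) * sideSign I i) :
    AnglePattern (fun i => (a i).2.toMul ^ (ε i : ℤ)) (fun i => (c i).2.toMul ^ (ε i : ℤ)) := by
  have h0 : ∀ p : Prop, ∀ [Decidable p],
      (if p then (-2 : ℤ) • halfTurn F else 0).2 = 0 := by
    intro p _
    split_ifs
    · apply Additive.toMul.injective
      simp [halfTurn]
    · rfl
  have key : ∀ (s k l m : ℤ) (x y z : Fˣ), x ^ k * (y ^ l * z ^ m) = 1 →
      y ^ (-(s * l)) = x ^ (s * k) * z ^ (s * m) := by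
    intro s k l m x y z e
    rw [zpow_neg, inv_eq_iff_mul_eq_one, zpow_mul', zpow_mul', zpow_mul', ← mul_zpow, ← mul_zpow,
      mul_left_comm, e, one_zpow]
  obtain ⟨h₁, h₂, h₃, h₄, h₅⟩ := signed_relations h
  have f₁ := congrArg Additive.toMul ((congrArg Prod.snd h₁).trans (h0 _))
  have f₂ := congrArg Additive.toMul ((congrArg Prod.snd h₂).trans (h0 _))
  have f₃ := congrArg Additive.toMul ((congrArg Prod.snd h₃).trans (h0 _))
  have f₄ := congrArg Additive.toMul ((congrArg Prod.snd h₄).trans (h0 _))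
  have f₅ := congrArg Additive.toMul ((congrArg Prod.snd h₅).trans (h0 _))
  have e₀ : (ε 0 : ℤ) = s * sideSign I 0 := by rw [hε]; simp
  have e₁ : (ε 1 : ℤ) = -(s * sideSign I 1) := by rw [hε]; simp
  have e₂ : (ε 2 : ℤ) = s * sideSign I 2 := by rw [hε]; simp
  have e₃ : (ε 3 : ℤ) = -(s * sideSign I 3) := by rw [hε, show ((3 : Fin 5) : ℕ) = 3 from rfl]; ring
  have e₄ : (ε 4 : ℤ) = s * sideSign I 4 := by rw [hε, show ((4 : Fin 5) : ℕ) = 4 from rfl]; ring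
  constructor <;> simp only [e₀, e₁, e₂, e₃, e₄]
  · exact key s _ _ _ _ _ _ f₁
  · exact key s _ _ _ _ _ _ f₂
  -- The factor solved for has index 2 here, not an odd one, so the exponent is reversed.
  · simpa only [neg_mul, neg_neg] using key (-s) _ _ _ _ _ _ f₃
  · exact key s _ _ _ _ _ _ f₅
  · exact key s _ _ _ _ _ _ f₄

end Relations

/-! ### Collecting the characters of a side -/

section Sides

theorem coe_circle_prod {ι : Type*} (S : Finset ι) (f : ι → Circle) :
    ((∏ i ∈ S, f i : Circle) : ℂ) = ∏ i ∈ S, (f i : ℂ) := map_prod Circle.coeHom f S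

variable {F : Type*} [NontriviallyNormedField F] [ProperSpace F] {a c : Fin 5 → AngleGroup F}
  {ε : Fin 5 → ℤˣ} {S : Finset (Fin 5)} {s : ℤ}

theorem prod_psiSign_eq (z : Fin 5 → GaussGroup F) (z₀ z₂ z₄ : GaussGroup F)
    (hz : z = tetVars z₀ z₂ z₄) (r : Fin 5 → ℤ) (hr : ∀ i ∈ S, -(ε i : ℤ) = r i) :
    ∏ i ∈ S, PsiSign (ε i) (a i) (c i) (z i) =
      ((∏ i, (z i).1 (charArg (fun i => (a i).2.toMul ^ (ε i : ℤ))
        (fun i => (c i).2.toMul ^ (ε i : ℤ)) S z₀.2 z₂.2 z₄.2 i) ^ r i : Circle) : ℂ) *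
      (sideModulus (fun i => (a i).1) (fun i => (c i).1) (fun i => (a i).2.toMul ^ (ε i : ℤ)) S
        z₀.2 z₂.2 z₄.2 : ℂ) := by
  have hu : ∀ i, (z i).2 = tetUnits z₀.2 z₂.2 z₄.2 i := by
    intro i
    rw [hz]
    fin_cases i <;> rfl
  have e : ∏ i, (z i).1 (charArg (fun i => (a i).2.toMul ^ (ε i : ℤ))
        (fun i => (c i).2.toMul ^ (ε i : ℤ)) S z₀.2 z₂.2 z₄.2 i) ^ r i =
      ∏ i ∈ S, (z i).1 (oneSub ((a i).2.toMul ^ (ε i : ℤ) * (z i).2) *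
        (c i).2.toMul ^ (ε i : ℤ)) ^ (-(ε i : ℤ)) := by
    rw [← Finset.prod_subset (Finset.subset_univ S)]
    · refine Finset.prod_congr rfl fun i hi => ?_
      rw [charArg, if_pos hi, hr i hi, hu]
    · intro i _ hi
      rw [charArg, if_neg hi, map_one, one_zpow]
  rw [e, sideModulus, Complex.ofReal_prod, coe_circle_prod, ← Finset.prod_mul_distrib]
  refine Finset.prod_congr rfl fun i _ => ?_
  rw [psiSign_eq, hu]

/-- On this side ε_i = s(-1)^i, so s is a common exponent of the phase and of all characters. The
relations z₁ = z₀ + z₂ and z₃ = z₂ + z₄ distribute the characters of T₁ and T₃ among those of z₀,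
z₂, z₄. -/
theorem pairing_mul_prod_psiSign (z₀ z₂ z₄ : GaussGroup F)
    (hε : ∀ i ∈ S, (ε i : ℤ) = s * (-1) ^ (i : ℕ)) :
    ((pairing z₀ z₄ ^ s : Circle) : ℂ) *
      ∏ i ∈ S, PsiSign (ε i) (a i) (c i) (tetVars z₀ z₂ z₄ i) =
    (((z₀.1 (innerArg (fun i => (a i).2.toMul ^ (ε i : ℤ)) (fun i => (c i).2.toMul ^ (ε i : ℤ)) S
        z₀.2 z₂.2 z₄.2 0) *
      z₂.1 (innerArg (fun i => (a i).2.toMul ^ (ε i : ℤ)) (fun i => (c i).2.toMul ^ (ε i : ℤ)) S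
        z₀.2 z₂.2 z₄.2 1) *
      z₄.1 (innerArg (fun i => (a i).2.toMul ^ (ε i : ℤ)) (fun i => (c i).2.toMul ^ (ε i : ℤ)) S
        z₀.2 z₂.2 z₄.2 2)) ^ s : Circle) : ℂ) *
      (sideModulus (fun i => (a i).1) (fun i => (c i).1) (fun i => (a i).2.toMul ^ (ε i : ℤ)) S
        z₀.2 z₂.2 z₄.2 : ℂ) := by
  rw [prod_psiSign_eq _ z₀ z₂ z₄ rfl (fun i => s * -(-1) ^ (i : ℕ))
    (fun i hi => by rw [hε i hi, mul_neg]), ← mul_assoc, ← Circle.coe_mul]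
  congr 2
  simp only [zpow_mul', Finset.prod_zpow, ← mul_zpow]
  congr 1
  have hd : ∀ (p q : GaussGroup F) (t : Fˣ), (p * q).1 t = p.1 t * q.1 t := fun _ _ _ => rfl
  simp [Fin.prod_univ_five]
  simp only [innerArg, tetVars, pairing, Matrix.cons_val, hd, map_mul, map_div]
  apply Additive.ofMul.injective
  simp only [ofMul_mul, ofMul_div, ofMul_inv]
  abel

theorem prod_psiSign_outer (z₀ z₂ z₄ : GaussGroup F)
    (hε : ∀ i ∈ S, (ε i : ℤ) = -s * (-1) ^ (i : ℕ)) :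
    ∏ i ∈ S, PsiSign (ε i) (a i) (c i) (tetVars z₀ z₂ z₄ i) =
    (((z₀.1 (outerArg (fun i => (a i).2.toMul ^ (ε i : ℤ)) (fun i => (c i).2.toMul ^ (ε i : ℤ)) S
        z₀.2 z₂.2 z₄.2 0) *
      z₂.1 (outerArg (fun i => (a i).2.toMul ^ (ε i : ℤ)) (fun i => (c i).2.toMul ^ (ε i : ℤ)) S
        z₀.2 z₂.2 z₄.2 1) *
      z₄.1 (outerArg (fun i => (a i).2.toMul ^ (ε i : ℤ)) (fun i => (c i).2.toMul ^ (ε i : ℤ)) S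
        z₀.2 z₂.2 z₄.2 2)) ^ s : Circle) : ℂ) *
      (sideModulus (fun i => (a i).1) (fun i => (c i).1) (fun i => (a i).2.toMul ^ (ε i : ℤ)) S
        z₀.2 z₂.2 z₄.2 : ℂ) := by
  rw [prod_psiSign_eq _ z₀ z₂ z₄ rfl (fun i => s * (-1) ^ (i : ℕ))
    (fun i hi => by rw [hε i hi, neg_mul, neg_neg])]
  congr 2
  simp only [zpow_mul', Finset.prod_zpow]
  congr 1
  have hd : ∀ (p q : GaussGroup F) (t : Fˣ), (p * q).1 t = p.1 t * q.1 t := fun _ _ _ => rfl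
  simp [Fin.prod_univ_five]
  simp only [outerArg, tetVars, Matrix.cons_val, hd, map_mul, map_div]
  apply Additive.ofMul.injective
  simp only [ofMul_mul, ofMul_div, ofMul_inv]
  abel

end Sides

/-! ### Assembly of the pentagon identities -/

section Assembly

variable {F : Type*} [NontriviallyNormedField F]

theorem real_relations {a c : Fin 5 → AngleGroup F} {I : Finset (Fin 5)}
    (h : ∀ j k : Fin 5, j ≠ k → ({j, k} : Finset (Fin 5)) ≠ I →
      ∑ i ∈ I \ {j, k}, edgeAngle a c i j k = ∑ i ∈ Iᶜ \ {j, k}, edgeAngle a c i j k) :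
    (sideSign I 0 * (a 0).1 + (sideSign I 1 * (a 1).1 + sideSign I 2 * (a 2).1) =
      if ({3, 4} : Finset (Fin 5)) = I then -2 else 0) ∧
    (sideSign I 2 * (a 2).1 + (sideSign I 3 * (a 3).1 + sideSign I 4 * (a 4).1) =
      if ({0, 1} : Finset (Fin 5)) = I then -2 else 0) ∧
    (sideSign I 1 * (c 1).1 + (sideSign I 2 * (c 2).1 + sideSign I 3 * (c 3).1) =
      if ({0, 4} : Finset (Fin 5)) = I then -2 else 0) ∧
    (sideSign I 0 * (a 0).1 + (sideSign I 3 * (c 3).1 + sideSign I 4 * (c 4).1) =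
      if ({1, 2} : Finset (Fin 5)) = I then -2 else 0) ∧
    (sideSign I 0 * (c 0).1 + (sideSign I 1 * (c 1).1 + sideSign I 4 * (a 4).1) =
      if ({2, 3} : Finset (Fin 5)) = I then -2 else 0) := by
  have h0 : ∀ p : Prop, ∀ [Decidable p],
      (if p then (-2 : ℤ) • halfTurn F else 0).1 = if p then -2 else 0 := by
    intro p _
    split_ifs
    · simp [halfTurn]
    · rfl
  obtain ⟨h₁, h₂, h₃, h₄, h₅⟩ := signed_relations h
  have f₁ := (congrArg Prod.fst h₁).trans (h0 _)
  have f₂ := (congrArg Prod.fst h₂).trans (h0 _)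
  have f₃ := (congrArg Prod.fst h₃).trans (h0 _)
  have f₄ := (congrArg Prod.fst h₄).trans (h0 _)
  have f₅ := (congrArg Prod.fst h₅).trans (h0 _)
  simp only [Prod.fst_add, Prod.smul_fst, zsmul_eq_mul] at f₁ f₂ f₃ f₄ f₅
  exact ⟨f₁, f₂, f₃, f₄, f₅⟩

variable [ProperSpace F] [MeasurableSpace F] [BorelSpace F]

theorem measurable_charArg {β : Type*} [MeasurableSpace β] (A C : Fin 5 → Fˣ)
    (S : Finset (Fin 5)) {x₀ x₂ x₄ : β → Fˣ} (h₀ : Measurable x₀) (h₂ : Measurable x₂)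
    (h₄ : Measurable x₄) (i : Fin 5) :
    Measurable fun r => charArg A C S (x₀ r) (x₂ r) (x₄ r) i := by
  have hu : Measurable fun r => tetUnits (x₀ r) (x₂ r) (x₄ r) i := by
    fin_cases i
    · exact h₀
    · exact h₀.mul h₂
    · exact h₂
    · exact h₂.mul h₄
    · exact h₄
  unfold charArg
  split_ifs
  · exact (measurable_toUnit.comp ((measurableEmbedding_val.measurable.comp
      (hu.const_mul _)).const_sub 1)).mul_const _
  · exact measurable_const

theorem measurable_innerArg {β : Type*} [MeasurableSpace β] (A C : Fin 5 → Fˣ)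
    (S : Finset (Fin 5)) {x₀ x₂ x₄ : β → Fˣ} (h₀ : Measurable x₀) (h₂ : Measurable x₂)
    (h₄ : Measurable x₄) (k : Fin 3) :
    Measurable fun r => innerArg A C S (x₀ r) (x₂ r) (x₄ r) k := by
  have h := fun i => measurable_charArg A C S h₀ h₂ h₄ i
  fin_cases k
  · exact (h₄.mul (h 1)).div (h 0)
  · exact ((h 1).mul (h 3)).div (h 2)
  · exact (h₀.mul (h 3)).div (h 4)

variable [MeasurableSpace (PontryaginDual Fˣ)] [BorelSpace (PontryaginDual Fˣ)]
  {μ : Measure F} [μ.IsAddHaarMeasure] {ν : Measure (PontryaginDual Fˣ)} [ν.IsHaarMeasure]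

/-- S is the side under the integral and T the other one; their signs are opposite, which is why one
exponent s serves both. The hypotheses `hin` and `hout` only rewrite the characters of z₀, z₂, z₄ in
terms of those of p, q, n. -/
theorem identity_of_kernelConcentrates (hν : IsDualMeasure (unitsMeasure μ) ν)
    {f : GaussGroup F → GaussGroup F → ℂ} (hf : IsTestFunction ν f)
    {a c : Fin 5 → AngleGroup F} {ε : Fin 5 → ℤˣ} {S T : Finset (Fin 5)} {s : ℤˣ}
    (hS : ∀ i ∈ S, (ε i : ℤ) = s * (-1) ^ (i : ℕ)) (hT : ∀ i ∈ T, (ε i : ℤ) = -s * (-1) ^ (i : ℕ))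
    {A C : Fin 5 → Fˣ} (hA : A = fun i => (a i).2.toMul ^ (ε i : ℤ))
    (hC : C = fun i => (c i).2.toMul ^ (ε i : ℤ))
    (Z₀ Z₂ Z₄ : GaussGroup F → GaussGroup F → GaussGroup F → GaussGroup F)
    {x₀ x₂ x₄ : Fˣ → Fˣ → Fˣ → Fˣ} {P Q N : Fˣ → Fˣ → Fˣ → Fˣ} {P₀ Q₀ : Fˣ → Fˣ → Fˣ}
    (K : KernelConcentrates (unitsMeasure μ) P Q N
      (fun x y z => sideModulus (fun i => (a i).1) (fun i => (c i).1) A S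
        (x₀ x y z) (x₂ x y z) (x₄ x y z)) P₀ Q₀
      (fun x y => sideModulus (fun i => (a i).1) (fun i => (c i).1) A T
        (x₀ x y 1) (x₂ x y 1) (x₄ x y 1)))
    (h₀ : ∀ p q n, (Z₀ p q n).2 = x₀ p.2 q.2 n.2) (h₂ : ∀ p q n, (Z₂ p q n).2 = x₂ p.2 q.2 n.2)
    (h₄ : ∀ p q n, (Z₄ p q n).2 = x₄ p.2 q.2 n.2)
    (hin : ∀ p q n : GaussGroup F,
      ((Z₀ p q n).1 (innerArg A C S (x₀ p.2 q.2 n.2) (x₂ p.2 q.2 n.2) (x₄ p.2 q.2 n.2) 0) *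
        (Z₂ p q n).1 (innerArg A C S (x₀ p.2 q.2 n.2) (x₂ p.2 q.2 n.2) (x₄ p.2 q.2 n.2) 1) *
        (Z₄ p q n).1 (innerArg A C S (x₀ p.2 q.2 n.2) (x₂ p.2 q.2 n.2) (x₄ p.2 q.2 n.2) 2)) ^
          (s : ℤ) = p.1 (P p.2 q.2 n.2) * q.1 (Q p.2 q.2 n.2) * n.1 (N p.2 q.2 n.2))
    (hout : ∀ p q : GaussGroup F,
      ((Z₀ p q 1).1 (outerArg A C T (x₀ p.2 q.2 1) (x₂ p.2 q.2 1) (x₄ p.2 q.2 1) 0) *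
        (Z₂ p q 1).1 (outerArg A C T (x₀ p.2 q.2 1) (x₂ p.2 q.2 1) (x₄ p.2 q.2 1) 1) *
        (Z₄ p q 1).1 (outerArg A C T (x₀ p.2 q.2 1) (x₂ p.2 q.2 1) (x₄ p.2 q.2 1) 2)) ^
          (s : ℤ) = p.1 (P₀ p.2 q.2) * q.1 (Q₀ p.2 q.2))
    (hN : Measurable fun r : Fˣ × Fˣ × Fˣ => N r.1 r.2.1 r.2.2) :
    PairingConverges (unitsMeasure μ) ν f (fun p q => ∏ i ∈ T, PsiSign (ε i) (a i) (c i)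
      (tetVars (Z₀ p q 1) (Z₂ p q 1) (Z₄ p q 1) i)) ∧
    HasImproperIntegral (unitsMeasure μ) ν f
      (fun p q n => ((pairing (Z₀ p q n) (Z₄ p q n) ^ (s : ℤ) : Circle) : ℂ) *
        ∏ i ∈ S, PsiSign (ε i) (a i) (c i) (tetVars (Z₀ p q n) (Z₂ p q n) (Z₄ p q n) i))
      (distPairing (unitsMeasure μ) ν f fun p q => ∏ i ∈ T, PsiSign (ε i) (a i) (c i)
        (tetVars (Z₀ p q 1) (Z₂ p q 1) (Z₄ p q 1) i)) := by
  subst hA hC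
  refine hasImproperIntegral_of_concentrates hν hf (fun α β γ x y z => ?_) (fun α β x y => ?_) hN
    (K _ hf.continuous_partialTransform hf.compactSupport)
  · rw [pairing_mul_prod_psiSign _ _ _ hS, h₀, h₂, h₄, hin]
    simp only [Circle.coe_mul]
  · rw [prod_psiSign_outer _ _ _ hT, h₀, h₂, h₄]
    simp only [Prod.snd_one]
    rw [hout (α, x) (β, y)]
    simp only [Circle.coe_mul]

theorem pentagonIdentity_of_anglesMatch (hν : IsDualMeasure (unitsMeasure μ) ν)
    (σ : Equiv.Perm (Fin 5)) (a c : Fin 5 → AngleGroup F) (hmatch : AnglesMatch σ a c) :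
    PentagonIdentity (unitsMeasure μ) ν σ a c := by
  intro f hf
  obtain ⟨i, hi⟩ : ∃ i, i = min (σ 1) (σ 3) := ⟨_, rfl⟩
  obtain ⟨j, hj⟩ : ∃ j, j = max (σ 1) (σ 3) := ⟨_, rfl⟩
  have hij : i < j := by
    rw [hi, hj]
    exact min_lt_max.2 fun e => absurd (σ.injective e) (by decide)
  have hI : twoSide σ = {i, j} := by rw [twoSide_eq, hi, hj]
  have hv : ∀ p q n : GaussGroup F, vars σ p q n = pentagonVars i j p q n := by
    intro p q n
    rw [hi, hj]
    rfl
  have hε : ∀ k, (tetSign σ k : ℤ) =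
      -(Equiv.Perm.sign σ : ℤ) * (-1) ^ (k : ℕ) * sideSign {i, j} k := by
    intro k
    rw [tetSign_eq, hI, sideSign]
    split_ifs <;> simp
  unfold AnglesMatch at hmatch
  rw [hI] at hmatch
  have pat := anglePattern_of_match hmatch hε
  have real := real_relations hmatch
  have h₁ : ∀ k ∈ ({i, j} : Finset (Fin 5))ᶜ, (tetSign σ k : ℤ) =
      (Equiv.Perm.sign σ : ℤ) * (-1) ^ (k : ℕ) := fun k hk => by
    rw [hε, sideSign, if_neg (Finset.mem_compl.1 hk)]
    ring
  have h₂ : ∀ k ∈ ({i, j} : Finset (Fin 5)), (tetSign σ k : ℤ) =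
      -(Equiv.Perm.sign σ : ℤ) * (-1) ^ (k : ℕ) := fun k hk => by
    rw [hε, sideSign, if_pos hk, mul_one]
  have hdiv : ∀ (p q : GaussGroup F) (t : Fˣ), (p / q).1 t = p.1 t / q.1 t := fun _ _ _ => by
    rw [div_eq_mul_inv]
    rfl
  have hone : ∀ t : Fˣ, (1 : GaussGroup F).1 t = 1 := fun _ => rfl
  have hcases : ∀ i j : Fin 5, i < j → (i = 0 ∧ j = 1) ∨ (i = 0 ∧ j = 2) ∨ (i = 1 ∧ j = 2) ∨
      (i = 3 ∧ j = 4) ∨ (i = 0 ∧ j = 3) ∨ (i = 0 ∧ j = 4) ∨ (i = 1 ∧ j = 3) ∨ (i = 1 ∧ j = 4) ∨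
      (i = 2 ∧ j = 3) ∨ (i = 2 ∧ j = 4) := by decide
  simp only [hv, hI, relPhase, sideWeight]
  clear hv hI hi hj hmatch hε
  rcases hcases i j hij with ⟨rfl, rfl⟩ | ⟨rfl, rfl⟩ | ⟨rfl, rfl⟩ | ⟨rfl, rfl⟩ | ⟨rfl, rfl⟩ |
    ⟨rfl, rfl⟩ | ⟨rfl, rfl⟩ | ⟨rfl, rfl⟩ | ⟨rfl, rfl⟩ | ⟨rfl, rfl⟩
  all_goals
    obtain ⟨r₁, r₂, r₃, r₄, r₅⟩ := real
    simp only [sideSign, Finset.mem_insert, Finset.mem_singleton, Fin.reduceEq, or_false, or_true,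
      or_self, if_true, if_false, Int.cast_one, Int.cast_neg] at r₁ r₂ r₃ r₄ r₅
  -- The edge 01 is among the five without an angle b, so `r₂` keeps the value -2 and the other four
  -- right sides vanish. The pairs 34, 12, 04 and 23 behave likewise.
  · rw [if_neg (by decide)] at r₁ r₃ r₄ r₅
    have K := kernelConcentrates_pentagon_zero_one (μ := μ) pat (Equiv.Perm.sign σ)
      (a := fun i => (a i).1) (c := fun i => (c i).1)
      (by linarith) (by linarith) (by linarith) (by linarith) (by linarith)
    rw [if_neg (by decide)]
    refine identity_of_kernelConcentrates (s := (Equiv.Perm.sign σ)) hν hf h₁ h₂ rfl rfl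
      -- As z₂ = q/p, the character of p has the argument of z₀ divided by that of z₂.
      (fun p _ _ => p) (fun p q _ => q / p) (fun _ _ n => n) K
      (x₀ := (fun x _ _ => x)) (x₂ := (fun x y _ => y / x)) (x₄ := (fun _ _ z => z))
      (fun _ _ _ => rfl) (fun _ _ _ => rfl) (fun _ _ _ => rfl) (fun p q n => ?_) (fun p q => ?_) ?_
    · simp only [hdiv, map_zpow, map_div, map_mul, ← mul_zpow]
      congr 1
      apply Additive.ofMul.injective
      simp only [ofMul_mul, ofMul_div]
      abel
    · simp only [hdiv, hone, map_zpow, map_div, map_mul, ← mul_zpow, div_one]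
      congr 1
      apply Additive.ofMul.injective
      simp only [ofMul_mul, ofMul_div, ofMul_one]
      abel
    · have hm := fun k => measurable_innerArg (fun i => (a i).2.toMul ^ (tetSign σ i : ℤ))
        (fun i => (c i).2.toMul ^ (tetSign σ i : ℤ)) {0, 1}ᶜ
        (β := Fˣ × Fˣ × Fˣ) measurable_fst (measurable_snd.fst.div measurable_fst) measurable_snd.snd k
      fun_prop
  · rw [if_neg (by decide)] at r₁ r₂ r₃ r₄ r₅
    have K := kernelConcentrates_pentagon_zero_two (μ := μ) pat (Equiv.Perm.sign σ)
      (a := fun i => (a i).1) (c := fun i => (c i).1)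
      (by linarith) (by linarith) (by linarith) (by linarith) (by linarith)
    rw [if_neg (by decide)]
    refine identity_of_kernelConcentrates (s := (Equiv.Perm.sign σ)) hν hf h₁ h₂ rfl rfl
      (fun p _ _ => p) (fun _ q _ => q) (fun _ _ n => n) K
      (x₀ := (fun x _ _ => x)) (x₂ := (fun _ y _ => y)) (x₄ := (fun _ _ z => z))
      (fun _ _ _ => rfl) (fun _ _ _ => rfl) (fun _ _ _ => rfl) (fun p q n => ?_) (fun p q => ?_) ?_
    · simp only [map_zpow, ← mul_zpow]
    · simp only [hdiv, hone, map_zpow, map_div, map_mul, ← mul_zpow, div_one]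
      congr 1
      apply Additive.ofMul.injective
      simp only [ofMul_mul, ofMul_div, ofMul_one]
      abel
    · have hm := fun k => measurable_innerArg (fun i => (a i).2.toMul ^ (tetSign σ i : ℤ))
        (fun i => (c i).2.toMul ^ (tetSign σ i : ℤ)) {0, 2}ᶜ
        (β := Fˣ × Fˣ × Fˣ) measurable_fst measurable_snd.fst measurable_snd.snd k
      fun_prop
  · rw [if_neg (by decide)] at r₁ r₂ r₃ r₅
    have K := kernelConcentrates_pentagon_one_two (μ := μ) pat (Equiv.Perm.sign σ)
      (a := fun i => (a i).1) (c := fun i => (c i).1)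
      (by linarith) (by linarith) (by linarith) (by linarith) (by linarith)
    rw [if_neg (by decide)]
    refine identity_of_kernelConcentrates (s := (Equiv.Perm.sign σ)) hν hf h₁ h₂ rfl rfl
      (fun p q _ => p / q) (fun _ q _ => q) (fun _ _ n => n) K
      (x₀ := (fun x y _ => x / y)) (x₂ := (fun _ y _ => y)) (x₄ := (fun _ _ z => z))
      (fun _ _ _ => rfl) (fun _ _ _ => rfl) (fun _ _ _ => rfl) (fun p q n => ?_) (fun p q => ?_) ?_
    · simp only [hdiv, map_zpow, map_div, map_mul, ← mul_zpow]
      congr 1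
      apply Additive.ofMul.injective
      simp only [ofMul_mul, ofMul_div]
      abel
    · simp only [hdiv, hone, map_zpow, map_div, map_mul, ← mul_zpow, div_one]
      congr 1
      apply Additive.ofMul.injective
      simp only [ofMul_mul, ofMul_div, ofMul_one]
      abel
    · have hm := fun k => measurable_innerArg (fun i => (a i).2.toMul ^ (tetSign σ i : ℤ))
        (fun i => (c i).2.toMul ^ (tetSign σ i : ℤ)) {1, 2}ᶜ
        (β := Fˣ × Fˣ × Fˣ) (measurable_fst.div measurable_snd.fst) measurable_snd.fst measurable_snd.snd k
      fun_prop
  · rw [if_neg (by decide)] at r₂ r₃ r₄ r₅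
    -- For the pair 34 the side with two tetrahedra is integrated, so the roles of the sides are
    -- exchanged and sgn(σ) is replaced by its negative.
    have K := kernelConcentrates_pentagon_three_four (μ := μ) pat (-Equiv.Perm.sign σ)
      (a := fun i => (a i).1) (c := fun i => (c i).1)
      (by linarith) (by linarith) (by linarith) (by linarith) (by linarith)
    rw [if_pos rfl]
    simp only [← zpow_neg, ← Units.val_neg]
    refine identity_of_kernelConcentrates (s := (-Equiv.Perm.sign σ)) hν hf
      (by simpa using h₂) (by simpa using h₁) rfl rfl
      (fun p _ _ => p) (fun _ q _ => q) (fun _ _ n => n) K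
      (x₀ := (fun x _ _ => x)) (x₂ := (fun _ y _ => y)) (x₄ := (fun _ _ z => z))
      (fun _ _ _ => rfl) (fun _ _ _ => rfl) (fun _ _ _ => rfl) (fun p q n => ?_) (fun p q => ?_) ?_
    · simp only [map_zpow, ← mul_zpow]
    · simp only [hdiv, hone, map_zpow, map_div, map_mul, ← mul_zpow, div_one]
      congr 1
      apply Additive.ofMul.injective
      simp only [ofMul_mul, ofMul_div, ofMul_one]
      abel
    · have hm := fun k => measurable_innerArg (fun i => (a i).2.toMul ^ (tetSign σ i : ℤ))
        (fun i => (c i).2.toMul ^ (tetSign σ i : ℤ)) {3, 4}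
        (β := Fˣ × Fˣ × Fˣ) measurable_fst measurable_snd.fst measurable_snd.snd k
      fun_prop
  · rw [if_neg (by decide)] at r₁ r₂ r₃ r₄ r₅
    have K := kernelConcentrates_pentagon_zero_three (μ := μ) pat (Equiv.Perm.sign σ)
      (a := fun i => (a i).1) (c := fun i => (c i).1)
      (by linarith) (by linarith) (by linarith) (by linarith) (by linarith)
    rw [if_neg (by decide)]
    refine identity_of_kernelConcentrates (s := (Equiv.Perm.sign σ)) hν hf h₁ h₂ rfl rfl
      (fun p _ _ => p) (fun _ _ n => n) (fun _ q n => q / n) K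
      (x₀ := (fun x _ _ => x)) (x₂ := (fun _ _ z => z)) (x₄ := (fun _ y z => y / z))
      (fun _ _ _ => rfl) (fun _ _ _ => rfl) (fun _ _ _ => rfl) (fun p q n => ?_) (fun p q => ?_) ?_
    · simp only [hdiv, map_zpow, map_div, map_mul, ← mul_zpow]
      congr 1
      apply Additive.ofMul.injective
      simp only [ofMul_mul, ofMul_div]
      abel
    · simp only [hdiv, hone, map_zpow, map_div, map_mul, ← mul_zpow, div_one]
      congr 1
      apply Additive.ofMul.injective
      simp only [ofMul_mul, ofMul_div, ofMul_one]
      abel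
    · have hm := fun k => measurable_innerArg (fun i => (a i).2.toMul ^ (tetSign σ i : ℤ))
        (fun i => (c i).2.toMul ^ (tetSign σ i : ℤ)) {0, 3}ᶜ
        (β := Fˣ × Fˣ × Fˣ) measurable_fst measurable_snd.snd (measurable_snd.fst.div measurable_snd.snd) k
      fun_prop
  · rw [if_neg (by decide)] at r₁ r₂ r₄ r₅
    have K := kernelConcentrates_pentagon_zero_four (μ := μ) pat (Equiv.Perm.sign σ)
      (a := fun i => (a i).1) (c := fun i => (c i).1)
      (by linarith) (by linarith) (by linarith) (by linarith) (by linarith)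
    rw [if_neg (by decide)]
    refine identity_of_kernelConcentrates (s := (Equiv.Perm.sign σ)) hν hf h₁ h₂ rfl rfl
      (fun p _ _ => p) (fun _ _ n => n) (fun _ q _ => q) K
      (x₀ := (fun x _ _ => x)) (x₂ := (fun _ _ z => z)) (x₄ := (fun _ y _ => y))
      (fun _ _ _ => rfl) (fun _ _ _ => rfl) (fun _ _ _ => rfl) (fun p q n => ?_) (fun p q => ?_) ?_
    · simp only [hdiv, map_zpow, map_div, map_mul, ← mul_zpow]
      congr 1
      apply Additive.ofMul.injective
      simp only [ofMul_mul, ofMul_div]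
      abel
    · simp only [hdiv, hone, map_zpow, map_div, map_mul, ← mul_zpow, div_one]
      congr 1
      apply Additive.ofMul.injective
      simp only [ofMul_mul, ofMul_div, ofMul_one]
      abel
    · have hm := fun k => measurable_innerArg (fun i => (a i).2.toMul ^ (tetSign σ i : ℤ))
        (fun i => (c i).2.toMul ^ (tetSign σ i : ℤ)) {0, 4}ᶜ
        (β := Fˣ × Fˣ × Fˣ) measurable_fst measurable_snd.snd measurable_snd.fst k
      fun_prop
  · rw [if_neg (by decide)] at r₁ r₂ r₃ r₄ r₅
    have K := kernelConcentrates_pentagon_one_three (μ := μ) pat (Equiv.Perm.sign σ)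
      (a := fun i => (a i).1) (c := fun i => (c i).1)
      (by linarith) (by linarith) (by linarith) (by linarith) (by linarith)
    rw [if_neg (by decide)]
    refine identity_of_kernelConcentrates (s := (Equiv.Perm.sign σ)) hν hf h₁ h₂ rfl rfl
      (fun p _ n => p / n) (fun _ _ n => n) (fun _ q n => q / n) K
      (x₀ := (fun x _ z => x / z)) (x₂ := (fun _ _ z => z)) (x₄ := (fun _ y z => y / z))
      (fun _ _ _ => rfl) (fun _ _ _ => rfl) (fun _ _ _ => rfl) (fun p q n => ?_) (fun p q => ?_) ?_
    · simp only [hdiv, map_zpow, map_div, map_mul, ← mul_zpow]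
      congr 1
      apply Additive.ofMul.injective
      simp only [ofMul_mul, ofMul_div]
      abel
    · simp only [hdiv, hone, map_zpow, map_div, map_mul, ← mul_zpow, div_one]
      congr 1
      apply Additive.ofMul.injective
      simp only [ofMul_mul, ofMul_div, ofMul_one]
      abel
    · have hm := fun k => measurable_innerArg (fun i => (a i).2.toMul ^ (tetSign σ i : ℤ))
        (fun i => (c i).2.toMul ^ (tetSign σ i : ℤ)) {1, 3}ᶜ
        (β := Fˣ × Fˣ × Fˣ) (measurable_fst.div measurable_snd.snd) measurable_snd.snd (measurable_snd.fst.div measurable_snd.snd) k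
      fun_prop
  · rw [if_neg (by decide)] at r₁ r₂ r₃ r₄ r₅
    have K := kernelConcentrates_pentagon_one_four (μ := μ) pat (Equiv.Perm.sign σ)
      (a := fun i => (a i).1) (c := fun i => (c i).1)
      (by linarith) (by linarith) (by linarith) (by linarith) (by linarith)
    rw [if_neg (by decide)]
    refine identity_of_kernelConcentrates (s := (Equiv.Perm.sign σ)) hν hf h₁ h₂ rfl rfl
      (fun p _ n => p / n) (fun _ _ n => n) (fun _ q _ => q) K
      (x₀ := (fun x _ z => x / z)) (x₂ := (fun _ _ z => z)) (x₄ := (fun _ y _ => y))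
      (fun _ _ _ => rfl) (fun _ _ _ => rfl) (fun _ _ _ => rfl) (fun p q n => ?_) (fun p q => ?_) ?_
    · simp only [hdiv, map_zpow, map_div, map_mul, ← mul_zpow]
      congr 1
      apply Additive.ofMul.injective
      simp only [ofMul_mul, ofMul_div]
      abel
    · simp only [hdiv, hone, map_zpow, map_div, map_mul, ← mul_zpow, div_one]
      congr 1
      apply Additive.ofMul.injective
      simp only [ofMul_mul, ofMul_div, ofMul_one]
      abel
    · have hm := fun k => measurable_innerArg (fun i => (a i).2.toMul ^ (tetSign σ i : ℤ))
        (fun i => (c i).2.toMul ^ (tetSign σ i : ℤ)) {1, 4}ᶜ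
        (β := Fˣ × Fˣ × Fˣ) (measurable_fst.div measurable_snd.snd) measurable_snd.snd measurable_snd.fst k
      fun_prop
  · rw [if_neg (by decide)] at r₁ r₂ r₃ r₄
    have K := kernelConcentrates_pentagon_two_three (μ := μ) pat (Equiv.Perm.sign σ)
      (a := fun i => (a i).1) (c := fun i => (c i).1)
      (by linarith) (by linarith) (by linarith) (by linarith) (by linarith)
    rw [if_neg (by decide)]
    refine identity_of_kernelConcentrates (s := (Equiv.Perm.sign σ)) hν hf h₁ h₂ rfl rfl
      (fun _ _ n => n) (fun p _ _ => p) (fun p q _ => q / p) K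
      (x₀ := (fun _ _ z => z)) (x₂ := (fun x _ _ => x)) (x₄ := (fun x y _ => y / x))
      (fun _ _ _ => rfl) (fun _ _ _ => rfl) (fun _ _ _ => rfl) (fun p q n => ?_) (fun p q => ?_) ?_
    · simp only [hdiv, map_zpow, map_div, map_mul, ← mul_zpow]
      congr 1
      apply Additive.ofMul.injective
      simp only [ofMul_mul, ofMul_div]
      abel
    · simp only [hdiv, hone, map_zpow, map_div, map_mul, ← mul_zpow, div_one]
      congr 1
      apply Additive.ofMul.injective
      simp only [ofMul_mul, ofMul_div, ofMul_one]
      abel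
    · have hm := fun k => measurable_innerArg (fun i => (a i).2.toMul ^ (tetSign σ i : ℤ))
        (fun i => (c i).2.toMul ^ (tetSign σ i : ℤ)) {2, 3}ᶜ
        (β := Fˣ × Fˣ × Fˣ) measurable_snd.snd measurable_fst (measurable_snd.fst.div measurable_fst) k
      fun_prop
  · rw [if_neg (by decide)] at r₁ r₂ r₃ r₄ r₅
    have K := kernelConcentrates_pentagon_two_four (μ := μ) pat (Equiv.Perm.sign σ)
      (a := fun i => (a i).1) (c := fun i => (c i).1)
      (by linarith) (by linarith) (by linarith) (by linarith) (by linarith)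
    rw [if_neg (by decide)]
    refine identity_of_kernelConcentrates (s := (Equiv.Perm.sign σ)) hν hf h₁ h₂ rfl rfl
      (fun _ _ n => n) (fun p _ _ => p) (fun _ q _ => q) K
      (x₀ := (fun _ _ z => z)) (x₂ := (fun x _ _ => x)) (x₄ := (fun _ y _ => y))
      (fun _ _ _ => rfl) (fun _ _ _ => rfl) (fun _ _ _ => rfl) (fun p q n => ?_) (fun p q => ?_) ?_
    · simp only [hdiv, map_zpow, map_div, map_mul, ← mul_zpow]
      congr 1
      apply Additive.ofMul.injective
      simp only [ofMul_mul, ofMul_div]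
      abel
    · simp only [hdiv, hone, map_zpow, map_div, map_mul, ← mul_zpow, div_one]
      congr 1
      apply Additive.ofMul.injective
      simp only [ofMul_mul, ofMul_div, ofMul_one]
      abel
    · have hm := fun k => measurable_innerArg (fun i => (a i).2.toMul ^ (tetSign σ i : ℤ))
        (fun i => (c i).2.toMul ^ (tetSign σ i : ℤ)) {2, 4}ᶜ
        (β := Fˣ × Fˣ × Fˣ) measurable_snd.snd measurable_fst measurable_snd.fst k
      fun_prop

end Assembly

end OrderedPentagon

end

theorem proposition4p4 {F : Type*} [NontriviallyNormedField F] [ProperSpace F]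
    [MeasurableSpace F] [BorelSpace F] (μ : Measure F) [μ.IsAddHaarMeasure]
    [MeasurableSpace (PontryaginDual Fˣ)] [BorelSpace (PontryaginDual Fˣ)]
    (ν : Measure (PontryaginDual Fˣ)) [ν.IsHaarMeasure]
    (hν : OrderedPentagon.IsDualMeasure (OrderedPentagon.unitsMeasure μ) ν)
    (σ : Equiv.Perm (Fin 5)) (a c : Fin 5 → OrderedPentagon.AngleGroup F)
    (hnonneg : OrderedPentagon.AnglesNonneg a c) (hmatch : OrderedPentagon.AnglesMatch σ a c) :
    OrderedPentagon.PentagonIdentity (OrderedPentagon.unitsMeasure μ) ν σ a c :=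
  OrderedPentagon.pentagonIdentity_of_anglesMatch hν σ a c hmatch
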